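/- Let $p>2$ be a prime, $n\ge 1$ an integer with $p>n$, $q=p^a$ with $a\ge 1$, $t\in\mathbb F_q^*$, and $f_t(x,y)=x^n+y+\frac{t}{xy}$. Normalize $\operatorname{ord}_p$ on $\mathbb C_p$ by $\operatorname{ord}_p p=1$. Let $\mathbb Q_q$ be the unramified extension of $\mathbb Q_p$ of degree $a$ in $\mathbb C_p$, $\mathbb Z_q$ its ring of integers, $\bar t\in\mathbb Z_q$ the Teichmüller lift of $t$, and $\zeta_p\in\mathbb C_p$ a primitive $p$-th root of unity. Let $\gamma\in\mathbb Q_p(\zeta_p)$ be a zero of $\sum_{k\ge0}x^{p^k}/p^k$ with $\operatorname{ord}_p\gamma=\frac1{p-1}$, let $\tilde\gamma\in\mathbb C_p$ satisfy $\tilde\gamma^{\,n}=\gamma$, and put $R=\mathbb Z_q[\tilde\gamma]$. Let $\sigma$ be the automorphism of $\mathbb Q_q(\zeta_p,\tilde\gamma)$ that fixes $\zeta_p$ and $\tilde\gamma$ and restricts to the Frobenius on $\mathbb Q_q$. For $(a,b)\in\mathbb Z^2$ put $\omega(a,b)=\frac an+b+\frac{2n+1}n\max\{0,-a,-b\}$,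 and let $$\mathcal C_0=\Big\{\sum_{(a,b)\in\mathbb Z^2}\xi(a,b)\,\tilde\gamma^{\,n\omega(a,b)}x^ay^b\ :\ \xi(a,b)\in R,\ |\xi(a,b)|_p\to0\text{ as }\omega(a,b)\to\infty\Big\}.$$ Let $\Theta_\infty(x)=\exp\big(\sum_{k\ge0}(\gamma x)^{p^k}/p^k\big)$, let $F_t(x,y)=\Theta_\infty(x^n)\,\Theta_\infty(y)\,\Theta_\infty\big(\frac{\bar t}{xy}\big)$, and let $\alpha_1=\sigma^{-1}\circ\psi_p\circ F_t$ on $\mathcal C_0$, where $F_t$ acts by multiplication, $\psi_p\big(\sum c(a,b)x^ay^b\big)=\sum c(pa,pb)x^ay^b$, and $\sigma^{-1}$ acts on coefficients. With $\gamma_i=\sum_{k=0}^i\gamma^{p^k}/p^k$, let $$D_x=x\frac{\partial}{\partial x}+\sum_{i\ge0}\gamma_ip^i\Big(nx^{np^i}-\frac{\sigma^i(\bar t)}{x^{p^i}y^{p^i}}\Big),\qquad D_y=y\frac{\partial}{\partial y}+\sum_{i\ge0}\gamma_ip^i\Big(y^{p^i}-\frac{\sigma^i(\bar t)}{x^{p^i}y^{p^i}}\Big),$$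 and $H^2=\mathcal C_0/(D_x\mathcal C_0+D_y\mathcal C_0)$. Put $\tilde\varepsilon_i=\tilde\gamma^{\,i}x^i$ for $0\le i\le n$ and $\tilde\varepsilon_i=\tilde\gamma^{\,i}x^{i-n}y$ for $n+1\le i\le 2n$. Then there is exactly one matrix $A=(A_{ij})_{0\le i,j\le 2n}$ with entries in $R$ such that $\alpha_1(\tilde\varepsilon_i)=\sum_{j=0}^{2n}A_{ij}\tilde\varepsilon_j$ in $H^2$ for all $0\le i\le 2n$. Moreover, if $\det(I-AT)=1+b_1T+\cdots+b_{2n+1}T^{2n+1}$, then $$\operatorname{ord}_pb_m=\frac{m(m-1)}{2n}\qquad\text{for } m=1,\ n,\ n+1,\ 2n,\ 2n+1.$$ -/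

import Mathlib

noncomputable section

namespace DworkFamily

/-! ### Fields and rings inside `ℂ_[p]`, with `q = p ^ a` -/

/-- The additive valuation with `ord_p p = 1` attached to the absolute value, `ord_p 0 = ⊤`. -/
def ordp (p : ℕ) {K : Type*} [NormedField K] (z : K) : WithTop ℝ :=
  open Classical in
  if z = 0 then ⊤ else ((-Real.logb (p : ℝ) ‖z‖ : ℝ) : WithTop ℝ)

/-- `ℚ_q`, the unramified extension of `ℚ_p` of degree `a`: it is generated by the
roots of unity of order dividing `p ^ a - 1`. -/
def Qq (p : ℕ) [Fact p.Prime] (a : ℕ) : IntermediateField ℚ_[p] ℂ_[p] :=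
  IntermediateField.adjoin ℚ_[p] {z : ℂ_[p] | z ^ (p ^ a - 1) = 1}

/-- `ℤ_q`, the ring of integers of `ℚ_q`. -/
def Zq (p : ℕ) [Fact p.Prime] (a : ℕ) : Subring ℂ_[p] where
  carrier := {z | z ∈ Qq p a ∧ ‖z‖ ≤ 1}
  one_mem' := ⟨one_mem _, by simp⟩
  zero_mem' := ⟨zero_mem _, by simp⟩
  mul_mem' := fun {x y} hx hy =>
    ⟨mul_mem hx.1 hy.1, by
      rw [norm_mul]; exact mul_le_one₀ hx.2 (norm_nonneg _) hy.2⟩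
  add_mem' := fun {x y} hx hy =>
    ⟨add_mem hx.1 hy.1,
      (PadicComplex.isNonarchimedean p x y).trans (max_le hx.2 hy.2)⟩
  neg_mem' := fun {x} hx => ⟨neg_mem hx.1, by rw [norm_neg]; exact hx.2⟩

/-- `ℤ_q[γ̃]`, for an element `g = γ̃` of `ℂ_p`. -/
def ZqAdjoin (p : ℕ) [Fact p.Prime] (a : ℕ) (g : ℂ_[p]) : Subring ℂ_[p] :=
  Subring.closure ((Zq p a : Set ℂ_[p]) ∪ {g})

/-- The field `Ω₀(γ̃) = ℚ_q(ζ_p, γ̃)`. -/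
def Omega (p : ℕ) [Fact p.Prime] (a : ℕ) (ζ g : ℂ_[p]) : IntermediateField ℚ_[p] ℂ_[p] :=
  IntermediateField.adjoin ℚ_[p] ({z : ℂ_[p] | z ^ (p ^ a - 1) = 1} ∪ {ζ, g})

/-- `γ̃` as an element of `Ω₀(γ̃)`. -/
def Omega.gen (p : ℕ) [Fact p.Prime] (a : ℕ) (ζ g : ℂ_[p]) : Omega p a ζ g :=
  ⟨g, IntermediateField.subset_adjoin _ _ (by simp)⟩

/-- The ring of integers `ℤ_q[γ̃]` of `Ω₀(γ̃)`, as a subset of `Ω₀(γ̃)`. -/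
def Omega.integers (p : ℕ) [Fact p.Prime] (a : ℕ) (ζ g : ℂ_[p]) : Set (Omega p a ζ g) :=
  {z | (z : ℂ_[p]) ∈ ZqAdjoin p a g}

/-- `τ` is the Teichmüller representative in `ℤ_q` of `t`, where `red` is the reduction
map from `ℤ_q` to its residue field `F` with `p ^ a` elements. -/
def IsTeichmuller (p : ℕ) [Fact p.Prime] (a : ℕ) {F : Type*} [Field F]
    (red : Zq p a →+* F) (t : F) (τ : ℂ_[p]) : Prop :=
  ∃ z : Zq p a, z ^ p ^ a = z ∧ red z = t ∧ (z : ℂ_[p]) = τ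

/-- `σ` is the extension to `Ω₀(γ̃)`, fixing `ζ_p` and `γ̃`, of the Frobenius automorphism
of `ℚ_q / ℚ_p` (which is the `p`-th power map on roots of unity of order prime to `p`). -/
structure IsFrobenius (p : ℕ) [Fact p.Prime] (a : ℕ) (ζ g : ℂ_[p])
    (σ : Omega p a ζ g ≃ₐ[ℚ_[p]] Omega p a ζ g) : Prop where
  map_root : ∀ θ : Omega p a ζ g, θ ^ (p ^ a - 1) = 1 → σ θ = θ ^ p
  map_zeta : ∀ z : Omega p a ζ g, (z : ℂ_[p]) = ζ → σ z = z
  map_gen : σ (Omega.gen p a ζ g) = Omega.gen p a ζ g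

/-! ### The splitting function -/

/-- The logarithm `∑ x ^ (p ^ k) / p ^ k` of the Artin-Hasse series. -/
def artinHasseLog (p : ℕ) : PowerSeries ℚ :=
  open Classical in
  PowerSeries.mk fun m => if ∃ k : ℕ, m = p ^ k then (1 : ℚ) / m else 0

/-- The Artin-Hasse series `E(x) = exp (∑ x ^ (p ^ k) / p ^ k)`. -/
def artinHasse (p : ℕ) : PowerSeries ℚ :=
  (PowerSeries.exp ℚ).subst (artinHasseLog p)

/-- The coefficient `a_k` of the splitting function `Θ_∞(x) = E(γ x) = ∑ a_k x ^ k`. -/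
def thetaCoeff (p : ℕ) {K : Type*} [Field K] (γ : K) (k : ℕ) : K :=
  ((PowerSeries.coeff k (artinHasse p) : ℚ) : K) * γ ^ k

/-! ### Laurent series in `x, y`

A series `∑ c(a,b) x ^ a y ^ b` is given by its coefficients `c : ℤ × ℤ → K`. -/

section Series

variable {K : Type*} [NormedField K]

/-- `n` times the weight function `ω(a,b) = a / n + b + (2 n + 1) / n * max {0, -a, -b}`. -/
def nweight (n : ℕ) (u : ℤ × ℤ) : ℤ :=
  u.1 + n * u.2 + (2 * n + 1) * max 0 (max (-u.1) (-u.2))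

/-- The coefficient `B(a,b)` of `x ^ a y ^ b` in
`F_t(x,y) = Θ_∞(x ^ n) Θ_∞(y) Θ_∞(τ / (x y))`: the sum of `τ ^ k a_k a_l a_m` over all
`k, l, m ≥ 0` with `n l - k = a` and `m - k = b`. -/
def FtCoeff (p n : ℕ) (γ τ : K) (u : ℤ × ℤ) : K :=
  ∑' w : {w : ℕ × ℕ × ℕ //
      (n : ℤ) * w.2.1 - w.1 = u.1 ∧ (w.2.2 : ℤ) - w.1 = u.2},
    τ ^ w.1.1 * (thetaCoeff p γ w.1.1 * thetaCoeff p γ w.1.2.1 * thetaCoeff p γ w.1.2.2)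

/-- Multiplication of series by `F_t`. -/
def mulFt (p n : ℕ) (γ τ : K) (c : ℤ × ℤ → K) : ℤ × ℤ → K :=
  fun u => ∑' v : ℤ × ℤ, FtCoeff p n γ τ (u - v) * c v

/-- The operator `ψ_p : ∑ c(a,b) x ^ a y ^ b ↦ ∑ c(p a, p b) x ^ a y ^ b`. -/
def psi (p : ℕ) (c : ℤ × ℤ → K) : ℤ × ℤ → K :=
  fun u => c (p * u.1, p * u.2)

/-- The operator `α₁ = σ⁻¹ ∘ ψ_p ∘ F_t`, with `σ⁻¹` acting on coefficients. -/
def alpha1 (p n : ℕ) (γ τ : K) (σ : K ≃+* K) (c : ℤ × ℤ → K) : ℤ × ℤ → K :=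
  fun u => σ.symm (psi p (mulFt p n γ τ c) u)

/-- The partial sum `γ_i = ∑_{k ≤ i} γ ^ (p ^ k) / p ^ k`. -/
def gammaPartial (p : ℕ) (γ : K) (i : ℕ) : K :=
  ∑ k ∈ Finset.range (i + 1), γ ^ p ^ k / (p : K) ^ k

/-- `D_x = x ∂/∂x + ∑_i γ_i p ^ i (n x ^ (n p ^ i) - σ ^ i(τ) / (x ^ (p ^ i) y ^ (p ^ i)))`. -/
def Dx (p n : ℕ) (γ τ : K) (σ : K ≃+* K) (c : ℤ × ℤ → K) : ℤ × ℤ → K :=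
  fun u => (u.1 : K) * c u +
    ∑' i : ℕ, gammaPartial p γ i * (p : K) ^ i *
      ((n : K) * c (u.1 - n * p ^ i, u.2) - σ^[i] τ * c (u.1 + p ^ i, u.2 + p ^ i))

/-- `D_y = y ∂/∂y + ∑_i γ_i p ^ i (y ^ (p ^ i) - σ ^ i(τ) / (x ^ (p ^ i) y ^ (p ^ i)))`. -/
def Dy (p : ℕ) (γ τ : K) (σ : K ≃+* K) (c : ℤ × ℤ → K) : ℤ × ℤ → K :=
  fun u => (u.2 : K) * c u +
    ∑' i : ℕ, gammaPartial p γ i * (p : K) ^ i *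
      (c (u.1, u.2 - p ^ i) - σ^[i] τ * c (u.1 + p ^ i, u.2 + p ^ i))

/-- The space `C₀` of the series `∑ ξ(a,b) g ^ (n ω(a,b)) x ^ a y ^ b` with `ξ(a,b)` in the
ring `R` and `ξ(a,b) → 0` as `ω(a,b) → ∞`. As `ω` takes each bounded range of values at
finitely many points only, this is convergence along the cofinite filter. -/
def C0 (n : ℕ) (R : Set K) (g : K) : Set (ℤ × ℤ → K) :=
  {c | ∃ ξ : ℤ × ℤ → K, (∀ u, ξ u ∈ R) ∧
    Filter.Tendsto ξ Filter.cofinite (nhds 0) ∧ ∀ u, c u = ξ u * g ^ nweight n u}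

/-- The exponents of the monomials `ε_i`: `x ^ i` for `i ≤ n`, `x ^ (i - n) y` for `i > n`. -/
def epsExp (n i : ℕ) : ℤ × ℤ :=
  if i ≤ n then ((i : ℤ), 0) else ((i : ℤ) - n, 1)

/-- The series `ε̃_i = g ^ (n ω(ε_i)) ε_i`. -/
def epsTilde (n : ℕ) (g : K) (i : ℕ) : ℤ × ℤ → K :=
  Pi.single (epsExp n i) (g ^ nweight n (epsExp n i))

/-- `c` and `c'` have the same class in `H² = C₀ / (D_x C₀ + D_y C₀)`. -/
def CohomologousC0 (p n : ℕ) (R : Set K) (g γ τ : K) (σ : K ≃+* K)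
    (c c' : ℤ × ℤ → K) : Prop :=
  ∃ ξx ∈ C0 n R g, ∃ ξy ∈ C0 n R g, c - c' = Dx p n γ τ σ ξx + Dy p γ τ σ ξy

/-- `A` is the matrix of `α₁` on `H²` with respect to `ε̃_0, …, ε̃_{2n}`: its entries lie in
`R`, and `α₁(ε̃_i) = ∑_j A_{ij} ε̃_j` in `H²` for every `i`. -/
def IsFrobeniusMatrix (p n : ℕ) (R : Set K) (g γ τ : K) (σ : K ≃+* K)
    (A : Matrix (Fin (2 * n + 1)) (Fin (2 * n + 1)) K) : Prop :=
  (∀ i j, A i j ∈ R) ∧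
    ∀ i : Fin (2 * n + 1),
      CohomologousC0 p n R g γ τ σ (alpha1 p n γ τ σ (epsTilde n g i))
        (∑ j : Fin (2 * n + 1), A i j • epsTilde n g j)

end Series

end DworkFamily

end

noncomputable section

namespace DworkFamily

/-! ### Integrality of the Artin-Hasse series -/

section ArtinHasse

open PowerSeries

variable (p : ℕ)

/-! Write g for γ̃. Everything is measured by divisibility by g, where ‖p‖ = ‖g‖ ^ (n(p-1)). The
ring R turns out to be the closed unit ball of Ω₀(γ̃) (`integers_eq`), because ℚ_q is unramified
over ℚ_p and γ ^ (p-1) lies in ℚ_p. After that only the properties collected in `FrobeniusData` are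
used.

The three rays through (n,0), (0,1), (-1,-1) cut the plane into three cones, and nω is the function,
linear on each cone, that equals n at these points. Let X, Y, Z be the corresponding monomials. The
number γ_i is minus the tail of a series with sum 0, so the terms i ≥ 1 of D_x and D_y are
negligible (`ordGE_kappa`). The parts of D_x and D_y that raise the weight by n therefore reduce,
modulo g, to nX - τZ and Y - τZ on the graded ring in which monomials without a common cone multiply
to 0.

Two facts about that ring carry the cohomology. Modulo the two leading forms it is spanned by the
ε_i, one in each weight 0, …, 2n (`decomposable_single`). The Koszul complex of the forms has no
homology in the middle, even when the image is only required to vanish off the ε_i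
(`isSyzygy_of_gradedOp`, `IsSyzygy.eq_potential`). Successive approximation in powers of g turns the
first fact into existence of A (`exists_reduction`) and the second into uniqueness
(`eq_zero_of_boundary`).

For the valuations, p-integrality of the Artin-Hasse series makes the coefficient of F_t at v
divisible by g ^ (nω(v)). Since ψ_p multiplies exponents by p, the coefficient of α₁(ε̃_i) at u is
divisible by g ^ (p·nω(u)). The reduction keeps this divisibility in weights up to 2n. As ε̃_j
already contains g ^ j, column j of A is divisible by g ^ ((p-1)j).

Let B be A with these factors removed. Its entries modulo g come from leading coefficients of F_t,
which are units when they are products of Artin-Hasse coefficients 1/k! with k < p. With the blocks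
{0}, {1,…,n-1}, {n}, {n+1,…,2n-1}, {2n}, the matrix B is block upper triangular modulo g. In its
diagonal blocks column j has its only unit in the row i ≡ pj mod n, and p is prime to n
(`exists_matrix`).

Finally, b_m is up to sign the sum over m-element sets S of ∏_{j∈S} g ^ ((p-1)j) times a minor of B.
The set {0,…,m-1} has strictly the least exponent m(m-1)/2, and its minor is a unit when m ends a
block, which is the case for the five listed values. Since g ^ (p-1) has order 1/n, the formula
follows. -/

theorem coeff_artinHasseLog_pow (k : ℕ) :
    coeff (p ^ k) (artinHasseLog p) = 1 / (p : ℚ) ^ k := by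
  classical
  simp only [artinHasseLog, coeff_mk]
  rw [if_pos ⟨k, rfl⟩]; simp

theorem coeff_artinHasseLog_of_ne {m : ℕ} (h : ∀ k, m ≠ p ^ k) :
    coeff m (artinHasseLog p) = 0 := by
  classical
  simp only [artinHasseLog, coeff_mk]
  rw [if_neg]; rintro ⟨k, hk⟩; exact h k hk

variable [hp : Fact p.Prime]

theorem constantCoeff_artinHasseLog : constantCoeff (artinHasseLog p) = 0 := by
  rw [← coeff_zero_eq_constantCoeff_apply]
  exact coeff_artinHasseLog_of_ne p fun k h => (pow_pos hp.out.pos k).ne h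

theorem hasSubst_artinHasseLog : HasSubst (artinHasseLog p) :=
  HasSubst.of_constantCoeff_zero' (constantCoeff_artinHasseLog p)

theorem derivative_artinHasse :
    d⁄dX ℚ (artinHasse p) = artinHasse p * d⁄dX ℚ (artinHasseLog p) := by
  rw [artinHasse, derivative_subst (hasSubst_artinHasseLog p), derivative_exp]

theorem constantCoeff_artinHasse : constantCoeff (artinHasse p) = 1 := by
  refine (constantCoeff_subst (hasSubst_artinHasseLog p) (exp ℚ)).trans ?_
  rw [finsum_eq_single _ 0]
  · simp
  · intro k hk
    rw [map_pow, show MvPowerSeries.constantCoeff (artinHasseLog p) = 0 from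
      constantCoeff_artinHasseLog p, zero_pow hk, smul_zero]

/-- Equal logarithmic derivatives make the quotient `F * G⁻¹` have derivative zero, so in
characteristic zero it equals its constant term. -/
theorem eq_of_derivative_eq_mul {K : Type*} [Field K] [CharZero K] {F G H : PowerSeries K}
    (hF : d⁄dX K F = F * H) (hG : d⁄dX K G = G * H)
    (hF0 : constantCoeff F = 1) (hG0 : constantCoeff G = 1) : F = G := by
  have hGne : constantCoeff G ≠ 0 := by rw [hG0]; exact one_ne_zero
  have h : F * G⁻¹ = 1 := by
    apply derivative.ext
    · rw [Derivation.leibniz, derivative_inv', hF, hG, Derivation.map_one_eq_zero]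
      have := PowerSeries.mul_inv_cancel G hGne
      simp only [smul_eq_mul]
      linear_combination (-F * G⁻¹ * H) * this
    · simp [hF0, hG0]
  calc F = F * G⁻¹ * G := by rw [mul_assoc, PowerSeries.inv_mul_cancel G hGne, mul_one]
    _ = G := by rw [h, one_mul]

/-- Substituting x ^ p shifts the index k by one, and the factor p restores the denominators; only
the term k = 0 is left over. -/
theorem natCast_mul_artinHasseLog :
    (p : ℚ⟦X⟧) * artinHasseLog p
      = expand p hp.out.ne_zero (artinHasseLog p) + (p : ℚ⟦X⟧) * X := by
  have hp0 : (p : ℚ) ≠ 0 := Nat.cast_ne_zero.mpr hp.out.ne_zero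
  ext m
  have hc : ((p : ℕ) : ℚ⟦X⟧) = C (p : ℚ) := by simp
  rw [map_add, hc, coeff_C_mul, coeff_C_mul, coeff_X]
  by_cases h : ∃ k, m = p ^ k
  · obtain ⟨k, rfl⟩ := h
    cases k with
    | zero =>
      rw [coeff_artinHasseLog_pow, coeff_expand_of_not_dvd]
      · simp
      · simpa using hp.out.one_lt.ne'
    | succ k =>
      have h1 : p ^ (k + 1) ≠ 1 := (Nat.one_lt_pow (by omega) hp.out.one_lt).ne'
      rw [coeff_artinHasseLog_pow, pow_succ' p k, coeff_expand_mul, coeff_artinHasseLog_pow,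
        if_neg (by rw [← pow_succ']; exact h1)]
      field_simp
      ring
  · push Not at h
    rw [coeff_artinHasseLog_of_ne p h, if_neg (by simpa using h 0)]
    by_cases hd : p ∣ m
    · obtain ⟨k, rfl⟩ := hd
      rw [coeff_expand_mul, coeff_artinHasseLog_of_ne]
      · simp
      · rintro i rfl
        exact h (i + 1) (pow_succ' p i).symm
    · rw [coeff_expand_of_not_dvd _ _ _ hd]; simp

/-- Dwork's functional equation `E(x)^p = E(x^p) exp(p x)`. -/
theorem artinHasse_pow :
    artinHasse p ^ p = expand p hp.out.ne_zero (artinHasse p) * rescale (p : ℚ) (exp ℚ) := by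
  have hL0 : constantCoeff (expand p hp.out.ne_zero (artinHasseLog p)) = 0 := by
    rw [constantCoeff_expand, constantCoeff_artinHasseLog]
  have hE : expand p hp.out.ne_zero (artinHasse p)
      = (exp ℚ).subst (expand p hp.out.ne_zero (artinHasseLog p)) := by
    rw [artinHasse]
    exact expand_subst p hp.out.ne_zero (hasSubst_artinHasseLog p) (exp ℚ)
  have hr : rescale (p : ℚ) (exp ℚ) = exp ℚ ^ p := (exp_pow_eq_rescale_exp p).symm
  have hD := congrArg (d⁄dX ℚ) (natCast_mul_artinHasseLog p)
  simp only [map_add, Derivation.leibniz, Derivation.map_natCast, smul_eq_mul, mul_zero,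
    add_zero, derivative_X, mul_one] at hD
  apply eq_of_derivative_eq_mul (H := (p : ℚ⟦X⟧) * d⁄dX ℚ (artinHasseLog p))
  · rw [derivative_pow, derivative_artinHasse]
    have := pow_sub_one_mul hp.out.ne_zero (artinHasse p)
    linear_combination ((p : ℚ⟦X⟧) * d⁄dX ℚ (artinHasseLog p)) * this
  · rw [Derivation.leibniz, hr, derivative_pow, derivative_exp, hE,
      derivative_subst (HasSubst.of_constantCoeff_zero' hL0), derivative_exp, hD]
    simp only [smul_eq_mul]
    have := pow_sub_one_mul hp.out.ne_zero (exp ℚ)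
    linear_combination ((p : ℚ⟦X⟧) *
      (exp ℚ).subst (expand p hp.out.ne_zero (artinHasseLog p))) * this
  · rw [map_pow, constantCoeff_artinHasse, one_pow]
  · rw [map_mul, constantCoeff_expand, constantCoeff_artinHasse, hr, map_pow]; simp

/-- Legendre's formula (p-1) v_p(j!) = j - s_p(j), with positive digit sum s_p(j), gives v_p(j!) <
j. Thus exp(px) is congruent to 1 modulo p. -/
theorem norm_pow_div_factorial_le {j : ℕ} (hj : j ≠ 0) :
    ‖((p : ℚ_[p]) ^ j / (j.factorial : ℚ_[p]))‖ ≤ ‖(p : ℚ_[p])‖ := by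
  have hj0 : j.factorial ≠ 0 := j.factorial_ne_zero
  have h1 : padicValNat p j.factorial + 1 ≤ j := by
    have h := sub_one_mul_padicValNat_factorial (p := p) j
    have h2 : 0 < (p.digits j).sum := by
      rw [Nat.pos_iff_ne_zero]
      intro h0
      apply hj
      rw [← Nat.ofDigits_digits p j]
      have : ∀ l : List ℕ, l.sum = 0 → Nat.ofDigits p l = 0 := by
        intro l
        induction l with
        | nil => simp
        | cons a l ih => intro h; simp at h; simp [Nat.ofDigits_cons, h.1, ih (by simpa using h.2)]
      exact this _ h0
    have h3 : padicValNat p j.factorial ≤ (p - 1) * padicValNat p j.factorial :=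
      Nat.le_mul_of_pos_left _ (by have := hp.out.two_le; omega)
    have h4 : 0 < j := Nat.pos_of_ne_zero hj
    omega
  obtain ⟨d, hd⟩ : ∃ d, j = padicValNat p j.factorial + 1 + d := ⟨_, (Nat.add_sub_of_le h1).symm⟩
  have hv : ‖(j.factorial : ℚ_[p])‖ = ‖(p : ℚ_[p])‖ ^ padicValNat p j.factorial := by
    have := Padic.norm_eq_zpow_neg_valuation (p := p) (x := (j.factorial : ℚ_[p]))
      (Nat.cast_ne_zero.mpr hj0)
    rw [this, Padic.norm_p, Padic.valuation_natCast]
    simp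
  have hpos : 0 < ‖(p : ℚ_[p])‖ := by
    rw [norm_pos_iff]; exact Nat.cast_ne_zero.mpr hp.out.ne_zero
  rw [norm_div, norm_pow, hv]
  have he : ‖(p : ℚ_[p])‖ ^ j = ‖(p : ℚ_[p])‖ ^ padicValNat p j.factorial *
      (‖(p : ℚ_[p])‖ * ‖(p : ℚ_[p])‖ ^ d) := by
    rw [← pow_succ', ← pow_add]; congr 1; omega
  rw [he, mul_div_cancel_left₀ _ (pow_pos hpos _).ne']
  exact mul_le_of_le_one_right hpos.le (pow_le_one₀ hpos.le (Padic.norm_p_lt_one.le))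

/-- Dwork's argument: let T be the truncation of E below degree m, integral by induction. In degree
m, E ^ p contributes the coefficient of T ^ p plus p times the unknown one, and E(x ^ p) exp(px) is
congruent to T(x ^ p) modulo p. Since T ^ p ≡ T(x ^ p) modulo p, the unknown coefficient times p is
divisible by p. -/
theorem exists_padicInt_coeff_artinHasse (m : ℕ) :
    ∃ z : ℤ_[p], (z : ℚ_[p]) = ((coeff m (artinHasse p) : ℚ) : ℚ_[p]) := by
  induction m using Nat.strong_induction_on with
  | _ m ih =>
  rcases Nat.eq_zero_or_pos m with rfl | hm
  · refine ⟨1, ?_⟩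
    rw [coeff_zero_eq_constantCoeff_apply, constantCoeff_artinHasse]; simp
  have hp0 : p ≠ 0 := hp.out.ne_zero
  choose! z hz using ih
  let ι : ℤ_[p] →+* ℚ_[p] := PadicInt.Coe.ringHom
  set E : ℚ_[p]⟦X⟧ := PowerSeries.map (Rat.castHom ℚ_[p]) (artinHasse p) with hE
  have hEc : ∀ k, coeff k E = ((coeff k (artinHasse p) : ℚ) : ℚ_[p]) := fun k => by
    rw [hE, coeff_map]; rfl
  let T : Polynomial ℤ_[p] := ∑ k ∈ Finset.range m, Polynomial.monomial k (z k)
  have hTc : ∀ k, T.coeff k = if k < m then z k else 0 := fun k => by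
    simp only [T, Polynomial.finsetSum_coeff, Polynomial.coeff_monomial]
    simp
  set T' : ℚ_[p]⟦X⟧ := ((T.map ι : Polynomial ℚ_[p]) : ℚ_[p]⟦X⟧) with hT'
  have hT'c : ∀ k, coeff k T' = ι (T.coeff k) := fun k => by
    rw [hT', Polynomial.coeff_coe, Polynomial.coeff_map]
  have hlow : ∀ k < m, coeff k T' = coeff k E := fun k hk => by
    rw [hT'c, hTc, if_pos hk, hEc, ← hz k hk]; rfl
  obtain ⟨S, hS⟩ : X ^ m ∣ E - T' := by
    rw [X_pow_dvd_iff]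
    intro k hk
    rw [map_sub, hlow k hk, sub_self]
  have hS0 : constantCoeff S = coeff m E := by
    have := congrArg (coeff m) hS
    rw [map_sub, hT'c, hTc, if_neg (lt_irrefl m), map_zero, sub_zero, coeff_X_pow_mul', if_pos le_rfl,
      Nat.sub_self, coeff_zero_eq_constantCoeff_apply] at this
    exact this.symm
  have hT0 : constantCoeff T' = 1 := by
    rw [← coeff_zero_eq_constantCoeff_apply, hlow 0 hm, hEc, coeff_zero_eq_constantCoeff_apply,
      constantCoeff_artinHasse]; simp
  -- Only the part linear in `X ^ m * S` matters: the quadratic remainder starts in degree 2m, and T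
  -- has constant term 1.
  have hpow : coeff m (E ^ p) = coeff m (T' ^ p) + p * coeff m E := by
    have h1 : E = T' + X ^ m * S := by rw [← hS]; ring
    obtain ⟨k, hk⟩ := Polynomial.powAddExpansion T' (X ^ m * S) p
    rw [h1, hk, ← h1, map_add, map_add]
    have h2 : (p : ℚ_[p]⟦X⟧) * T' ^ (p - 1) * (X ^ m * S)
        = X ^ m * ((p : ℚ_[p]⟦X⟧) * T' ^ (p - 1) * S) := by ring
    have h3 : k * (X ^ m * S) ^ 2 = X ^ (2 * m) * (k * S ^ 2) := by ring
    rw [h2, h3, coeff_X_pow_mul', if_pos le_rfl, Nat.sub_self, coeff_X_pow_mul',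
      if_neg (by omega), coeff_zero_eq_constantCoeff_apply, map_mul constantCoeff,
      map_mul constantCoeff, map_pow constantCoeff, hT0, hS0]
    simp
  have hfun : E ^ p = expand p hp0 E * PowerSeries.map (Rat.castHom ℚ_[p])
      (rescale (p : ℚ) (exp ℚ)) := by
    rw [hE, ← map_pow, artinHasse_pow, map_mul, map_expand]
  have hexpand : ∀ k ≤ m, coeff k (expand p hp0 E) = ι ((Polynomial.expand ℤ_[p] p T).coeff k) := by
    intro k hk
    rw [coeff_expand, Polynomial.coeff_expand hp.out.pos]
    split_ifs with hd
    · have : k / p < m := by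
        rcases Nat.eq_zero_or_pos k with rfl | hk0
        · simpa using hm
        · exact (Nat.div_lt_self hk0 hp.out.one_lt).trans_le hk
      rw [← hT'c, hlow _ this]
    · simp
  have hexp : ∀ j, coeff j (PowerSeries.map (Rat.castHom ℚ_[p]) (rescale (p : ℚ) (exp ℚ)))
      = (p : ℚ_[p]) ^ j / (j.factorial : ℚ_[p]) := fun j => by
    rw [coeff_map, coeff_rescale, coeff_exp]
    simp [div_eq_mul_inv]
  -- Over `ZMod p` the p-th power of a polynomial is its expansion by p.
  have hdvd : (p : ℤ_[p]) ∣ (Polynomial.expand ℤ_[p] p T).coeff m - (T ^ p).coeff m := by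
    rw [← Ideal.mem_span_singleton, ← PadicInt.maximalIdeal_eq_span_p, ← PadicInt.ker_toZMod,
      RingHom.mem_ker, map_sub, ← Polynomial.coeff_map, ← Polynomial.coeff_map,
      Polynomial.map_pow, Polynomial.map_expand, ZMod.expand_card, sub_self]
  have hnp : ∀ x : ℚ_[p], ‖(p : ℚ_[p]) * x‖ ≤ ‖(p : ℚ_[p])‖ → ‖x‖ ≤ 1 := fun x hx => by
    have hpos : 0 < ‖(p : ℚ_[p])‖ := by rw [norm_pos_iff]; exact Nat.cast_ne_zero.mpr hp0
    rw [norm_mul] at hx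
    exact le_of_mul_le_mul_left (by simpa using hx) hpos
  have key : ‖coeff m E‖ ≤ 1 := by
    apply hnp
    have h1 : (p : ℚ_[p]) * coeff m E
        = ι ((Polynomial.expand ℤ_[p] p T).coeff m - (T ^ p).coeff m)
          + ∑ x ∈ (Finset.HasAntidiagonal.antidiagonal m).erase (m, 0),
            coeff x.1 (expand p hp0 E) * ((p : ℚ_[p]) ^ x.2 / (x.2.factorial : ℚ_[p])) := by
      have h2 := hpow
      rw [hfun, coeff_mul] at h2
      simp only [hexp] at h2
      rw [← Finset.add_sum_erase _ _ (show (m, 0) ∈ Finset.HasAntidiagonal.antidiagonal m by simp)] at h2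
      have h3 : coeff m (T' ^ p) = ι ((T ^ p).coeff m) := by
        rw [hT', ← Polynomial.coe_pow, Polynomial.coeff_coe, ← Polynomial.map_pow,
          Polynomial.coeff_map]
      rw [hexpand m le_rfl, h3] at h2
      simp only [pow_zero, Nat.factorial_zero, Nat.cast_one, div_one, mul_one] at h2
      rw [map_sub]
      linear_combination -h2
    rw [h1]
    refine (IsUltrametricDist.norm_add_le_max _ _).trans (max_le ?_ ?_)
    · obtain ⟨w, hw⟩ := hdvd
      rw [hw, map_mul, norm_mul, map_natCast]
      exact mul_le_of_le_one_right (norm_nonneg _) (PadicInt.norm_le_one w)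
    · refine IsUltrametricDist.norm_sum_le_of_forall_le_of_nonneg (norm_nonneg _) ?_
      intro x hx
      simp only [Finset.mem_erase, Finset.HasAntidiagonal.mem_antidiagonal, ne_eq] at hx
      have hx2 : x.2 ≠ 0 := fun h => hx.1 (Prod.ext (by simpa [h] using hx.2) h)
      rw [hexpand x.1 (by omega), norm_mul]
      exact (mul_le_of_le_one_left (norm_nonneg _) (PadicInt.norm_le_one _)).trans
        (norm_pow_div_factorial_le p hx2)
  exact ⟨⟨_, key⟩, hEc m⟩

theorem norm_coeff_artinHasse_le (m : ℕ) :
    ‖((coeff m (artinHasse p) : ℚ) : ℚ_[p])‖ ≤ 1 := by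
  obtain ⟨z, hz⟩ := exists_padicInt_coeff_artinHasse p m
  rw [← hz]; exact PadicInt.norm_le_one z

/-- Below degree p the Artin-Hasse logarithm is just x, so the series agrees with the exponential
there. -/
theorem coeff_artinHasse_of_lt {k : ℕ} (hk : k < p) :
    coeff k (artinHasse p) = 1 / (k.factorial : ℚ) := by
  induction k with
  | zero => simp [constantCoeff_artinHasse]
  | succ k ih =>
    have h := congrArg (coeff k) (derivative_artinHasse p)
    rw [coeff_derivative, coeff_mul, Finset.sum_eq_single (k, 0)] at h
    · have h1 : coeff 1 (artinHasseLog p) = 1 := by simpa using coeff_artinHasseLog_pow p 0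
      rw [coeff_derivative, h1, ih (by omega)] at h
      rw [Nat.factorial_succ]
      have : (k.factorial : ℚ) ≠ 0 := Nat.cast_ne_zero.mpr k.factorial_ne_zero
      have : ((k : ℚ) + 1) ≠ 0 := by positivity
      push_cast at h ⊢
      field_simp at h ⊢
      linear_combination h
    · rintro ⟨i, j⟩ hij hne
      rw [Finset.HasAntidiagonal.mem_antidiagonal] at hij
      simp only at hij
      rw [coeff_derivative, coeff_artinHasseLog_of_ne]
      · simp
      · intro e he
        have hj : j ≠ 0 := by rintro rfl; exact hne (by simp at hij; simp [hij])
        cases e with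
        | zero => simp at he; exact hj he
        | succ e =>
          have : p ≤ p ^ (e + 1) := Nat.le_self_pow (by omega) p
          omega
    · simp

theorem norm_coeff_artinHasse_of_lt {k : ℕ} (hk : k < p) :
    ‖((coeff k (artinHasse p) : ℚ) : ℚ_[p])‖ = 1 := by
  rw [coeff_artinHasse_of_lt p hk]
  have : ‖((k.factorial : ℕ) : ℚ_[p])‖ = 1 := by
    rw [Padic.norm_natCast_eq_one_iff]
    exact (hp.out.coprime_iff_not_dvd.mpr fun h => by
      rw [hp.out.dvd_factorial] at h; omega)
  push_cast
  rw [norm_div, this]; simp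

end ArtinHasse

/-! ### The ring `ℤ_q` -/

section Unramified

variable (p : ℕ) [hp : Fact p.Prime]

theorem norm_algebraMap_padic (x : ℚ_[p]) : ‖algebraMap ℚ_[p] ℂ_[p] x‖ = ‖x‖ :=
  norm_algebraMap' ℂ_[p] x

theorem norm_natCast_prime : ‖(p : ℂ_[p])‖ = ‖(p : ℚ_[p])‖ := by
  rw [← norm_algebraMap_padic, map_natCast]

theorem norm_prime_pos : 0 < ‖(p : ℚ_[p])‖ := by
  rw [norm_pos_iff]; exact Nat.cast_ne_zero.mpr hp.out.ne_zero

variable (a : ℕ)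

/-- The roots of unity of order dividing `p ^ a - 1`. -/
def unityRoots : Finset ℂ_[p] := Polynomial.nthRootsFinset (p ^ a - 1) (1 : ℂ_[p])

variable {p a}

theorem pow_sub_one_pos (ha : 0 < a) : 0 < p ^ a - 1 := by
  have := Nat.one_lt_pow ha.ne' hp.out.one_lt
  omega

theorem mem_unityRoots (ha : 0 < a) {z : ℂ_[p]} :
    z ∈ unityRoots p a ↔ z ^ (p ^ a - 1) = 1 := by
  rw [unityRoots, Polynomial.mem_nthRootsFinset (pow_sub_one_pos ha)]

theorem norm_of_pow_eq_one {z : ℂ_[p]} {m : ℕ} (hm : 0 < m) (hz : z ^ m = 1) : ‖z‖ = 1 := by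
  have h : ‖z‖ ^ m = 1 := by rw [← norm_pow, hz, norm_one]
  exact (pow_eq_one_iff_of_nonneg (norm_nonneg _) hm.ne').mp h

variable (p a)

/-- The additive group of `ℤ_p`-linear combinations of the roots of unity of order
dividing `p ^ a - 1`. -/
def unityLattice : AddSubgroup ℂ_[p] where
  carrier := {x | ∃ c : unityRoots p a → ℤ_[p], x = ∑ z, (c z : ℚ_[p]) • (z : ℂ_[p])}
  zero_mem' := ⟨0, by simp⟩
  add_mem' := by
    rintro x y ⟨c, rfl⟩ ⟨d, rfl⟩
    exact ⟨c + d, by simp [add_smul, Finset.sum_add_distrib]⟩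
  neg_mem' := by
    rintro x ⟨c, rfl⟩
    exact ⟨-c, by simp⟩

variable {p a}

theorem smul_mem_unityLattice (ha : 0 < a) (c : ℤ_[p]) {z : ℂ_[p]} (hz : z ^ (p ^ a - 1) = 1) :
    (c : ℚ_[p]) • z ∈ unityLattice p a := by
  classical
  refine ⟨Pi.single ⟨z, (mem_unityRoots ha).mpr hz⟩ c, ?_⟩
  rw [Finset.sum_eq_single ⟨z, (mem_unityRoots ha).mpr hz⟩]
  · simp
  · intro b _ hb; simp [Pi.single_eq_of_ne hb]
  · simp

theorem pow_of_mem_unityRoots (ha : 0 < a) (z : unityRoots p a) :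
    (z : ℂ_[p]) ^ (p ^ a - 1) = 1 := (mem_unityRoots ha).mp z.2

theorem mul_mem_unityLattice (ha : 0 < a) {x y : ℂ_[p]} (hx : x ∈ unityLattice p a)
    (hy : y ∈ unityLattice p a) : x * y ∈ unityLattice p a := by
  obtain ⟨c, rfl⟩ := hx
  obtain ⟨d, rfl⟩ := hy
  rw [Finset.sum_mul_sum]
  refine sum_mem fun z _ => sum_mem fun w _ => ?_
  have h := smul_mem_unityLattice ha (c z * d w) (z := (z : ℂ_[p]) * w)
    (by rw [mul_pow, pow_of_mem_unityRoots ha, pow_of_mem_unityRoots ha, one_mul])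
  rw [smul_mul_smul_comm]
  simpa using h

theorem one_mem_unityLattice (ha : 0 < a) : (1 : ℂ_[p]) ∈ unityLattice p a := by
  have := smul_mem_unityLattice ha (1 : ℤ_[p]) (z := (1 : ℂ_[p])) (one_pow _)
  simpa using this

theorem pow_mem_unityLattice (ha : 0 < a) {x : ℂ_[p]} (hx : x ∈ unityLattice p a) (k : ℕ) :
    x ^ k ∈ unityLattice p a := by
  induction k with
  | zero => simpa using one_mem_unityLattice ha
  | succ k ih => rw [pow_succ]; exact mul_mem_unityLattice ha ih hx

theorem natCast_mul_mem_unityLattice (m : ℕ) {x : ℂ_[p]} (hx : x ∈ unityLattice p a) :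
    (m : ℂ_[p]) * x ∈ unityLattice p a := by
  rw [← nsmul_eq_mul]; exact nsmul_mem hx m

theorem norm_le_one_of_mem_unityLattice (ha : 0 < a) {x : ℂ_[p]} (hx : x ∈ unityLattice p a) :
    ‖x‖ ≤ 1 := by
  obtain ⟨c, rfl⟩ := hx
  refine IsUltrametricDist.norm_sum_le_of_forall_le_of_nonneg zero_le_one fun z _ => ?_
  rw [norm_smul, norm_of_pow_eq_one (pow_sub_one_pos ha) (pow_of_mem_unityRoots ha z), mul_one]
  exact PadicInt.norm_le_one _

variable (p a) in
/-- The elements of the lattice whose `p ^ a`-th power is congruent to themselves modulo `p`. -/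
def frobeniusFixed (ha : 0 < a) : AddSubgroup ℂ_[p] where
  carrier := {x | x ∈ unityLattice p a ∧ ∃ y ∈ unityLattice p a, x ^ p ^ a = x + p * y}
  zero_mem' := ⟨zero_mem _, 0, zero_mem _, by
    rw [zero_pow (pow_pos hp.out.pos a).ne']; simp⟩
  add_mem' := by
    rintro x y ⟨hx, x', hx', ex⟩ ⟨hy, y', hy', ey⟩
    let S : Subring ℂ_[p] :=
      { unityLattice p a with
        one_mem' := one_mem_unityLattice ha
        mul_mem' := mul_mem_unityLattice ha }
    obtain ⟨r, hr⟩ := exists_add_pow_prime_pow_eq hp.out (⟨x, hx⟩ : S) ⟨y, hy⟩ a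
    have hr' := congrArg (Subtype.val) hr
    push_cast at hr'
    refine ⟨add_mem hx hy, x' + y' + x * y * r, add_mem (add_mem hx' hy')
      (mul_mem_unityLattice ha (mul_mem_unityLattice ha hx hy) r.2), ?_⟩
    rw [hr', ex, ey]; ring
  neg_mem' := by
    rintro x ⟨hx, x', hx', ex⟩
    -- For p = 2 the sign is lost in the even power, and the discrepancy 2x is absorbed into the
    -- multiple of p.
    rcases hp.out.eq_two_or_odd' with h2 | hodd
    · refine ⟨neg_mem hx, x + x', add_mem hx hx', ?_⟩
      have he : Even (p ^ a) := by rw [h2]; exact (even_two).pow_of_ne_zero ha.ne'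
      rw [he.neg_pow, ex]
      have : (p : ℂ_[p]) = 2 := by exact_mod_cast congrArg (Nat.cast : ℕ → ℂ_[p]) h2
      rw [this]; ring
    · refine ⟨neg_mem hx, -x', neg_mem hx', ?_⟩
      rw [(hodd.pow).neg_pow, ex]; ring

/-- Raising to the power p ^ a is additive modulo p. On a generator c • z it fixes z and, by
Fermat's little theorem, fixes c modulo p. -/
theorem exists_pow_eq_add (ha : 0 < a) {x : ℂ_[p]} (hx : x ∈ unityLattice p a) :
    ∃ y ∈ unityLattice p a, x ^ p ^ a = x + p * y := by
  suffices h : x ∈ frobeniusFixed p a ha from h.2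
  obtain ⟨c, rfl⟩ := hx
  refine sum_mem fun z _ => ?_
  have hz := pow_of_mem_unityRoots ha z
  refine ⟨smul_mem_unityLattice ha _ hz, ?_⟩
  have hzq : (z : ℂ_[p]) ^ p ^ a = z := by
    have : p ^ a = p ^ a - 1 + 1 := (Nat.sub_add_cancel (Nat.one_le_pow _ _ hp.out.pos)).symm
    rw [this, pow_succ, hz, one_mul]
  have hd : (p : ℤ_[p]) ∣ (c z) ^ p ^ a - c z := by
    rw [← Ideal.mem_span_singleton, ← PadicInt.maximalIdeal_eq_span_p, ← PadicInt.ker_toZMod,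
      RingHom.mem_ker, map_sub, map_pow, ZMod.pow_card_pow, sub_self]
  obtain ⟨d, hd⟩ := hd
  refine ⟨(d : ℚ_[p]) • (z : ℂ_[p]), smul_mem_unityLattice ha d hz, ?_⟩
  have hd' : ((c z : ℤ_[p]) : ℚ_[p]) ^ p ^ a = c z + p * d := by
    have := congrArg (fun w : ℤ_[p] => (w : ℚ_[p])) hd
    push_cast at this
    linear_combination this
  rw [smul_pow, hzq, hd', add_smul, mul_smul]
  congr 1
  rw [Algebra.smul_def (p : ℚ_[p]), map_natCast]

theorem exists_eq_mul_of_norm_lt_one (ha : 0 < a) {x : ℂ_[p]} (hx : x ∈ unityLattice p a)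
    (h1 : ‖x‖ < 1) : ∃ y ∈ unityLattice p a, x = p * y := by
  -- modulo `p` the element `x` equals its powers, which tend to zero
  have hpow : ∀ k : ℕ, ∃ y ∈ unityLattice p a, x ^ (p ^ a) ^ k = x + p * y := by
    intro k
    induction k with
    | zero => exact ⟨0, zero_mem _, by simp⟩
    | succ k ih =>
      obtain ⟨y, hy, e⟩ := ih
      obtain ⟨y', hy', e'⟩ := exists_pow_eq_add ha (pow_mem_unityLattice ha hx ((p ^ a) ^ k))
      refine ⟨y + y', add_mem hy hy', ?_⟩
      rw [pow_succ, pow_mul, e', e]; ring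
  have hmem : ∀ k : ℕ, ∃ c : unityRoots p a → ℤ_[p],
      x ^ (p ^ a) ^ k = ∑ z, (c z : ℚ_[p]) • (z : ℂ_[p]) :=
    fun k => pow_mem_unityLattice ha hx _
  choose c hc using hmem
  -- The roots of unity are linearly dependent, so small powers need not have small coefficient
  -- vectors. By compactness a subsequence of the vectors converges; its limit represents 0 and can
  -- be subtracted, which leaves coefficients divisible by p.
  obtain ⟨c₀, φ, hφ, hlim⟩ := CompactSpace.tendsto_subseq c
  have hcont : Continuous fun d : unityRoots p a → ℤ_[p] =>
      ∑ z, (d z : ℚ_[p]) • (z : ℂ_[p]) := by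
    refine continuous_finsetSum _ fun z _ => ?_
    have h : Continuous fun d : unityRoots p a → ℤ_[p] => (d z : ℚ_[p]) :=
      continuous_subtype_val.comp (continuous_apply z)
    exact h.smul (continuous_const (y := (z : ℂ_[p])))
  have h0 : ∑ z, (c₀ z : ℚ_[p]) • (z : ℂ_[p]) = 0 := by
    have l1 := (hcont.tendsto c₀).comp hlim
    have l2 : Filter.Tendsto (fun k => x ^ (p ^ a) ^ φ k) Filter.atTop (nhds 0) := by
      refine (tendsto_pow_atTop_nhds_zero_of_norm_lt_one h1).comp ?_
      exact (tendsto_pow_atTop_atTop_of_one_lt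
        (Nat.one_lt_pow ha.ne' hp.out.one_lt)).comp hφ.tendsto_atTop
    refine tendsto_nhds_unique l1 (l2.congr fun k => ?_)
    simp [hc]
  have hev : ∀ᶠ k in Filter.atTop, ∀ z, ‖c (φ k) z - c₀ z‖ ≤ ‖(p : ℤ_[p])‖ := by
    rw [Filter.eventually_all]
    intro z
    have l : Filter.Tendsto (fun k => ‖c (φ k) z - c₀ z‖) Filter.atTop (nhds 0) := by
      rw [← tendsto_iff_norm_sub_tendsto_zero]
      exact ((continuous_apply z).tendsto c₀).comp hlim
    have hpp : 0 < ‖(p : ℤ_[p])‖ := by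
      rw [norm_pos_iff]; exact Nat.cast_ne_zero.mpr hp.out.ne_zero
    exact (l.eventually (gt_mem_nhds hpp)).mono fun _ h => le_of_lt h
  obtain ⟨k, hk⟩ := hev.exists
  have hdiv : ∀ z, ∃ d : ℤ_[p], c (φ k) z - c₀ z = p * d := by
    intro z
    have := hk z
    rw [PadicInt.norm_p] at this
    have h2 := (PadicInt.norm_le_pow_iff_mem_span_pow (c (φ k) z - c₀ z) 1).mp (by simpa using this)
    rw [pow_one, Ideal.mem_span_singleton] at h2
    exact h2
  choose d hd using hdiv
  obtain ⟨y, hy, e⟩ := hpow (φ k)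
  refine ⟨∑ z, (d z : ℚ_[p]) • (z : ℂ_[p]) - y, sub_mem ⟨d, rfl⟩ hy, ?_⟩
  have e2 : x ^ (p ^ a) ^ φ k = p * ∑ z, (d z : ℚ_[p]) • (z : ℂ_[p]) := by
    rw [hc (φ k), ← sub_zero (∑ z, _), ← h0, ← Finset.sum_sub_distrib, Finset.mul_sum]
    refine Finset.sum_congr rfl fun z _ => ?_
    have hd' := congrArg (fun w : ℤ_[p] => (w : ℚ_[p])) (hd z)
    push_cast at hd'
    rw [← sub_smul, hd', mul_smul, Algebra.smul_def (p : ℚ_[p]), map_natCast]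
  linear_combination e2 - e

/-- The roots of unity are algebraic and closed under multiplication, so the field they generate is
already their linear span. -/
theorem mem_Qq_iff (ha : 0 < a) {x : ℂ_[p]} :
    x ∈ Qq p a ↔ x ∈ Submodule.span ℚ_[p] {z : ℂ_[p] | z ^ (p ^ a - 1) = 1} := by
  have halg : ∀ z ∈ {z : ℂ_[p] | z ^ (p ^ a - 1) = 1}, IsAlgebraic ℚ_[p] z := by
    intro z hz
    refine IsIntegral.isAlgebraic (IsIntegral.of_pow (pow_sub_one_pos (p := p) ha) ?_)
    rw [show z ^ (p ^ a - 1) = 1 from hz]; exact isIntegral_one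
  have h1 : x ∈ Qq p a ↔ x ∈ (Qq p a).toSubalgebra := Iff.rfl
  rw [h1, Qq, IntermediateField.adjoin_toSubalgebra_of_isAlgebraic (fun z hz => halg z hz),
    ← Subalgebra.mem_toSubmodule, Algebra.adjoin_eq_span]
  let M : Submonoid ℂ_[p] :=
    { carrier := {z : ℂ_[p] | z ^ (p ^ a - 1) = 1}
      one_mem' := one_pow _
      mul_mem' := fun {x y} hx hy => by
        change (x * y) ^ (p ^ a - 1) = 1
        rw [mul_pow, hx, hy, one_mul] }
  have hM : ((Submonoid.closure {z : ℂ_[p] | z ^ (p ^ a - 1) = 1} : Submonoid ℂ_[p]) : Set ℂ_[p])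
      = {z : ℂ_[p] | z ^ (p ^ a - 1) = 1} :=
    congrArg (fun N : Submonoid ℂ_[p] => (N : Set ℂ_[p])) (Submonoid.closure_eq M)
  rw [hM]

theorem exists_pow_mul_mem_unityLattice (ha : 0 < a) {x : ℂ_[p]} (hx : x ∈ Qq p a) :
    ∃ k : ℕ, (p : ℂ_[p]) ^ k * x ∈ unityLattice p a := by
  rw [mem_Qq_iff ha] at hx
  induction hx using Submodule.span_induction with
  | mem z hz =>
    refine ⟨0, ?_⟩
    have := smul_mem_unityLattice ha (1 : ℤ_[p]) hz
    simpa using this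
  | zero => exact ⟨0, by simp⟩
  | add x y _ _ hx hy =>
    obtain ⟨k, hk⟩ := hx
    obtain ⟨l, hl⟩ := hy
    refine ⟨k + l, ?_⟩
    have h1 := natCast_mul_mem_unityLattice (p ^ l) hk
    have h2 := natCast_mul_mem_unityLattice (p ^ k) hl
    convert add_mem h1 h2 using 1
    push_cast; ring
  | smul c x _ hx =>
    obtain ⟨k, hk⟩ := hx
    obtain ⟨l, hl⟩ : ∃ l : ℕ, ‖(p : ℚ_[p]) ^ l * c‖ ≤ 1 := by
      have h0 : Filter.Tendsto (fun l : ℕ => (p : ℚ_[p]) ^ l * c) Filter.atTop (nhds (0 * c)) :=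
        (tendsto_pow_atTop_nhds_zero_of_norm_lt_one (Padic.norm_p_lt_one (p := p))).mul_const c
      rw [zero_mul] at h0
      have := (h0.norm.eventually (gt_mem_nhds (by simp : ‖(0 : ℚ_[p])‖ < 1))).exists
      exact this.imp fun _ h => le_of_lt h
    refine ⟨k + l, ?_⟩
    obtain ⟨d, hd⟩ := hk
    refine ⟨fun z => ⟨_, hl⟩ * d z, ?_⟩
    have : (p : ℂ_[p]) ^ (k + l) * c • x = ((p : ℚ_[p]) ^ l * c) • ((p : ℂ_[p]) ^ k * x) := by
      rw [Algebra.smul_def, Algebra.smul_def, map_mul, map_pow, map_natCast]; ring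
    rw [this, hd, Finset.smul_sum]
    refine Finset.sum_congr rfl fun z _ => ?_
    rw [smul_smul]; rfl

/-- The extension `ℚ_q / ℚ_p` is unramified. -/
theorem norm_mem_zpow (ha : 0 < a) {x : ℂ_[p]} (hx : x ∈ Qq p a) (h0 : x ≠ 0) :
    ∃ m : ℤ, ‖x‖ = ‖(p : ℚ_[p])‖ ^ m := by
  have hlat : ∀ k : ℕ, ∀ x ∈ unityLattice p a, x ≠ 0 → ‖(p : ℚ_[p])‖ ^ k ≤ ‖x‖ →
      ∃ m : ℤ, ‖x‖ = ‖(p : ℚ_[p])‖ ^ m := by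
    intro k
    induction k with
    | zero =>
      intro x hx _ h
      exact ⟨0, le_antisymm (by simpa using norm_le_one_of_mem_unityLattice ha hx) (by simpa using h)⟩
    | succ k ih =>
      intro x hx h0 h
      rcases (norm_le_one_of_mem_unityLattice ha hx).lt_or_eq with h1 | h1
      · obtain ⟨y, hy, rfl⟩ := exists_eq_mul_of_norm_lt_one ha hx h1
        rw [norm_mul, norm_natCast_prime, pow_succ'] at h
        obtain ⟨m, hm⟩ := ih y hy (right_ne_zero_of_mul h0)
          (le_of_mul_le_mul_left h (norm_prime_pos p))
        refine ⟨m + 1, ?_⟩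
        rw [norm_mul, hm, norm_natCast_prime, zpow_add_one₀ (norm_prime_pos p).ne', mul_comm]
      · exact ⟨0, by simpa using h1⟩
  obtain ⟨k, hk⟩ := exists_pow_mul_mem_unityLattice ha hx
  have hp0 : (p : ℂ_[p]) ≠ 0 := Nat.cast_ne_zero.mpr hp.out.ne_zero
  have hne : (p : ℂ_[p]) ^ k * x ≠ 0 := mul_ne_zero (pow_ne_zero _ hp0) h0
  obtain ⟨j, hj⟩ := exists_pow_lt_of_lt_one (norm_pos_iff.mpr hne) (Padic.norm_p_lt_one (p := p))
  obtain ⟨m, hm⟩ := hlat j _ hk hne hj.le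
  refine ⟨m - k, ?_⟩
  rw [norm_mul, norm_pow, norm_natCast_prime] at hm
  have hpos := norm_prime_pos p
  rw [zpow_sub₀ hpos.ne', ← hm, zpow_natCast]
  field_simp

end Unramified

theorem norm_sub_le_max_norm {E : Type*} [SeminormedAddCommGroup E] [IsUltrametricDist E]
    (x y : E) : ‖x - y‖ ≤ max ‖x‖ ‖y‖ := by
  rw [sub_eq_add_neg, ← norm_neg y]; exact IsUltrametricDist.norm_add_le_max x (-y)

/-! ### The field `Ω₀(γ̃)` and its ring of integers -/

section Field

variable {p : ℕ} [hp : Fact p.Prime]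

theorem zpow_norm_prime_injective {i j : ℤ} (h : ‖(p : ℚ_[p])‖ ^ i = ‖(p : ℚ_[p])‖ ^ j) : i = j :=
  zpow_right_injective₀ (norm_prime_pos p) Padic.norm_p_lt_one.ne h

/-- The terms of `∑ z_i g ^ i` with `‖z_i‖` in `‖p‖ ^ ℤ`, `‖g‖ ^ e = ‖p‖` and `i < e` have
distinct norms, so that none of them exceeds the norm of the sum. -/
theorem norm_le_of_sum_pow {g : ℂ_[p]} {e : ℕ} (hg : ‖g‖ ^ e = ‖(p : ℚ_[p])‖)
    {z : ℕ → ℂ_[p]} (hz : ∀ i < e, z i = 0 ∨ ∃ m : ℤ, ‖z i‖ = ‖(p : ℚ_[p])‖ ^ m)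
    {s : Finset ℕ} (hs : ∀ i ∈ s, i < e) {i : ℕ} (hi : i ∈ s) :
    ‖z i * g ^ i‖ ≤ ‖∑ j ∈ s, z j * g ^ j‖ := by
  classical
  -- The exponent `e * m + j` determines j modulo e; this is what separates the norms of the terms.
  have hpow : ∀ j < e, ∀ m : ℤ, ‖z j‖ = ‖(p : ℚ_[p])‖ ^ m →
      ‖z j * g ^ j‖ ^ e = ‖(p : ℚ_[p])‖ ^ (e * m + j) := by
    intro j _ m hm
    rw [norm_mul, norm_pow, mul_pow, ← pow_mul, mul_comm j e, pow_mul, hg, hm,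
      zpow_add₀ (norm_prime_pos p).ne', zpow_natCast, ← zpow_natCast, ← zpow_mul, mul_comm m]
  have hfilt : ∑ j ∈ s, z j * g ^ j = ∑ j ∈ s with z j ≠ 0, z j * g ^ j := by
    rw [Finset.sum_filter]
    refine Finset.sum_congr rfl fun j _ => ?_
    split_ifs with h
    · rfl
    · push Not at h; rw [h, zero_mul]
  by_cases h0 : z i = 0
  · rw [h0, zero_mul, norm_zero]; exact norm_nonneg _
  have hmem : i ∈ s.filter fun j => z j ≠ 0 := by simp [hi, h0]
  rw [hfilt, IsUltrametricDist.norm_sum_eq_sup'_of_pairwise_ne ⟨i, hmem⟩]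
  · exact Finset.le_sup' (fun j => ‖z j * g ^ j‖) hmem
  · intro j hj k hk hjk h
    simp only [Finset.coe_filter, Set.mem_ofPred_eq] at hj hk
    obtain ⟨m, hm⟩ := (hz j (hs j hj.1)).resolve_left hj.2
    obtain ⟨l, hl⟩ := (hz k (hs k hk.1)).resolve_left hk.2
    have h1 := hpow j (hs j hj.1) m hm
    rw [h, hpow k (hs k hk.1) l hl] at h1
    have h2 := zpow_norm_prime_injective h1
    have hj' := hs j hj.1
    have hk' := hs k hk.1
    apply hjk
    have h3 : ((j : ℤ) - k) = e * (l - m) := by linear_combination -h2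
    have h4 : |(j : ℤ) - k| < e := by rw [abs_lt]; constructor <;> omega
    have h5 : (j : ℤ) - k = 0 := Int.eq_zero_of_abs_lt_dvd ⟨l - m, h3⟩ h4
    omega

theorem norm_pow_of_ordp {γ : ℂ_[p]}
    (h : ordp p γ = ((1 / ((p : ℝ) - 1) : ℝ) : WithTop ℝ)) :
    ‖γ‖ ^ (p - 1) = ‖(p : ℚ_[p])‖ := by
  rw [ordp] at h
  split_ifs at h with h0
  · exact absurd h (WithTop.top_ne_coe)
  · have hpos : 0 < ‖γ‖ := norm_pos_iff.mpr h0
    have h1 : -Real.logb (p : ℝ) ‖γ‖ = 1 / ((p : ℝ) - 1) := WithTop.coe_injective h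
    have hp1 : (1 : ℝ) < p := by exact_mod_cast hp.out.one_lt
    have h2 : Real.logb (p : ℝ) (‖γ‖ ^ (p - 1)) = -1 := by
      rw [Real.logb_pow, Nat.cast_sub hp.out.one_le]
      have : (p : ℝ) - 1 ≠ 0 := by linarith
      have h3 : Real.logb (p : ℝ) ‖γ‖ = -(1 / ((p : ℝ) - 1)) := by linarith
      rw [h3]; push_cast; field_simp
    rw [Padic.norm_p, ← Real.rpow_logb (by linarith) hp1.ne' (pow_pos hpos (p - 1)), h2,
      Real.rpow_neg_one]

/-- Here p ^ k = 1 + (p-1)(1 + p + … + p ^ (k-1)); it rewrites the equation for γ as one for γ ^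
(p-1). -/
theorem pow_eq_mul_pow (k : ℕ) (γ : ℂ_[p]) :
    γ ^ p ^ k = γ * (γ ^ (p - 1)) ^ (∑ i ∈ Finset.range k, p ^ i) := by
  rw [← pow_mul, ← pow_succ']
  congr 1
  have := Nat.geomSum_eq hp.out.two_le k
  have h1 : (p - 1) * ∑ i ∈ Finset.range k, p ^ i = p ^ k - 1 := by
    have := Nat.geomSum_eq hp.out.two_le k
    rw [this, Nat.mul_div_cancel']
    exact Nat.sub_one_dvd_pow_sub_one p k
  rw [h1, Nat.sub_add_cancel (Nat.one_le_pow _ _ hp.out.pos)]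

omit hp in
theorem le_geomSum (hp3 : 3 ≤ p) (k : ℕ) :
    2 * k ≤ ∑ i ∈ Finset.range k, p ^ i + 1 := by
  induction k with
  | zero => simp
  | succ k ih =>
    rw [Finset.sum_range_succ]
    rcases Nat.eq_zero_or_pos k with rfl | hk
    · simp
    · have : p ≤ p ^ k := Nat.le_self_pow hk.ne' p
      omega

theorem norm_pow_sub_pow_le {v w : ℂ_[p]} (hv : ‖v‖ ≤ 1) (hw : ‖w‖ ≤ 1) (m : ℕ) :
    ‖v ^ m - w ^ m‖ ≤ ‖v - w‖ := by
  rw [← (Commute.all v w).mul_geom_sum₂, norm_mul]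
  refine mul_le_of_le_one_right (norm_nonneg _) ?_
  refine IsUltrametricDist.norm_sum_le_of_forall_le_of_nonneg zero_le_one fun i _ => ?_
  rw [norm_mul, norm_pow, norm_pow]
  exact mul_le_one₀ (pow_le_one₀ (norm_nonneg _) hv) (by positivity)
    (pow_le_one₀ (norm_nonneg _) hw)

/-- The number `γ ^ (p - 1)` is a `p`-adic number. -/
theorem pow_mem_range_algebraMap (hp2 : 2 < p) {γ : ℂ_[p]}
    (hγ0 : HasSum (fun k : ℕ => γ ^ p ^ k / (p : ℂ_[p]) ^ k) 0)
    (hγ : ‖γ‖ ^ (p - 1) = ‖(p : ℚ_[p])‖) :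
    ∃ c : ℚ_[p], algebraMap ℚ_[p] ℂ_[p] c = γ ^ (p - 1) := by
  have hp0 : (p : ℂ_[p]) ≠ 0 := Nat.cast_ne_zero.mpr hp.out.ne_zero
  have hpos := norm_prime_pos p
  have hlt : ‖(p : ℚ_[p])‖ < 1 := Padic.norm_p_lt_one
  have hγne : γ ≠ 0 := by
    rintro rfl
    rw [norm_zero, zero_pow (by omega)] at hγ
    exact hpos.ne hγ
  set v : ℂ_[p] := γ ^ (p - 1) / p with hv
  have hγv : γ ^ (p - 1) = p * v := by rw [hv]; field_simp
  have hv1 : ‖v‖ = 1 := by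
    rw [hv, norm_div, norm_pow, hγ, norm_natCast_prime, div_self hpos.ne']
  set M : ℕ → ℕ := fun k => ∑ i ∈ Finset.range k, p ^ i with hM
  have hMk : ∀ k, 2 * k ≤ M k + 1 := le_geomSum hp2
  have hsum : HasSum (fun k : ℕ => (p : ℂ_[p]) ^ (M k) / (p : ℂ_[p]) ^ k * v ^ M k) 0 := by
    have := hγ0.mul_left γ⁻¹
    rw [mul_zero] at this
    refine this.congr_fun fun k => ?_
    rw [pow_eq_mul_pow, hγv, mul_pow]
    change (p : ℂ_[p]) ^ M k / (p : ℂ_[p]) ^ k * v ^ M k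
      = γ⁻¹ * (γ * ((p : ℂ_[p]) ^ M k * v ^ M k) / (p : ℂ_[p]) ^ k)
    field_simp
  have hterm : ∀ k, ∀ w : ℂ_[p], ‖w‖ ≤ 1 →
      ‖(p : ℂ_[p]) ^ (M (k + 2)) / (p : ℂ_[p]) ^ (k + 2) * w‖ ≤ ‖(p : ℚ_[p])‖ ^ (k + 1) := by
    intro k w hw
    obtain ⟨d, hd⟩ := Nat.exists_eq_add_of_le (show k + 2 + (k + 1) ≤ M (k + 2) by
      have := hMk (k + 2); omega)
    rw [hd, pow_add, pow_add, mul_assoc, mul_div_cancel_left₀ _ (pow_ne_zero _ hp0), norm_mul,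
      norm_mul, norm_pow, norm_pow, norm_natCast_prime, mul_assoc]
    refine mul_le_of_le_one_right (by positivity) (mul_le_one₀ ?_ (norm_nonneg _) hw)
    exact pow_le_one₀ hpos.le hlt.le
  have hM0 : M 0 = 0 := by simp [hM]
  have hM1 : M 1 = 1 := by simp [hM]
  have hv2 : HasSum (fun k : ℕ => (p : ℂ_[p]) ^ (M (k + 2)) / (p : ℂ_[p]) ^ (k + 2) *
      v ^ M (k + 2)) (-(1 + v)) := by
    rw [hasSum_nat_add_iff' 2 |>.symm] at hsum
    simpa [Finset.sum_range_succ, hM0, hM1, hp0] using hsum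
  -- The unit v = γ ^ (p-1) / p satisfies v = -1 - ∑_{k≥2} p ^ (M_k - k) v ^ (M_k). The right side
  -- is defined over ℚ_p and contracts distances by ‖p‖, so iterating truncations of it from 0
  -- yields p-adic numbers converging to v.
  have happrox : ∀ j : ℕ, ∃ c : ℚ_[p], ‖c‖ ≤ 1 ∧
      ‖v - algebraMap ℚ_[p] ℂ_[p] c‖ ≤ ‖(p : ℚ_[p])‖ ^ j := by
    intro j
    induction j with
    | zero => exact ⟨0, by simp, by simp [hv1]⟩
    | succ j ih =>
      obtain ⟨c, hc1, hc⟩ := ih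
      set w := algebraMap ℚ_[p] ℂ_[p] c with hw
      have hw1 : ‖w‖ ≤ 1 := by rw [hw, norm_algebraMap_padic]; exact hc1
      let d : ℚ_[p] := -(1 + ∑ k ∈ Finset.range j,
        (p : ℚ_[p]) ^ (M (k + 2)) / (p : ℚ_[p]) ^ (k + 2) * c ^ M (k + 2))
      have hd : algebraMap ℚ_[p] ℂ_[p] d = -(1 + ∑ k ∈ Finset.range j,
        (p : ℂ_[p]) ^ (M (k + 2)) / (p : ℂ_[p]) ^ (k + 2) * w ^ M (k + 2)) := by
        simp [d, hw]
      have hdist : ‖v - algebraMap ℚ_[p] ℂ_[p] d‖ ≤ ‖(p : ℚ_[p])‖ ^ (j + 1) := by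
        have h1 := (hasSum_nat_add_iff' j).mpr hv2
        have h2 : ‖-(1 + v) - ∑ k ∈ Finset.range j, (p : ℂ_[p]) ^ (M (k + 2)) /
            (p : ℂ_[p]) ^ (k + 2) * v ^ M (k + 2)‖ ≤ ‖(p : ℚ_[p])‖ ^ (j + 1) := by
          rw [← h1.tsum_eq]
          refine IsUltrametricDist.norm_tsum_le_of_forall_le_of_nonneg (by positivity) fun k => ?_
          refine (hterm (k + j) (v ^ M (k + j + 2)) ?_).trans ?_
          · rw [norm_pow, hv1, one_pow]
          · exact pow_le_pow_of_le_one hpos.le hlt.le (by omega)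
        have h3 : ‖∑ k ∈ Finset.range j, (p : ℂ_[p]) ^ (M (k + 2)) /
            (p : ℂ_[p]) ^ (k + 2) * (v ^ M (k + 2) - w ^ M (k + 2))‖
            ≤ ‖(p : ℚ_[p])‖ ^ (j + 1) := by
          refine IsUltrametricDist.norm_sum_le_of_forall_le_of_nonneg (by positivity) fun k _ => ?_
          have h4 := hterm k 1 (by simp)
          rw [mul_one] at h4
          rw [norm_mul, pow_succ' _ j]
          refine mul_le_mul (h4.trans ?_) ((norm_pow_sub_pow_le hv1.le hw1 _).trans hc)
            (norm_nonneg _) hpos.le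
          exact pow_le_of_le_one hpos.le hlt.le (by omega)
        have h5 : v - algebraMap ℚ_[p] ℂ_[p] d =
            -(-(1 + v) - ∑ k ∈ Finset.range j, (p : ℂ_[p]) ^ (M (k + 2)) /
              (p : ℂ_[p]) ^ (k + 2) * v ^ M (k + 2))
            - ∑ k ∈ Finset.range j, (p : ℂ_[p]) ^ (M (k + 2)) /
              (p : ℂ_[p]) ^ (k + 2) * (v ^ M (k + 2) - w ^ M (k + 2)) := by
          rw [hd]; simp only [mul_sub, Finset.sum_sub_distrib]; ring
        rw [h5]
        exact (norm_sub_le_max_norm _ _).trans (max_le (by rwa [norm_neg]) h3)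
      refine ⟨d, ?_, hdist⟩
      rw [← norm_algebraMap_padic]
      have h6 : algebraMap ℚ_[p] ℂ_[p] d = v - (v - algebraMap ℚ_[p] ℂ_[p] d) := by ring
      rw [h6]
      refine (norm_sub_le_max_norm _ _).trans (max_le hv1.le (hdist.trans ?_))
      exact pow_le_one₀ hpos.le hlt.le
  have hclosed : IsClosed (Set.range (algebraMap ℚ_[p] ℂ_[p])) :=
    (algebraMap_isometry ℚ_[p] ℂ_[p]).isClosedEmbedding.isClosed_range
  obtain ⟨c, hc⟩ : v ∈ Set.range (algebraMap ℚ_[p] ℂ_[p]) := by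
    choose c _ hc using happrox
    refine hclosed.mem_of_tendsto (f := fun j => algebraMap ℚ_[p] ℂ_[p] (c j)) (b := Filter.atTop)
      ?_ (Filter.Eventually.of_forall fun j => ⟨c j, rfl⟩)
    rw [tendsto_iff_norm_sub_tendsto_zero]
    refine squeeze_zero (fun _ => norm_nonneg _) (fun j => ?_)
      (tendsto_pow_atTop_nhds_zero_of_lt_one hpos.le hlt)
    rw [norm_sub_rev]; exact hc j
  exact ⟨p * c, by rw [map_mul, hc, map_natCast, hγv]⟩

theorem isIntegral_of_isPrimitiveRoot {ζ : ℂ_[p]} (hζ : IsPrimitiveRoot ζ p) :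
    IsIntegral ℚ_[p] ζ := 
  IsIntegral.of_pow hp.out.pos (by rw [hζ.pow_eq_one]; exact isIntegral_one)

/-- The field `ℚ_p(ζ_p)` is generated by `γ`. -/
theorem adjoin_zeta_eq {ζ γ : ℂ_[p]} (hζ : IsPrimitiveRoot ζ p)
    (hγ : γ ∈ IntermediateField.adjoin ℚ_[p] {ζ})
    (hγn : ‖γ‖ ^ (p - 1) = ‖(p : ℚ_[p])‖) :
    IntermediateField.adjoin ℚ_[p] {γ} = IntermediateField.adjoin ℚ_[p] {ζ} := by
  have hζi := isIntegral_of_isPrimitiveRoot hζ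
  have : FiniteDimensional ℚ_[p] (IntermediateField.adjoin ℚ_[p] {ζ}) :=
    IntermediateField.adjoin.finiteDimensional hζi
  have hγi : IsIntegral ℚ_[p] γ := by
    have : IsIntegral ℚ_[p] (⟨γ, hγ⟩ : IntermediateField.adjoin ℚ_[p] {ζ}) :=
      Algebra.IsIntegral.isIntegral _
    exact this.map (IntermediateField.adjoin ℚ_[p] {ζ}).val
  apply IntermediateField.eq_of_le_of_finrank_le
  · rw [IntermediateField.adjoin_simple_le_iff]; exact hγ
  · rw [IntermediateField.adjoin.finrank hζi, IntermediateField.adjoin.finrank hγi]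
    have h1 : (minpoly ℚ_[p] ζ).natDegree ≤ p - 1 := by
      have hroot : Polynomial.aeval ζ (Polynomial.cyclotomic p ℚ_[p]) = 0 := by
        rw [Polynomial.aeval_def, Polynomial.eval₂_eq_eval_map, Polynomial.map_cyclotomic]
        exact hζ.isRoot_cyclotomic hp.out.pos
      have := Polynomial.natDegree_le_of_dvd (minpoly.dvd ℚ_[p] ζ hroot)
        (Polynomial.cyclotomic_ne_zero p ℚ_[p])
      rwa [Polynomial.natDegree_cyclotomic, Nat.totient_prime hp.out] at this
    refine h1.trans ?_
    -- Powers of γ below the exponent p - 1 have norms in distinct classes modulo ‖p‖ ^ ℤ, so γ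
    -- satisfies no polynomial of smaller degree. Its degree is thus at least that of ζ_p.
    by_contra! hlt
    set P := minpoly ℚ_[p] γ with hP
    have hev : ∑ i ∈ Finset.range (P.natDegree + 1),
        algebraMap ℚ_[p] ℂ_[p] (P.coeff i) * γ ^ i = 0 := by
      have := minpoly.aeval ℚ_[p] γ
      rw [Polynomial.aeval_eq_sum_range] at this
      simpa [Algebra.smul_def] using this
    have hle := norm_le_of_sum_pow (e := p - 1) hγn
      (z := fun i => algebraMap ℚ_[p] ℂ_[p] (P.coeff i)) (fun i _ => by
        by_cases h0 : P.coeff i = 0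
        · left; simp [h0]
        · right
          refine ⟨(P.coeff i).valuation, ?_⟩
          rw [norm_algebraMap_padic, Padic.norm_eq_zpow_neg_valuation h0, Padic.norm_p, inv_zpow,
            zpow_neg])
      (s := Finset.range (P.natDegree + 1)) (fun i hi => by
        rw [Finset.mem_range] at hi; omega)
      (i := P.natDegree) (by simp)
    rw [hev, norm_zero, Polynomial.coeff_natDegree, (minpoly.monic hγi).leadingCoeff, map_one,
      one_mul, norm_pow] at hle
    have hγne : γ ≠ 0 := by
      rintro rfl
      rw [norm_zero, zero_pow (by have := hp.out.two_le; omega)] at hγn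
      exact (norm_prime_pos p).ne hγn
    exact absurd hle (not_le.mpr (pow_pos (norm_pos_iff.mpr hγne) _))

variable {a n : ℕ} {ζ γ g : ℂ_[p]}

/-- Since g ^ (n(p-1)) = γ ^ (p-1) is a p-adic number c, and ζ_p lies in ℚ_p(γ), the field is
ℚ_q[g]. Division by the monic polynomial X ^ (n(p-1)) - c bounds the degree. -/
theorem exists_sum_of_mem_Omega (hn : 0 < n) (hp2 : 2 < p) (hζ : IsPrimitiveRoot ζ p)
    (hγ : γ ∈ IntermediateField.adjoin ℚ_[p] {ζ})
    (hγ0 : HasSum (fun k : ℕ => γ ^ p ^ k / (p : ℂ_[p]) ^ k) 0)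
    (hγn : ‖γ‖ ^ (p - 1) = ‖(p : ℚ_[p])‖) (hg : g ^ n = γ) {x : ℂ_[p]}
    (hx : x ∈ Omega p a ζ g) :
    ∃ z : ℕ → ℂ_[p], (∀ i, z i ∈ Qq p a) ∧
      x = ∑ i ∈ Finset.range (n * (p - 1)), z i * g ^ i := by
  obtain ⟨c, hc⟩ := pow_mem_range_algebraMap hp2 hγ0 hγn
  have hge : g ^ (n * (p - 1)) = algebraMap ℚ_[p] ℂ_[p] c := by rw [pow_mul, hg, hc]
  have he : 0 < n * (p - 1) := Nat.mul_pos hn (by omega)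
  let cq : Qq p a := algebraMap ℚ_[p] (Qq p a) c
  let m : Polynomial (Qq p a) := Polynomial.X ^ (n * (p - 1)) - Polynomial.C cq
  have hm : m.Monic := Polynomial.monic_X_pow_sub_C cq he.ne'
  have hmg : Polynomial.aeval g m = 0 := by
    simp only [m, map_sub, map_pow, Polynomial.aeval_X, Polynomial.aeval_C]
    rw [hge]
    exact sub_self _
  have hgi : IsIntegral (Qq p a) g := ⟨m, hm, hmg⟩
  have hle : Omega p a ζ g ≤
      (IntermediateField.adjoin (Qq p a) {g}).restrictScalars ℚ_[p] := by
    rw [Omega, IntermediateField.adjoin_le_iff]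
    have hgm : g ∈ IntermediateField.adjoin (Qq p a) {g} :=
      IntermediateField.mem_adjoin_simple_self _ _
    rintro y (hy | rfl | hy)
    · have hy' : y ∈ Qq p a := IntermediateField.subset_adjoin _ _ hy
      exact (IntermediateField.adjoin (Qq p a) {g}).algebraMap_mem ⟨y, hy'⟩
    · have h1 : y ∈ IntermediateField.adjoin ℚ_[p] {γ} := by
        rw [adjoin_zeta_eq hζ hγ hγn]; exact IntermediateField.mem_adjoin_simple_self _ _
      have h2 : IntermediateField.adjoin ℚ_[p] {γ} ≤
          (IntermediateField.adjoin (Qq p a) {g}).restrictScalars ℚ_[p] := by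
        rw [IntermediateField.adjoin_simple_le_iff, ← hg]
        exact pow_mem hgm n
      exact h2 h1
    · rw [Set.mem_singleton_iff] at hy
      rw [hy]; exact hgm
  have hx' : x ∈ (IntermediateField.adjoin (Qq p a) {g}).toSubalgebra := hle hx
  rw [IntermediateField.adjoin_simple_toSubalgebra_of_isAlgebraic hgi.isAlgebraic,
    Algebra.adjoin_singleton_eq_range_aeval] at hx'
  obtain ⟨P, rfl⟩ := hx'
  refine ⟨fun i => ((P %ₘ m).coeff i : Qq p a), fun i => SetLike.coe_mem _, ?_⟩
  have h1 : Polynomial.aeval g P = Polynomial.aeval g (P %ₘ m) := by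
    conv_lhs => rw [← Polynomial.modByMonic_add_div P m]
    rw [map_add, map_mul, hmg, zero_mul, add_zero]
  have hdeg : (P %ₘ m).natDegree < n * (p - 1) := by
    have := Polynomial.natDegree_modByMonic_lt P hm (by
      intro h
      have := congrArg Polynomial.natDegree h
      rw [Polynomial.natDegree_X_pow_sub_C, Polynomial.natDegree_one] at this
      omega)
    rwa [Polynomial.natDegree_X_pow_sub_C] at this
  have h2 : (Polynomial.aeval g).toRingHom P = Polynomial.aeval g P := rfl
  rw [h2, h1, Polynomial.aeval_eq_sum_range' hdeg]
  rfl

theorem gen_norm_pow (hγn : ‖γ‖ ^ (p - 1) = ‖(p : ℚ_[p])‖) (hg : g ^ n = γ) :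
    ‖g‖ ^ (n * (p - 1)) = ‖(p : ℚ_[p])‖ := by
  rw [pow_mul, ← norm_pow, hg, hγn]

theorem gen_norm_lt_one (hγn : ‖γ‖ ^ (p - 1) = ‖(p : ℚ_[p])‖) (hg : g ^ n = γ) : ‖g‖ < 1 := by
  by_contra! h
  have := one_le_pow₀ h (n := n * (p - 1))
  rw [gen_norm_pow hγn hg] at this
  exact absurd this (not_le.mpr Padic.norm_p_lt_one)

/-- The ring `ℤ_q[γ̃]` is the closed unit ball of `Ω₀(γ̃)`. -/
theorem integers_eq (hn : 0 < n) (ha : 0 < a) (hp2 : 2 < p) (hζ : IsPrimitiveRoot ζ p)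
    (hγ : γ ∈ IntermediateField.adjoin ℚ_[p] {ζ})
    (hγ0 : HasSum (fun k : ℕ => γ ^ p ^ k / (p : ℂ_[p]) ^ k) 0)
    (hγn : ‖γ‖ ^ (p - 1) = ‖(p : ℚ_[p])‖) (hg : g ^ n = γ) :
    Omega.integers p a ζ g = {z | ‖z‖ ≤ 1} := by
  ext x
  change (x : ℂ_[p]) ∈ ZqAdjoin p a g ↔ ‖(x : ℂ_[p])‖ ≤ 1
  have hgn := gen_norm_pow hγn hg
  have hg1 := gen_norm_lt_one hγn hg
  constructor
  · intro h
    generalize (x : ℂ_[p]) = y at h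
    induction h using Subring.closure_induction with
    | mem y hy =>
      rcases hy with hy | hy
      · exact hy.2
      · rw [Set.mem_singleton_iff] at hy; rw [hy]; exact hg1.le
    | zero => simp
    | one => simp
    | add y z _ _ hy hz => exact (IsUltrametricDist.norm_add_le_max y z).trans (max_le hy hz)
    | neg y _ hy => rwa [norm_neg]
    | mul y z _ _ hy hz => rw [norm_mul]; exact mul_le_one₀ hy (norm_nonneg _) hz
  · intro h
    obtain ⟨z, hz, e⟩ := exists_sum_of_mem_Omega hn hp2 hζ hγ hγ0 hγn hg x.2
    rw [e]
    have hzn : ∀ i < n * (p - 1), z i = 0 ∨ ∃ m : ℤ, ‖z i‖ = ‖(p : ℚ_[p])‖ ^ m := fun i _ => by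
      by_cases h0 : z i = 0
      · exact Or.inl h0
      · exact Or.inr (norm_mem_zpow ha (hz i) h0)
    refine sum_mem fun i hi => mul_mem ?_ (pow_mem ?_ i)
    · refine Subring.subset_closure (Or.inl ⟨hz i, ?_⟩)
      have h1 := norm_le_of_sum_pow hgn hzn (s := Finset.range (n * (p - 1)))
        (fun i hi => Finset.mem_range.mp hi) hi
      rw [← e] at h1
      have h2 := h1.trans h
      rcases hzn i (Finset.mem_range.mp hi) with h0 | ⟨m, hm⟩
      · rw [h0]; simp
      · rw [hm]
        have h3 : ‖z i * g ^ i‖ ^ (n * (p - 1)) ≤ 1 := pow_le_one₀ (norm_nonneg _) h2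
        rw [norm_mul, norm_pow, mul_pow, ← pow_mul ‖g‖, mul_comm i, pow_mul ‖g‖, hgn, hm, ← zpow_natCast,
          ← zpow_mul, ← zpow_natCast, ← zpow_add₀ (norm_prime_pos p).ne'] at h3
        have h4 : 0 ≤ m * ((n * (p - 1) : ℕ) : ℤ) + i := by
          by_contra! hneg
          -- The e-th power of the term has norm ‖p‖ ^ (m e + i) with e = n(p-1); this is at most 1
          -- only if m e + i ≥ 0, and i < e then gives m ≥ 0.
          have := one_lt_zpow_of_neg₀ (norm_prime_pos p) Padic.norm_p_lt_one hneg
          linarith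
        have h5 : 0 ≤ m := by
          by_contra! hneg
          have hi' : (i : ℤ) < ((n * (p - 1) : ℕ) : ℤ) := by
            exact_mod_cast Finset.mem_range.mp hi
          nlinarith
        exact zpow_le_one₀ (norm_prime_pos p) Padic.norm_p_lt_one.le h5
    · exact Subring.subset_closure (Or.inr rfl)

theorem finiteDimensional_Omega (hn : 0 < n) (ha : 0 < a) (hζ : IsPrimitiveRoot ζ p)
    (hγ : γ ∈ IntermediateField.adjoin ℚ_[p] {ζ}) (hg : g ^ n = γ) :
    FiniteDimensional ℚ_[p] (Omega p a ζ g) := by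
  have hfin : Set.Finite ({z : ℂ_[p] | z ^ (p ^ a - 1) = 1} ∪ {ζ, g}) := by
    refine Set.Finite.union ?_ (by simp)
    refine (unityRoots p a).finite_toSet.subset fun z hz => ?_
    exact (mem_unityRoots ha).mpr hz
  have := hfin.to_subtype
  refine IntermediateField.finiteDimensional_adjoin fun x hx => ?_
  have hζi := isIntegral_of_isPrimitiveRoot hζ
  rcases hx with hx | rfl | hx
  · refine IsIntegral.of_pow (pow_sub_one_pos (p := p) ha) ?_
    rw [show x ^ (p ^ a - 1) = 1 from hx]; exact isIntegral_one
  · exact hζi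
  · rw [Set.mem_singleton_iff] at hx
    refine IsIntegral.of_pow hn ?_
    rw [hx, hg]
    have : FiniteDimensional ℚ_[p] (IntermediateField.adjoin ℚ_[p] {ζ}) :=
      IntermediateField.adjoin.finiteDimensional hζi
    have : IsIntegral ℚ_[p] (⟨γ, hγ⟩ : IntermediateField.adjoin ℚ_[p] {ζ}) :=
      Algebra.IsIntegral.isIntegral _
    exact this.map (IntermediateField.adjoin ℚ_[p] {ζ}).val

end Field

/-- An algebra automorphism of a finite extension of a complete field is an isometry. -/
theorem norm_algEquiv_apply {k K : Type*} [NontriviallyNormedField k] [CompleteSpace k]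
    [NormedField K] [NormedAlgebra k K] [FiniteDimensional k K] (σ : K ≃ₐ[k] K) (x : K) :
    ‖σ x‖ = ‖x‖ := by
  have hle : ∀ (τ : K ≃ₐ[k] K) (x : K), ‖τ x‖ ≤ ‖x‖ := by
    intro τ x
    let T : K →L[k] K := LinearMap.toContinuousLinearMap τ.toLinearMap
    have hT : ∀ y, ‖τ y‖ ≤ ‖T‖ * ‖y‖ := fun y => T.le_opNorm y
    by_contra! hlt
    rcases (norm_nonneg x).eq_or_lt with h0 | h0
    · have : x = 0 := norm_eq_zero.mp h0.symm
      rw [this, map_zero] at hlt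
      exact lt_irrefl _ hlt
    have h1 : 1 < ‖τ x‖ / ‖x‖ := by rwa [one_lt_div h0]
    -- The map is bounded as a linear operator and multiplicative, so a single expanded norm would
    -- grow without bound along the powers of x.
    obtain ⟨m, hm⟩ := pow_unbounded_of_one_lt ‖T‖ h1
    have h2 := hT (x ^ m)
    rw [map_pow, norm_pow, norm_pow] at h2
    rw [div_pow, lt_div_iff₀ (pow_pos h0 m)] at hm
    linarith
  refine le_antisymm (hle σ x) ?_
  have := hle σ.symm (σ x)
  rwa [AlgEquiv.symm_apply_apply] at this

/-! ### The weight function -/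

section Weight

variable {n : ℕ}

theorem nweight_def (a b : ℤ) :
    nweight n (a, b) = a + n * b + (2 * n + 1) * max 0 (max (-a) (-b)) := rfl

theorem nweight_nonneg (u : ℤ × ℤ) : 0 ≤ nweight n u := by
  obtain ⟨a, b⟩ := u
  rw [nweight_def]
  set M := max 0 (max (-a) (-b)) with hM
  have h0 : 0 ≤ M := le_max_left _ _
  have h1 : 0 ≤ a + M := by omega
  have h2 : 0 ≤ b + M := by omega
  have h3 : (0 : ℤ) ≤ n * (b + M) := by positivity
  have h4 : (0 : ℤ) ≤ n * M := by positivity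
  linarith

theorem bounds_of_nweight (hn : 0 < n) {a b d : ℤ} (h : nweight n (a, b) = d) :
    -d ≤ a ∧ a ≤ d ∧ -d ≤ b ∧ b ≤ d := by
  rw [nweight_def] at h
  set M := max 0 (max (-a) (-b)) with hM
  have h0 : 0 ≤ M := le_max_left _ _
  have h1 : 0 ≤ a + M := by omega
  have h2 : 0 ≤ b + M := by omega
  have hn' : (1 : ℤ) ≤ n := by exact_mod_cast hn
  have h3 : b + M ≤ n * (b + M) := le_mul_of_one_le_left h2 hn'
  have h4 : M ≤ n * M := le_mul_of_one_le_left h0 hn'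
  refine ⟨?_, ?_, ?_, ?_⟩ <;> linarith

/-- Multiplying by the k-th power of a ray monomial raises the weight by at most nk. The terms `0 *
k` here and below give the three rays the common shape used in `dworkOp`. -/
theorem nweight_le_sub_X (u : ℤ × ℤ) {k : ℤ} (hk : 0 ≤ k) :
    nweight n u ≤ nweight n (u.1 - n * k, u.2 - 0 * k) + n * k := by
  obtain ⟨a, b⟩ := u
  simp only [nweight_def]
  have h1 : (0 : ℤ) ≤ n * k := by positivity
  have h : max 0 (max (-a) (-b)) ≤ max 0 (max (-(a - n * k)) (-(b - 0 * k))) := by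
    generalize (n : ℤ) * k = m at *; omega
  have := mul_le_mul_of_nonneg_left h (by positivity : (0 : ℤ) ≤ 2 * n + 1)
  linarith

theorem nweight_le_sub_Y (u : ℤ × ℤ) {k : ℤ} (hk : 0 ≤ k) :
    nweight n u ≤ nweight n (u.1 - 0 * k, u.2 - 1 * k) + n * k := by
  obtain ⟨a, b⟩ := u
  simp only [nweight_def]
  have h : max 0 (max (-a) (-b)) ≤ max 0 (max (-(a - 0 * k)) (-(b - 1 * k))) := by omega
  have := mul_le_mul_of_nonneg_left h (by positivity : (0 : ℤ) ≤ 2 * n + 1)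
  linarith

theorem nweight_le_sub_Z (u : ℤ × ℤ) {k : ℤ} (hk : 0 ≤ k) :
    nweight n u ≤ nweight n (u.1 - (-1) * k, u.2 - (-1) * k) + n * k := by
  obtain ⟨a, b⟩ := u
  simp only [nweight_def]
  have h : max 0 (max (-a) (-b)) ≤ max 0 (max (-(a - (-1) * k)) (-(b - (-1) * k))) + k := by omega
  have := mul_le_mul_of_nonneg_left h (by positivity : (0 : ℤ) ≤ 2 * n + 1)
  linarith

/-- The weight is linear on each cone, so equality holds exactly when the point shares a cone with
the ray; the condition on the right describes the two cones adjacent to it. The next two lemmas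
treat the other rays. -/
theorem nweight_add_X (hn : 0 < n) (a b : ℤ) :
    nweight n (a + n, b) = nweight n (a, b) + n ↔ 0 ≤ a ∨ b ≤ a := by
  have hn' : (1 : ℤ) ≤ n := by exact_mod_cast hn
  simp only [nweight_def]
  have : a + n + n * b + (2 * n + 1) * max 0 (max (-(a + n)) (-b))
      = a + n * b + (2 * n + 1) * max 0 (max (-a) (-b)) + n ↔
      max 0 (max (-(a + n)) (-b)) = max 0 (max (-a) (-b)) := by
    refine ⟨fun h => ?_, fun h => by rw [h]; ring⟩
    apply mul_left_cancel₀ (by positivity : (2 * (n : ℤ) + 1) ≠ 0)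
    linarith
  rw [this]
  omega

theorem nweight_add_Y (a b : ℤ) :
    nweight n (a, b + 1) = nweight n (a, b) + n ↔ 0 ≤ b ∨ a ≤ b := by
  simp only [nweight_def]
  have : a + n * (b + 1) + (2 * n + 1) * max 0 (max (-a) (-(b + 1)))
      = a + n * b + (2 * n + 1) * max 0 (max (-a) (-b)) + n ↔
      max 0 (max (-a) (-(b + 1))) = max 0 (max (-a) (-b)) := by
    refine ⟨fun h => ?_, fun h => by rw [h]; ring⟩
    apply mul_left_cancel₀ (by positivity : (2 * (n : ℤ) + 1) ≠ 0)
    linarith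
  rw [this]
  omega

theorem nweight_add_Z (a b : ℤ) :
    nweight n (a + -1, b + -1) = nweight n (a, b) + n ↔ a ≤ 0 ∨ b ≤ 0 := by
  simp only [nweight_def]
  have : a + -1 + n * (b + -1) + (2 * n + 1) * max 0 (max (-(a + -1)) (-(b + -1)))
      = a + n * b + (2 * n + 1) * max 0 (max (-a) (-b)) + n ↔
      max 0 (max (-(a + -1)) (-(b + -1))) = max 0 (max (-a) (-b)) + 1 := by
    refine ⟨fun h => ?_, fun h => by rw [h]; ring⟩
    apply mul_left_cancel₀ (by positivity : (2 * (n : ℤ) + 1) ≠ 0)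
    linarith
  rw [this]
  omega

theorem nweight_epsExp (i : ℕ) : nweight n (epsExp n i) = i := by
  unfold epsExp
  split_ifs with h
  · rw [nweight_def]
    have : max 0 (max (-(i : ℤ)) (-0)) = 0 := by omega
    rw [this]; ring
  · rw [nweight_def]
    have : max 0 (max (-((i : ℤ) - n)) (-1)) = 0 := by omega
    rw [this]; ring

theorem epsExp_injective : Function.Injective (epsExp n) := fun i j h => by
  have := congrArg (nweight n) h
  rw [nweight_epsExp, nweight_epsExp] at this
  exact_mod_cast this

end Weight

/-! ### Divisibility by powers of `g`, in terms of norms -/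

section OrdGE

variable {K : Type*} [NormedField K]

/-- The element `x` is divisible by `g ^ k`, up to elements of norm at most one. -/
def OrdGE (g : K) (k : ℤ) (x : K) : Prop := ‖x‖ ≤ ‖g‖ ^ k

variable {g : K}

theorem OrdGE.mono (hg : 0 < ‖g‖) (hg1 : ‖g‖ < 1) {k l : ℤ} {x : K} (h : OrdGE g k x)
    (hl : l ≤ k) : OrdGE g l x :=
  le_trans h (zpow_le_zpow_right_of_le_one₀ hg hg1.le hl)

theorem OrdGE.zero (k : ℤ) : OrdGE g k 0 := by
  rw [OrdGE, norm_zero]; positivity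

theorem ordGE_zero_iff {x : K} : OrdGE g 0 x ↔ ‖x‖ ≤ 1 := by rw [OrdGE, zpow_zero]

theorem OrdGE.mul (hg : 0 < ‖g‖) {k l : ℤ} {x y : K} (hx : OrdGE g k x) (hy : OrdGE g l y) :
    OrdGE g (k + l) (x * y) := by
  rw [OrdGE, norm_mul, zpow_add₀ hg.ne']
  exact mul_le_mul hx hy (norm_nonneg _) (by positivity)

theorem OrdGE.unit_mul {l : ℤ} {x y : K} (hx : ‖x‖ ≤ 1) (hy : OrdGE g l y) :
    OrdGE g l (x * y) := by
  rw [OrdGE, norm_mul]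
  exact (mul_le_of_le_one_left (norm_nonneg _) hx).trans hy

theorem OrdGE.neg {k : ℤ} {x : K} (hx : OrdGE g k x) : OrdGE g k (-x) := by
  rw [OrdGE, norm_neg]; exact hx

theorem ordGE_zpow (k : ℤ) : OrdGE g k (g ^ k) := by rw [OrdGE, norm_zpow]

theorem OrdGE.mul_zpow (hg : 0 < ‖g‖) {k : ℤ} {x : K} (hx : OrdGE g k x) (l : ℤ) :
    OrdGE g (k + l) (x * g ^ l) := hx.mul hg (ordGE_zpow l)

theorem OrdGE.zpow_mul (hg : 0 < ‖g‖) {k : ℤ} {x : K} (hx : OrdGE g k x) (l : ℤ) :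
    OrdGE g (l + k) (g ^ l * x) := (ordGE_zpow l).mul hg hx

variable [IsUltrametricDist K]

theorem OrdGE.add {k : ℤ} {x y : K} (hx : OrdGE g k x) (hy : OrdGE g k y) : OrdGE g k (x + y) :=
  (IsUltrametricDist.norm_add_le_max x y).trans (max_le hx hy)

theorem OrdGE.sub {k : ℤ} {x y : K} (hx : OrdGE g k x) (hy : OrdGE g k y) : OrdGE g k (x - y) :=
  (norm_sub_le_max_norm x y).trans (max_le hx hy)

theorem OrdGE.tsum {ι : Type*} {k : ℤ} {f : ι → K} (hf : ∀ i, OrdGE g k (f i)) :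
    OrdGE g k (∑' i, f i) :=
  IsUltrametricDist.norm_tsum_le_of_forall_le_of_nonneg (by positivity) hf

theorem norm_intCast_le_one' (m : ℤ) : ‖(m : K)‖ ≤ 1 := by
  simpa using IsUltrametricDist.norm_intCast_le_one K m

end OrdGE

/-! ### The data of the family over a complete field -/

/-- The properties of `K = Ω₀(γ̃)` on which the computation of the Frobenius matrix rests. -/
structure FrobeniusData (p n : ℕ) {K : Type*} [NormedField K] (g τ : K) (σ : K ≃+* K) :
    Prop where
  prime : p.Prime
  two_lt : 2 < p
  n_pos : 0 < n
  n_lt : n < p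
  gen_pos : 0 < ‖g‖
  gen_lt : ‖g‖ < 1
  norm_prime : ‖(p : K)‖ = ‖g‖ ^ (n * (p - 1))
  norm_n : ‖(n : K)‖ = 1
  norm_tau : ‖τ‖ = 1
  norm_sigma : ∀ z, ‖σ z‖ = ‖z‖
  hasSum : HasSum (fun k : ℕ => (g ^ n) ^ p ^ k / (p : K) ^ k) 0
  norm_coeff_le : ∀ k, ‖((PowerSeries.coeff k (artinHasse p) : ℚ) : K)‖ ≤ 1
  norm_coeff_eq : ∀ k < p, ‖((PowerSeries.coeff k (artinHasse p) : ℚ) : K)‖ = 1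

section Operators

variable {K : Type*} [NormedField K] [IsUltrametricDist K]

variable {p n : ℕ} {g τ : K} {σ : K ≃+* K}

/-- The coefficient `γ_i p ^ i` in the definition of `D_x` and `D_y`. -/
def kappa (p n : ℕ) (g : K) (i : ℕ) : K := gammaPartial p (g ^ n) i * (p : K) ^ i

namespace FrobeniusData

omit [IsUltrametricDist K] in
theorem gen_ne (S : FrobeniusData p n g τ σ) : g ≠ 0 := norm_pos_iff.mp S.gen_pos

omit [IsUltrametricDist K] in
theorem norm_sigma_iterate (S : FrobeniusData p n g τ σ) (i : ℕ) : ‖σ^[i] τ‖ = 1 := by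
  induction i with
  | zero => exact S.norm_tau
  | succ i ih => rw [Function.iterate_succ_apply', S.norm_sigma, ih]

omit [IsUltrametricDist K] in
theorem norm_prime_zpow (S : FrobeniusData p n g τ σ) :
    ‖(p : K)‖ = ‖g‖ ^ ((n : ℤ) * (p - 1)) := by
  rw [S.norm_prime, ← zpow_natCast]
  have := S.prime.one_le
  push_cast [Nat.cast_sub this]
  rfl

omit [IsUltrametricDist K] in
theorem ordGE_term (S : FrobeniusData p n g τ σ) (k : ℕ) :
    OrdGE g (n * p ^ k - n * (p - 1) * k) ((g ^ n) ^ p ^ k / (p : K) ^ k) := by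
  rw [OrdGE, norm_div, norm_pow, norm_pow, norm_pow, S.norm_prime_zpow, zpow_sub₀ S.gen_pos.ne',
    ← zpow_natCast, ← zpow_natCast, ← zpow_natCast, ← zpow_mul, ← zpow_mul]
  push_cast
  exact le_rfl

-- The orders of the terms γ ^ (p ^ k) / p ^ k never decrease (they agree for k = 0 and k = 1), so
-- the first term of a tail bounds the whole tail.
omit [IsUltrametricDist K] in
theorem exponent_mono (S : FrobeniusData p n g τ σ) {i k : ℕ} (h : i ≤ k) :
    (n : ℤ) * p ^ i - n * (p - 1) * i ≤ n * p ^ k - n * (p - 1) * k := by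
  induction h with
  | refl => exact le_rfl
  | @step k _ ih =>
    refine ih.trans ?_
    have h1 : (1 : ℤ) ≤ p ^ k := by exact_mod_cast Nat.one_le_pow k p S.prime.pos
    have h2 : (0 : ℤ) ≤ p - 1 := by have := S.prime.one_le; omega
    have h3 : (0 : ℤ) ≤ n * ((p - 1) * (p ^ k - 1)) := by
      have : (0 : ℤ) ≤ p ^ k - 1 := by omega
      positivity
    push_cast
    rw [pow_succ]
    linarith

/-- Because the full series at γ vanishes, the partial sum γ_i is minus the tail starting at i + 1.
This is why the higher terms of D_x and D_y are small although the individual summands of γ_i are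
not. -/
theorem ordGE_kappa (S : FrobeniusData p n g τ σ) (i : ℕ) :
    OrdGE g (n * p ^ (i + 1) - n * (p - 1)) (kappa p n g i) := by
  have h1 : gammaPartial p (g ^ n) i
      = -∑' k : ℕ, (g ^ n) ^ p ^ (k + (i + 1)) / (p : K) ^ (k + (i + 1)) := by
    have := ((hasSum_nat_add_iff' (i + 1)).mpr S.hasSum).tsum_eq
    rw [this, gammaPartial]; ring
  have h2 : OrdGE g (n * p ^ (i + 1) - n * (p - 1) * (i + 1 : ℕ)) (gammaPartial p (g ^ n) i) := by
    rw [h1]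
    refine OrdGE.neg (OrdGE.tsum fun k => ?_)
    exact (S.ordGE_term _).mono S.gen_pos S.gen_lt (S.exponent_mono (by omega))
  have h3 : OrdGE g (n * (p - 1) * i) ((p : K) ^ i) := by
    rw [OrdGE, norm_pow, S.norm_prime_zpow, ← zpow_natCast, ← zpow_mul]
  have := h2.mul S.gen_pos h3
  rw [kappa]
  convert this using 1
  push_cast; ring

omit [IsUltrametricDist K] in
theorem kappa_zero : kappa p n g 0 = g ^ (n : ℤ) := by simp [kappa, gammaPartial]

omit [IsUltrametricDist K] in
/-- Successive terms of `D_x` and `D_y` are increasingly divisible by `g`. -/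
theorem exponent_gain (S : FrobeniusData p n g τ σ) (i : ℕ) :
    (n : ℤ) * p ^ i + i ≤ n * p ^ (i + 1) - n * (p - 1) := by
  have hp : (3 : ℤ) ≤ p := by exact_mod_cast S.two_lt
  have hn : (1 : ℤ) ≤ n := by exact_mod_cast S.n_pos
  have h1 : (i : ℤ) ≤ p ^ i - 1 := by
    have := Nat.lt_pow_self S.prime.one_lt (n := i)
    have h2 : ((i : ℕ) : ℤ) < ((p ^ i : ℕ) : ℤ) := by exact_mod_cast this
    push_cast at h2
    omega
  have h2 : (0 : ℤ) ≤ p ^ i - 1 := by omega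
  have h3 : ((p : ℤ) ^ i - 1) ≤ n * (p - 1) * (p ^ i - 1) := by
    apply le_mul_of_one_le_left h2
    nlinarith
  have h4 : (n : ℤ) * p ^ (i + 1) - n * (p - 1) = n * p ^ i + n * (p - 1) * (p ^ i - 1) := by
    rw [pow_succ]; ring
  rw [h4]
  linarith

theorem ordGE_kappa_self (S : FrobeniusData p n g τ σ) (i : ℕ) :
    OrdGE g (n * p ^ i + i) (kappa p n g i) :=
  (S.ordGE_kappa i).mono S.gen_pos S.gen_lt (S.exponent_gain i)

theorem norm_kappa_le (S : FrobeniusData p n g τ σ) (i : ℕ) : ‖kappa p n g i‖ ≤ ‖g‖ ^ i := by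
  have := (S.ordGE_kappa_self i).mono S.gen_pos S.gen_lt (l := i) (by
    have : (0 : ℤ) ≤ n * p ^ i := by positivity
    linarith)
  rwa [OrdGE, zpow_natCast] at this

end FrobeniusData

/-- The operator `c ↦ ∑_i q_i x ^ (p ^ i V) c`. -/
def shiftSum (p : ℕ) (q : ℕ → K) (V : ℤ × ℤ) (c : ℤ × ℤ → K) : ℤ × ℤ → K :=
  fun u => ∑' i : ℕ, q i * c (u.1 - V.1 * p ^ i, u.2 - V.2 * p ^ i)

/-- The common form of `D_x` and `D_y`. -/
def dworkOp (p n : ℕ) (g τ : K) (σ : K ≃+* K) (ℓ : ℤ × ℤ → ℤ) (m : K) (V : ℤ × ℤ)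
    (c : ℤ × ℤ → K) : ℤ × ℤ → K :=
  fun u => (ℓ u : K) * c u +
    ∑' i : ℕ, kappa p n g i *
      (m * c (u.1 - V.1 * p ^ i, u.2 - V.2 * p ^ i) -
        σ^[i] τ * c (u.1 - (-1) * p ^ i, u.2 - (-1) * p ^ i))

omit [IsUltrametricDist K] in
theorem Dx_eq (c : ℤ × ℤ → K) :
    Dx p n (g ^ n) τ σ c = dworkOp p n g τ σ Prod.fst n ((n : ℤ), 0) c := by
  funext u
  simp [Dx, dworkOp, kappa]

omit [IsUltrametricDist K] in
theorem Dy_eq (c : ℤ × ℤ → K) :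
    Dy p (g ^ n) τ σ c = dworkOp p n g τ σ Prod.snd 1 (0, 1) c := by
  funext u
  simp [Dy, dworkOp, kappa]

variable [CompleteSpace K]

omit [CompleteSpace K] in
theorem norm_shiftSum_le {q : ℕ → K} {V : ℤ × ℤ} {c : ℤ × ℤ → K} (hq : ∀ i, ‖q i‖ ≤ 1)
    (hc : ∀ u, ‖c u‖ ≤ 1) (u : ℤ × ℤ) : ‖shiftSum p q V c u‖ ≤ 1 := by
  refine IsUltrametricDist.norm_tsum_le_of_forall_le_of_nonneg zero_le_one fun i => ?_
  rw [norm_mul]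
  exact mul_le_one₀ (hq i) (norm_nonneg _) (hc _)

omit [IsUltrametricDist K] in
theorem summable_mul_of_norm_le_pow {r : ℝ} (hr : 0 ≤ r) (hr1 : r < 1) {q c : ℕ → K}
    (hq : ∀ i, ‖q i‖ ≤ r ^ i) (hc : ∀ i, ‖c i‖ ≤ 1) : Summable fun i => q i * c i := by
  refine Summable.of_norm_bounded (g := fun i => r ^ i)
    (summable_geometric_of_lt_one hr hr1) fun i => ?_
  rw [norm_mul]
  exact (mul_le_of_le_one_right (norm_nonneg _) (hc i)).trans (hq i)

theorem shiftSum_add {r : ℝ} (hr : 0 ≤ r) (hr1 : r < 1) {q : ℕ → K} (hq : ∀ i, ‖q i‖ ≤ r ^ i)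
    {V : ℤ × ℤ} {c d : ℤ × ℤ → K} (hc : ∀ u, ‖c u‖ ≤ 1) (hd : ∀ u, ‖d u‖ ≤ 1) :
    shiftSum p q V (c + d) = shiftSum p q V c + shiftSum p q V d := by
  funext u
  simp only [shiftSum, Pi.add_apply, mul_add]
  exact (summable_mul_of_norm_le_pow hr hr1 hq fun i => hc _).tsum_add
    (summable_mul_of_norm_le_pow hr hr1 hq fun i => hd _)

theorem shiftSum_sub {r : ℝ} (hr : 0 ≤ r) (hr1 : r < 1) {q : ℕ → K} (hq : ∀ i, ‖q i‖ ≤ r ^ i)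
    {V : ℤ × ℤ} {c d : ℤ × ℤ → K} (hc : ∀ u, ‖c u‖ ≤ 1) (hd : ∀ u, ‖d u‖ ≤ 1) :
    shiftSum p q V (c - d) = shiftSum p q V c - shiftSum p q V d := by
  funext u
  simp only [shiftSum, Pi.sub_apply, mul_sub]
  exact (summable_mul_of_norm_le_pow hr hr1 hq fun i => hc _).tsum_sub
    (summable_mul_of_norm_le_pow hr hr1 hq fun i => hd _)

omit [IsUltrametricDist K] [CompleteSpace K] in
theorem shiftSum_smul (q : ℕ → K) (V : ℤ × ℤ) (m : K) (c : ℤ × ℤ → K) :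
    shiftSum p q V (m • c) = m • shiftSum p q V c := by
  funext u
  simp only [shiftSum, Pi.smul_apply, smul_eq_mul, ← tsum_mul_left]
  exact tsum_congr fun i => by ring

theorem shiftSum_comm {r : ℝ} (hr : 0 ≤ r) (hr1 : r < 1) {q q' : ℕ → K}
    (hq : ∀ i, ‖q i‖ ≤ r ^ i) (hq' : ∀ i, ‖q' i‖ ≤ r ^ i) (V V' : ℤ × ℤ) {c : ℤ × ℤ → K}
    (hc : ∀ u, ‖c u‖ ≤ 1) :
    shiftSum p q V (shiftSum p q' V' c) = shiftSum p q' V' (shiftSum p q V c) := by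
  funext u
  simp only [shiftSum, ← tsum_mul_left]
  rw [Summable.tsum_comm]
  · refine tsum_congr fun i => tsum_congr fun j => ?_
    have h : ∀ a b c : ℤ, a - b - c = a - c - b := fun a b c => by ring
    rw [h u.1, h u.2]; ring
  · refine Summable.of_norm_bounded (g := fun x : ℕ × ℕ => r ^ x.1 * r ^ x.2) ?_ ?_
    · exact (summable_geometric_of_lt_one hr hr1).mul_of_nonneg
        (summable_geometric_of_lt_one hr hr1) (fun _ => pow_nonneg hr _) (fun _ => pow_nonneg hr _)
    · rintro ⟨i, j⟩
      simp only [Function.uncurry_apply_pair]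
      rw [norm_mul, norm_mul, ← mul_assoc]
      refine (mul_le_of_le_one_right (by positivity) (hc _)).trans ?_
      rw [mul_comm (r ^ i)]
      exact mul_le_mul (hq j) (hq' i) (norm_nonneg _) (pow_nonneg hr _)

/-- The commutator of multiplication by a linear form with `shiftSum`. -/
theorem linear_mul_shiftSum {r : ℝ} (hr : 0 ≤ r) (hr1 : r < 1) {q : ℕ → K}
    (hq : ∀ i, ‖q i‖ ≤ r ^ i) (V : ℤ × ℤ) {c : ℤ × ℤ → K} (hc : ∀ u, ‖c u‖ ≤ 1)
    (ℓ : ℤ × ℤ → ℤ) (hℓ : ∀ u (k : ℤ), ℓ (u.1 - V.1 * k, u.2 - V.2 * k) = ℓ u - ℓ V * k)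
    (u : ℤ × ℤ) :
    shiftSum p q V (fun v => (ℓ v : K) * c v) u
      = ℓ u * shiftSum p q V c u - ℓ V * shiftSum p (fun i => q i * (p : K) ^ i) V c u := by
  simp only [shiftSum, ← tsum_mul_left]
  have h1 : Summable fun i => q i * c (u.1 - V.1 * p ^ i, u.2 - V.2 * p ^ i) :=
    summable_mul_of_norm_le_pow hr hr1 hq fun i => hc _
  have h2 : Summable fun i => q i * (p : K) ^ i * c (u.1 - V.1 * p ^ i, u.2 - V.2 * p ^ i) := by
    refine summable_mul_of_norm_le_pow hr hr1 (fun i => ?_) fun i => hc _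
    rw [norm_mul, norm_pow]
    refine (mul_le_of_le_one_right (norm_nonneg _) ?_).trans (hq i)
    have := norm_intCast_le_one' (K := K) (p : ℤ)
    rw [Int.cast_natCast] at this
    exact pow_le_one₀ (norm_nonneg _) this
  rw [← (h1.mul_left (ℓ u : K)).tsum_sub (h2.mul_left (ℓ V : K))]
  refine tsum_congr fun i => ?_
  rw [hℓ]
  push_cast
  ring

namespace FrobeniusData

theorem dworkOp_eq (S : FrobeniusData p n g τ σ) (ℓ : ℤ × ℤ → ℤ) (m : K) (V : ℤ × ℤ)
    {c : ℤ × ℤ → K} (hc : ∀ u, ‖c u‖ ≤ 1) :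
    dworkOp p n g τ σ ℓ m V c = (fun u => (ℓ u : K) * c u) + m • shiftSum p (kappa p n g) V c
      - shiftSum p (fun i => kappa p n g i * σ^[i] τ) (-1, -1) c := by
  have hr := S.gen_pos.le
  funext u
  simp only [dworkOp, Pi.add_apply, Pi.sub_apply, Pi.smul_apply, smul_eq_mul, shiftSum,
    ← tsum_mul_left]
  rw [add_sub_assoc, ← Summable.tsum_sub]
  · congr 1
    exact tsum_congr fun i => by ring
  · exact (summable_mul_of_norm_le_pow hr S.gen_lt S.norm_kappa_le fun i => hc _).mul_left m
  · refine summable_mul_of_norm_le_pow hr S.gen_lt (fun i => ?_) fun i => hc _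
    rw [norm_mul, S.norm_sigma_iterate, mul_one]
    exact S.norm_kappa_le i

theorem dworkOp_add (S : FrobeniusData p n g τ σ) (ℓ : ℤ × ℤ → ℤ) (m : K) (V : ℤ × ℤ)
    {c d : ℤ × ℤ → K} (hc : ∀ u, ‖c u‖ ≤ 1) (hd : ∀ u, ‖d u‖ ≤ 1) :
    dworkOp p n g τ σ ℓ m V (c + d) = dworkOp p n g τ σ ℓ m V c + dworkOp p n g τ σ ℓ m V d := by
  have hr := S.gen_pos.le
  have hcd : ∀ u, ‖(c + d) u‖ ≤ 1 := fun u =>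
    (IsUltrametricDist.norm_add_le_max _ _).trans (max_le (hc u) (hd u))
  have hq : ∀ i, ‖kappa p n g i * σ^[i] τ‖ ≤ ‖g‖ ^ i := fun i => by
    rw [norm_mul, S.norm_sigma_iterate, mul_one]; exact S.norm_kappa_le i
  rw [S.dworkOp_eq _ _ _ hcd, S.dworkOp_eq _ _ _ hc, S.dworkOp_eq _ _ _ hd,
    shiftSum_add hr S.gen_lt S.norm_kappa_le hc hd, shiftSum_add hr S.gen_lt hq hc hd]
  funext u
  simp only [Pi.add_apply, Pi.sub_apply, Pi.smul_apply, smul_eq_mul]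
  ring

omit [IsUltrametricDist K] [CompleteSpace K] in
theorem dworkOp_smul (ℓ : ℤ × ℤ → ℤ) (m : K) (V : ℤ × ℤ) (s : K) (c : ℤ × ℤ → K) :
    dworkOp p n g τ σ ℓ m V (s • c) = s • dworkOp p n g τ σ ℓ m V c := by
  funext u
  simp only [dworkOp, Pi.smul_apply, smul_eq_mul, mul_add, ← tsum_mul_left]
  congr 1
  · ring
  · exact tsum_congr fun i => by ring

theorem dworkOp_sub (S : FrobeniusData p n g τ σ) (ℓ : ℤ × ℤ → ℤ) (m : K) (V : ℤ × ℤ)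
    {c d : ℤ × ℤ → K} (hc : ∀ u, ‖c u‖ ≤ 1) (hd : ∀ u, ‖d u‖ ≤ 1) :
    dworkOp p n g τ σ ℓ m V (c - d) = dworkOp p n g τ σ ℓ m V c - dworkOp p n g τ σ ℓ m V d := by
  have : c - d = c + (-1 : K) • d := by rw [neg_one_smul, sub_eq_add_neg]
  rw [this, S.dworkOp_add _ _ _ hc, dworkOp_smul, neg_one_smul, ← sub_eq_add_neg]
  intro u
  simpa using hd u

/-- The operators `D_x` and `D_y` commute. -/
theorem dworkOp_comm (S : FrobeniusData p n g τ σ) {c : ℤ × ℤ → K} (hc : ∀ u, ‖c u‖ ≤ 1) :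
    dworkOp p n g τ σ Prod.fst n ((n : ℤ), 0) (dworkOp p n g τ σ Prod.snd 1 (0, 1) c)
      = dworkOp p n g τ σ Prod.snd 1 (0, 1) (dworkOp p n g τ σ Prod.fst n ((n : ℤ), 0) c) := by
  have hr := S.gen_pos.le
  have hr1 := S.gen_lt
  have hκ := S.norm_kappa_le
  have hq : ∀ i, ‖kappa p n g i * σ^[i] τ‖ ≤ ‖g‖ ^ i := fun i => by
    rw [norm_mul, S.norm_sigma_iterate, mul_one]; exact S.norm_kappa_le i
  have h1 : ∀ i : ℕ, ‖g‖ ^ i ≤ 1 := fun i => pow_le_one₀ hr hr1.le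
  set q : ℕ → K := fun i => kappa p n g i * σ^[i] τ with hqdef
  have hℓ : ∀ (ℓ : ℤ × ℤ → ℤ) (c : ℤ × ℤ → K), (∀ u, ‖c u‖ ≤ 1) →
      ∀ u, ‖(fun v => (ℓ v : K) * c v) u‖ ≤ 1 := fun ℓ c hc u => by
    simp only [norm_mul]
    exact mul_le_one₀ (norm_intCast_le_one' _) (norm_nonneg _) (hc u)
  have hX : ∀ u, ‖shiftSum p (kappa p n g) ((n : ℤ), 0) c u‖ ≤ 1 :=
    norm_shiftSum_le (fun i => (hκ i).trans (h1 i)) hc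
  have hY : ∀ u, ‖shiftSum p (kappa p n g) (0, 1) c u‖ ≤ 1 :=
    norm_shiftSum_le (fun i => (hκ i).trans (h1 i)) hc
  have hZ : ∀ u, ‖shiftSum p q (-1, -1) c u‖ ≤ 1 :=
    norm_shiftSum_le (fun i => (hq i).trans (h1 i)) hc
  have hnX : ∀ u, ‖((n : K) • shiftSum p (kappa p n g) ((n : ℤ), 0) c) u‖ ≤ 1 := fun u => by
    rw [Pi.smul_apply, smul_eq_mul, norm_mul, S.norm_n, one_mul]; exact hX u
  have hadd : ∀ c d : ℤ × ℤ → K, (∀ u, ‖c u‖ ≤ 1) → (∀ u, ‖d u‖ ≤ 1) →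
      ∀ u, ‖(c + d) u‖ ≤ 1 := fun c d hc hd u =>
    (IsUltrametricDist.norm_add_le_max _ _).trans (max_le (hc u) (hd u))
  have hsub : ∀ c d : ℤ × ℤ → K, (∀ u, ‖c u‖ ≤ 1) → (∀ u, ‖d u‖ ≤ 1) →
      ∀ u, ‖(c - d) u‖ ≤ 1 := fun c d hc hd u =>
    (norm_sub_le_max_norm _ _).trans (max_le (hc u) (hd u))
  have hDy := hsub _ _ (hadd _ _ (hℓ Prod.snd c hc) hY) hZ
  have hDx := hsub _ _ (hadd _ _ (hℓ Prod.fst c hc) hnX) hZ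
  have e1 := S.dworkOp_eq Prod.snd (1 : K) (0, 1) hc
  have e2 := S.dworkOp_eq Prod.fst (n : K) ((n : ℤ), 0) hc
  rw [one_smul] at e1
  rw [e1, e2, S.dworkOp_eq _ _ _ hDy, S.dworkOp_eq _ _ _ hDx,
    shiftSum_sub hr hr1 hκ (hadd _ _ (hℓ Prod.snd c hc) hY) hZ,
    shiftSum_sub hr hr1 hq (hadd _ _ (hℓ Prod.snd c hc) hY) hZ,
    shiftSum_sub hr hr1 hκ (hadd _ _ (hℓ Prod.fst c hc) hnX) hZ,
    shiftSum_sub hr hr1 hq (hadd _ _ (hℓ Prod.fst c hc) hnX) hZ,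
    shiftSum_add hr hr1 hκ (hℓ Prod.snd c hc) hY, shiftSum_add hr hr1 hq (hℓ Prod.snd c hc) hY,
    shiftSum_add hr hr1 hκ (hℓ Prod.fst c hc) hnX, shiftSum_add hr hr1 hq (hℓ Prod.fst c hc) hnX,
    shiftSum_smul, shiftSum_smul,
    shiftSum_comm hr hr1 hκ hκ ((n : ℤ), 0) (0, 1) hc,
    shiftSum_comm hr hr1 hκ hq ((n : ℤ), 0) (-1, -1) hc,
    shiftSum_comm hr hr1 hκ hq (0, 1) (-1, -1) hc]
  funext u
  -- Only the linear forms fail to commute with the shifts. The mixed commutators with X and Y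
  -- vanish because one coordinate is 0; those with Z occur in both orders with the same coordinate
  -- -1 and cancel.
  have l1 := linear_mul_shiftSum (p := p) hr hr1 hκ ((n : ℤ), 0) hc Prod.snd (fun u k => by simp) u
  have l2 := linear_mul_shiftSum (p := p) hr hr1 hκ ((0 : ℤ), 1) hc Prod.fst (fun u k => by simp) u
  have l3 := linear_mul_shiftSum (p := p) hr hr1 hq ((-1 : ℤ), -1) hc Prod.snd (fun u k => by simp) u
  have l4 := linear_mul_shiftSum (p := p) hr hr1 hq ((-1 : ℤ), -1) hc Prod.fst (fun u k => by simp) u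
  simp only [Pi.add_apply, Pi.sub_apply, Pi.smul_apply, smul_eq_mul, l1, l2, l3, l4]
  push_cast
  ring

end FrobeniusData

end Operators

/-! ### The graded ring of the Newton polygon -/

section Graded

/-- Multiplication by the monomial of exponent `V`, of weight `n`, in the graded ring: products
of monomials which are not in a common cone vanish. -/
def starOp {R : Type*} [Zero R] (n : ℕ) (V : ℤ × ℤ) (a : ℤ × ℤ → R) (v : ℤ × ℤ) : R :=
  if nweight n (v - V) + n = nweight n v then a (v - V) else 0

/-- The leading form `(a, b) ↦ (m X - t Z) a + (Y - t Z) b` of `(D_x, D_y)`. -/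
def gradedOp {R : Type*} [CommRing R] (n : ℕ) (m t : R) (a b : ℤ × ℤ → R) (v : ℤ × ℤ) : R :=
  m * starOp n ((n : ℤ), 0) a v + starOp n (0, 1) b v
    - t * (starOp n (-1, -1) a v + starOp n (-1, -1) b v)

theorem starOp_add {R : Type*} [CommRing R] (n : ℕ) (V : ℤ × ℤ) (a b : ℤ × ℤ → R) (v : ℤ × ℤ) :
    starOp n V (a + b) v = starOp n V a v + starOp n V b v := by
  simp only [starOp, Pi.add_apply]; split_ifs <;> simp

theorem starOp_smul {R : Type*} [CommRing R] (n : ℕ) (V : ℤ × ℤ) (s : R) (a : ℤ × ℤ → R)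
    (v : ℤ × ℤ) : starOp n V (s • a) v = s * starOp n V a v := by
  simp only [starOp, Pi.smul_apply, smul_eq_mul]; split_ifs <;> simp

theorem starOp_zero {R : Type*} [CommRing R] (n : ℕ) (V : ℤ × ℤ) (v : ℤ × ℤ) :
    starOp n V (0 : ℤ × ℤ → R) v = 0 := by
  simp [starOp]

theorem gradedOp_add {R : Type*} [CommRing R] (n : ℕ) (m t : R) (a b a' b' : ℤ × ℤ → R)
    (v : ℤ × ℤ) :
    gradedOp n m t (a + a') (b + b') v = gradedOp n m t a b v + gradedOp n m t a' b' v := by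
  simp only [gradedOp, starOp_add]; ring

theorem gradedOp_smul {R : Type*} [CommRing R] (n : ℕ) (m t s : R) (a b : ℤ × ℤ → R)
    (v : ℤ × ℤ) : gradedOp n m t (s • a) (s • b) v = s * gradedOp n m t a b v := by
  simp only [gradedOp, starOp_smul]; ring

theorem starOp_single {R : Type*} [CommRing R] {n : ℕ} {V G : ℤ × ℤ}
    (h : nweight n (G + V) = nweight n G + n) :
    starOp n V (Pi.single G (1 : R)) = Pi.single (G + V) 1 := by
  funext v
  rw [starOp, Pi.single_apply, Pi.single_apply]
  by_cases hv : v = G + V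
  · subst hv; simp [h]
  · rw [if_neg hv]
    split_ifs with h1 h2
    · exact absurd (by rw [← h2, sub_add_cancel]) hv
    · rfl
    · rfl

theorem starOp_single_eq_zero {R : Type*} [CommRing R] {n : ℕ} {V G : ℤ × ℤ}
    (h : nweight n (G + V) ≠ nweight n G + n) :
    starOp n V (Pi.single G (1 : R)) = 0 := by
  funext v
  rw [starOp, Pi.single_apply]
  split_ifs with h1 h2
  · exfalso; apply h; rw [← h2, sub_add_cancel, h1]
  · rfl
  · rfl

variable {K : Type*} [NormedField K]

/-- In weight `d`, the element `c` of the graded ring is a multiple of the basis element of that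
weight plus an element of the ideal generated by the leading forms, with integral coefficients. -/
def Decomposable (n : ℕ) (m t : K) (d : ℤ) (c : ℤ × ℤ → K) : Prop :=
  ∃ (r : K) (ξ η : ℤ × ℤ → K), ‖r‖ ≤ 1 ∧ (2 * (n : ℤ) < d → r = 0) ∧ (∀ v, ‖ξ v‖ ≤ 1) ∧
    (∀ v, ‖η v‖ ≤ 1) ∧ ∀ v, nweight n v = d →
      c v = (if v = epsExp n d.toNat then r else 0) + gradedOp n m t ξ η v

variable {n : ℕ} {m t : K} {d : ℤ} {c c' : ℤ × ℤ → K}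

theorem Decomposable.add [IsUltrametricDist K] (h : Decomposable n m t d c)
    (h' : Decomposable n m t d c') : Decomposable n m t d (c + c') := by
  obtain ⟨r, ξ, η, h1, h2, h3, h4, h5⟩ := h
  obtain ⟨r', ξ', η', h1', h2', h3', h4', h5'⟩ := h'
  refine ⟨r + r', ξ + ξ', η + η', ?_, ?_, ?_, ?_, ?_⟩
  · exact (IsUltrametricDist.norm_add_le_max _ _).trans (max_le h1 h1')
  · intro h; rw [h2 h, h2' h, add_zero]
  · exact fun v => (IsUltrametricDist.norm_add_le_max _ _).trans (max_le (h3 v) (h3' v))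
  · exact fun v => (IsUltrametricDist.norm_add_le_max _ _).trans (max_le (h4 v) (h4' v))
  · intro v hv
    rw [Pi.add_apply, h5 v hv, h5' v hv, gradedOp_add]
    split_ifs <;> ring

theorem Decomposable.smul {s : K} (hs : ‖s‖ ≤ 1) (h : Decomposable n m t d c) :
    Decomposable n m t d (s • c) := by
  obtain ⟨r, ξ, η, h1, h2, h3, h4, h5⟩ := h
  refine ⟨s * r, s • ξ, s • η, ?_, ?_, ?_, ?_, ?_⟩
  · rw [norm_mul]; exact mul_le_one₀ hs (norm_nonneg _) h1
  · intro h; rw [h2 h, mul_zero]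
  · intro v; rw [Pi.smul_apply, smul_eq_mul, norm_mul]; exact mul_le_one₀ hs (norm_nonneg _) (h3 v)
  · intro v; rw [Pi.smul_apply, smul_eq_mul, norm_mul]; exact mul_le_one₀ hs (norm_nonneg _) (h4 v)
  · intro v hv
    rw [Pi.smul_apply, smul_eq_mul, h5 v hv, gradedOp_smul]
    split_ifs <;> ring

theorem decomposable_gradedOp {ξ η : ℤ × ℤ → K} (hξ : ∀ v, ‖ξ v‖ ≤ 1) (hη : ∀ v, ‖η v‖ ≤ 1) :
    Decomposable n m t d (gradedOp n m t ξ η) :=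
  ⟨0, ξ, η, by simp, fun _ => rfl, hξ, hη, fun v _ => by simp⟩

theorem decomposable_zero : Decomposable n m t d (0 : ℤ × ℤ → K) :=
  ⟨0, 0, 0, by simp, fun _ => rfl, by simp, by simp, fun v _ => by simp [gradedOp, starOp_zero]⟩

theorem norm_single_le (G : ℤ × ℤ) (v : ℤ × ℤ) : ‖(Pi.single G (1 : K) : ℤ × ℤ → K) v‖ ≤ 1 := by
  rw [Pi.single_apply]; split_ifs <;> simp

/-- The three monomials of weight `n` outside the origin on the rays of the fan. -/
def rayVec (n : ℕ) : Fin 3 → ℤ × ℤ := ![((n : ℤ), 0), (0, 1), (-1, -1)]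

variable [IsUltrametricDist K]

/-- Modulo the leading forms m X G ≡ t Z G and Y G ≡ t Z G, with m and t units, so the products of G
with the three rays are interchangeable. -/
theorem decomposable_ray_iff (hm : ‖m‖ = 1) (ht : ‖t‖ = 1) (G : ℤ × ℤ) (i j : Fin 3)
    (h : Decomposable n m t d (starOp n (rayVec n i) (Pi.single G 1))) :
    Decomposable n m t d (starOp n (rayVec n j) (Pi.single G 1)) := by
  have hm0 : m ≠ 0 := by rw [← norm_pos_iff, hm]; exact one_pos
  have ht0 : t ≠ 0 := by rw [← norm_pos_iff, ht]; exact one_pos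
  have hx : Decomposable n m t d (gradedOp n m t (Pi.single G 1) 0) :=
    decomposable_gradedOp (norm_single_le G) (by simp)
  have hy : Decomposable n m t d (gradedOp n m t 0 (Pi.single G 1)) :=
    decomposable_gradedOp (by simp) (norm_single_le G)
  have ex : gradedOp n m t (Pi.single G 1) 0 = m • starOp n (rayVec n 0) (Pi.single G 1)
      + (-t) • starOp n (rayVec n 2) (Pi.single G 1) := by
    funext v
    simp only [gradedOp, starOp_zero, Pi.add_apply, Pi.smul_apply, smul_eq_mul, rayVec,
      Matrix.cons_val]
    ring
  have ey : gradedOp n m t 0 (Pi.single G 1) = starOp n (rayVec n 1) (Pi.single G 1)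
      + (-t) • starOp n (rayVec n 2) (Pi.single G 1) := by
    funext v
    simp only [gradedOp, starOp_zero, Pi.add_apply, Pi.smul_apply, smul_eq_mul, rayVec,
      Matrix.cons_val]
    ring
  have hz : Decomposable n m t d (starOp n (rayVec n 2) (Pi.single G 1)) := by
    fin_cases i
    · have h1 := (hx.add (h.smul (s := -m) (by simp [hm]))).smul (s := -t⁻¹) (by simp [ht])
      convert h1 using 1
      rw [ex]; funext v
      simp only [Pi.add_apply, Pi.smul_apply, smul_eq_mul, Fin.zero_eta]
      field_simp; ring
    · have h1 := (hy.add (h.smul (s := -1) (by simp))).smul (s := -t⁻¹) (by simp [ht])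
      convert h1 using 1
      rw [ey]; funext v
      simp only [Pi.add_apply, Pi.smul_apply, smul_eq_mul, Fin.mk_one]
      field_simp; ring
    · exact h
  fin_cases j
  · have h1 := (hx.add (hz.smul (s := t) ht.le)).smul (s := m⁻¹) (by simp [hm])
    convert h1 using 1
    rw [ex]; funext v
    simp only [Pi.add_apply, Pi.smul_apply, smul_eq_mul, Fin.zero_eta]
    field_simp; ring
  · have h1 := hy.add (hz.smul (s := t) ht.le)
    convert h1 using 1
    rw [ey]; funext v
    simp only [Pi.add_apply, Pi.smul_apply, smul_eq_mul, Fin.mk_one]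
    ring
  · exact hz

/-- This trades one ray for another. If G has no common cone with the new ray, that product is 0 in
the graded ring and nothing remains to be shown. -/
theorem decomposable_single_add (hm : ‖m‖ = 1) (ht : ‖t‖ = 1) {G : ℤ × ℤ} (i j : Fin 3)
    (hj : nweight n (G + rayVec n j) = nweight n G + n)
    (h : nweight n (G + rayVec n i) = nweight n G + n →
      Decomposable n m t (nweight n (G + rayVec n i)) (Pi.single (G + rayVec n i) 1)) :
    Decomposable n m t (nweight n (G + rayVec n j)) (Pi.single (G + rayVec n j) 1) := by
  rw [hj, ← starOp_single hj]
  refine decomposable_ray_iff hm ht G i j ?_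
  by_cases hi : nweight n (G + rayVec n i) = nweight n G + n
  · rw [starOp_single hi, ← hi]; exact h hi
  · rw [starOp_single_eq_zero hi]; exact decomposable_zero

omit [IsUltrametricDist K] in
theorem decomposable_eps {i : ℕ} (hi : i ≤ 2 * n) :
    Decomposable n m t (nweight n (epsExp n i)) (Pi.single (epsExp n i) (1 : K)) := by
  rw [nweight_epsExp]
  refine ⟨1, 0, 0, by simp, fun h => ?_, by simp, by simp, fun v _ => ?_⟩
  · exfalso; omega
  · simp [gradedOp, starOp_zero, Pi.single_apply]

/-- Every monomial is a combination of the basis elements modulo the leading forms. -/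
theorem decomposable_single (hn : 0 < n) (hm : ‖m‖ = 1) (ht : ‖t‖ = 1) (u : ℤ × ℤ) :
    Decomposable n m t (nweight n u) (Pi.single u (1 : K)) := by
  let P : ℤ → ℤ → Prop := fun a b =>
    Decomposable n m t (nweight n (a, b)) (Pi.single (a, b) (1 : K))
  have hn' : (1 : ℤ) ≤ n := by exact_mod_cast hn
  have YofZ : ∀ a b : ℤ, (0 ≤ b ∨ a ≤ b) → ((a ≤ 0 ∨ b ≤ 0) → P (a - 1) (b - 1)) →
      P a (b + 1) := by
    intro a b h h'
    have := decomposable_single_add (n := n) (G := (a, b)) hm ht 2 1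
    simp only [rayVec, Matrix.cons_val, Prod.mk_add_mk, add_zero, nweight_add_Y,
      nweight_add_Z] at this
    exact this h h'
  have YofX : ∀ a b : ℤ, (0 ≤ b ∨ a ≤ b) → ((0 ≤ a ∨ b ≤ a) → P (a + n) b) → P a (b + 1) := by
    intro a b h h'
    have := decomposable_single_add (n := n) (G := (a, b)) hm ht 0 1
    simp only [rayVec, Matrix.cons_val, Prod.mk_add_mk, add_zero, nweight_add_Y,
      nweight_add_X hn] at this
    exact this h h'
  have XofZ : ∀ a b : ℤ, (0 ≤ a ∨ b ≤ a) → ((a ≤ 0 ∨ b ≤ 0) → P (a - 1) (b - 1)) →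
      P (a + n) b := by
    intro a b h h'
    have := decomposable_single_add (n := n) (G := (a, b)) hm ht 2 0
    simp only [rayVec, Matrix.cons_val, Prod.mk_add_mk, add_zero, nweight_add_X hn,
      nweight_add_Z] at this
    exact this h h'
  have XofY : ∀ a b : ℤ, (0 ≤ a ∨ b ≤ a) → ((0 ≤ b ∨ a ≤ b) → P a (b + 1)) → P (a + n) b := by
    intro a b h h'
    have := decomposable_single_add (n := n) (G := (a, b)) hm ht 1 0
    simp only [rayVec, Matrix.cons_val, Prod.mk_add_mk, add_zero, nweight_add_X hn,
      nweight_add_Y] at this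
    exact this h h'
  have ZofX : ∀ a b : ℤ, (a ≤ 0 ∨ b ≤ 0) → ((0 ≤ a ∨ b ≤ a) → P (a + n) b) →
      P (a - 1) (b - 1) := by
    intro a b h h'
    have := decomposable_single_add (n := n) (G := (a, b)) hm ht 0 2
    simp only [rayVec, Matrix.cons_val, Prod.mk_add_mk, add_zero, nweight_add_X hn,
      nweight_add_Z] at this
    exact this h h'
  have ZofY : ∀ a b : ℤ, (a ≤ 0 ∨ b ≤ 0) → ((0 ≤ b ∨ a ≤ b) → P a (b + 1)) →
      P (a - 1) (b - 1) := by
    intro a b h h'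
    have := decomposable_single_add (n := n) (G := (a, b)) hm ht 1 2
    simp only [rayVec, Matrix.cons_val, Prod.mk_add_mk, add_zero, nweight_add_Y,
      nweight_add_Z] at this
    exact this h h'
  -- the first cone
  have eps0 : ∀ a : ℤ, 0 ≤ a → a ≤ n → P a 0 := by
    intro a h1 h2
    have := decomposable_eps (m := m) (t := t) (n := n) (i := a.toNat) (by omega)
    have he : epsExp n a.toNat = (a, 0) := by
      rw [epsExp, if_pos (by omega)]; ext <;> simp [h1]
    rwa [he] at this
  have eps1 : ∀ a : ℤ, 1 ≤ a → a ≤ n → P a 1 := by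
    intro a h1 h2
    have := decomposable_eps (m := m) (t := t) (n := n) (i := (a + n).toNat) (by omega)
    have he : epsExp n (a + n).toNat = (a, 1) := by
      rw [epsExp, if_neg (by omega)]; ext <;> simp; omega
    rwa [he] at this
  -- The factor (a, b - 1) is interior to the first cone, hence killed by the opposite ray Z, so
  -- trading Y for Z finishes.
  have c1a : ∀ a b : ℤ, 1 ≤ a → 2 ≤ b → P a b := by
    intro a b h1 h2
    have := YofZ a (b - 1) (by omega) (by omega)
    rwa [sub_add_cancel] at this
  have c1b : ∀ a : ℤ, 1 ≤ a → P a 1 := by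
    intro a h1
    by_cases h : a ≤ n
    · exact eps1 a h1 h
    · have := XofZ (a - n) 1 (by omega) (by omega)
      rwa [sub_add_cancel] at this
  -- On the axis beyond (n, 0), trading X for Y moves the point to height 1, which is already
  -- settled.
  have c1c : ∀ a : ℤ, 0 ≤ a → P a 0 := by
    intro a h1
    by_cases h : a ≤ n
    · exact eps0 a h1 h
    · have := XofY (a - n) 0 (by omega) (fun _ => c1b _ (by omega))
      rwa [sub_add_cancel] at this
  have c1pos : ∀ a b : ℤ, 1 ≤ a → 0 ≤ b → P a b := by
    intro a b h1 h2
    rcases (by omega : b = 0 ∨ b = 1 ∨ 2 ≤ b) with rfl | rfl | h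
    · exact c1c a (by omega)
    · exact c1b a h1
    · exact c1a a b h1 h
  have c1 : ∀ a b : ℤ, 0 ≤ a → 0 ≤ b → P a b := by
    intro a b h1 h2
    rcases (by omega : 1 ≤ a ∨ a = 0) with h | rfl
    · exact c1pos a b h h2
    rcases (by omega : b = 0 ∨ 1 ≤ b) with rfl | h
    · exact c1c 0 le_rfl
    · have := YofX 0 (b - 1) (by omega) (fun _ => c1pos _ _ (by omega) (by omega))
      rwa [sub_add_cancel] at this
  -- the third cone
  have c3a : ∀ a b : ℤ, b < 0 → b < a → P a b := by
    intro a b h1 h2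
    -- Trading Z for Y gives a nonzero product only for b = -1, and then the result lies in the
    -- first cone.
    have key := ZofY (a + 1) (b + 1) (by omega) (fun h => by
      have hb : b = -1 := by omega
      subst hb
      exact c1 _ _ (by omega) (by omega))
    simpa using key
  have c3 : ∀ a b : ℤ, b < 0 → b ≤ a → P a b := by
    intro a b h1 h2
    rcases h2.lt_or_eq with h | rfl
    · exact c3a a b h1 h
    have key := ZofX (b + 1) (b + 1) (by omega) (fun _ => by
      by_cases hb : b + 1 < 0
      · exact c3a _ _ hb (by omega)
      · exact c1 _ _ (by omega) (by omega))
    simpa using key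
  -- the second cone
  have c2 : ∀ a b : ℤ, a < 0 → a < b → P a b := by
    intro a b h1 h2
    have key := ZofX (a + 1) (b + 1) (by omega) (fun h => by
      have ha : a = -1 := by omega
      subst ha
      exact c1 _ _ (by omega) (by omega))
    simpa using key
  obtain ⟨a, b⟩ := u
  rcases (by omega : (0 ≤ a ∧ 0 ≤ b) ∨ (b < 0 ∧ b ≤ a) ∨ (a < 0 ∧ a < b)) with h | h | h
  · exact c1 a b h.1 h.2
  · exact c3 a b h.1 h.2
  · exact c2 a b h.1 h.2

theorem finite_nweight_eq (hn : 0 < n) (d : ℤ) : {u : ℤ × ℤ | nweight n u = d}.Finite := by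
  refine ((Set.finite_Icc (-d) d).prod (Set.finite_Icc (-d) d)).subset fun u hu => ?_
  have := bounds_of_nweight hn (a := u.1) (b := u.2) hu
  exact ⟨⟨this.1, this.2.1⟩, ⟨this.2.2.1, this.2.2.2⟩⟩

theorem gradedOp_sum {R ι : Type*} [CommRing R] (m t : R) (s : Finset ι) (f : ι → R)
    (a b : ι → ℤ × ℤ → R) (v : ℤ × ℤ) :
    gradedOp n m t (fun w => ∑ i ∈ s, f i * a i w) (fun w => ∑ i ∈ s, f i * b i w) v
      = ∑ i ∈ s, f i * gradedOp n m t (a i) (b i) v := by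
  classical
  induction s using Finset.induction_on with
  | empty =>
    simp only [Finset.sum_empty]
    have : (fun _ : ℤ × ℤ => (0 : R)) = 0 := rfl
    rw [this, gradedOp]; simp [starOp_zero]
  | insert i s hi ih =>
    simp only [Finset.sum_insert hi]
    rw [← ih, ← gradedOp_smul, ← gradedOp_add]
    rfl

/-- The decomposition of the part of weight `d` of a series, with bounds. -/
theorem exists_decomposition (hn : 0 < n) (hm : ‖m‖ = 1) (ht : ‖t‖ = 1) (d : ℤ)
    (c : ℤ × ℤ → K) :
    ∃ (r : K) (ξ η : ℤ × ℤ → K), (2 * (n : ℤ) < d → r = 0) ∧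
      (∀ v, nweight n v = d →
        c v = (if v = epsExp n d.toNat then r else 0) + gradedOp n m t ξ η v) ∧
      (∀ C : ℝ, 0 ≤ C → (∀ u, nweight n u = d → ‖c u‖ ≤ C) →
        ‖r‖ ≤ C ∧ (∀ v, ‖ξ v‖ ≤ C) ∧ ∀ v, ‖η v‖ ≤ C) := by
  have hdec := fun u => decomposable_single (n := n) hn hm ht u
  choose r ξ η h1 h2 h3 h4 h5 using hdec
  let s := (finite_nweight_eq hn d).toFinset
  have hs : ∀ u, u ∈ s ↔ nweight n u = d := fun u => by simp [s]
  refine ⟨∑ u ∈ s, c u * r u, fun v => ∑ u ∈ s, c u * ξ u v, fun v => ∑ u ∈ s, c u * η u v,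
    ?_, ?_, ?_⟩
  · intro h
    refine Finset.sum_eq_zero fun u hu => ?_
    rw [h2 u (by rw [(hs u).mp hu]; exact h), mul_zero]
  · intro v hv
    rw [gradedOp_sum]
    have : (if v = epsExp n d.toNat then ∑ u ∈ s, c u * r u else 0)
        = ∑ u ∈ s, c u * (if v = epsExp n d.toNat then r u else 0) := by
      split_ifs <;> simp
    rw [this, ← Finset.sum_add_distrib]
    simp only [← mul_add]
    rw [Finset.sum_eq_single_of_mem v ((hs v).mpr hv)]
    · have := h5 v v rfl
      rw [hv] at this
      rw [← this]; simp
    · intro u hu huv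
      have hu' := (hs u).mp hu
      have := h5 u v (by rw [hv, hu'])
      rw [hu'] at this
      rw [← this, Pi.single_eq_of_ne (Ne.symm huv), mul_zero]
  · intro C hC hc
    have hb : ∀ f : ℤ × ℤ → K, (∀ u, ‖f u‖ ≤ 1) → ‖∑ u ∈ s, c u * f u‖ ≤ C := by
      intro f hf
      refine IsUltrametricDist.norm_sum_le_of_forall_le_of_nonneg hC fun u hu => ?_
      rw [norm_mul]
      exact (mul_le_of_le_one_right (norm_nonneg _) (hf u)).trans (hc u ((hs u).mp hu))
    exact ⟨hb r h1, fun v => hb _ fun u => h3 u v, fun v => hb _ fun u => h4 u v⟩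

/-- As `exists_decomposition`, with control of the coefficient of the basis element. -/
theorem exists_decomposition' (hn : 0 < n) (hm : ‖m‖ = 1) (ht : ‖t‖ = 1) {d : ℤ} (hd0 : 0 ≤ d)
    (c : ℤ × ℤ → K) :
    ∃ (r : K) (ξ η : ℤ × ℤ → K), (2 * (n : ℤ) < d → r = 0) ∧
      (∀ v, nweight n v = d →
        c v = (if v = epsExp n d.toNat then r else 0) + gradedOp n m t ξ η v) ∧
      (∀ C : ℝ, 0 ≤ C → (∀ u, nweight n u = d → ‖c u‖ ≤ C) →
        ‖r‖ ≤ C ∧ (∀ v, ‖ξ v‖ ≤ C) ∧ ∀ v, ‖η v‖ ≤ C) ∧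
      (d ≤ 2 * (n : ℤ) → ∀ C : ℝ, 0 ≤ C →
        (∀ u, nweight n u = d → u ≠ epsExp n d.toNat → ‖c u‖ ≤ C) →
        ‖r - c (epsExp n d.toNat)‖ ≤ C) := by
  by_cases hd : 2 * (n : ℤ) < d
  · obtain ⟨r, ξ, η, h1, h2, h3⟩ := exists_decomposition (n := n) hn hm ht d c
    exact ⟨r, ξ, η, h1, h2, h3, fun h => by omega⟩
  set e := epsExp n d.toNat with he
  -- The coefficient of the basis monomial is set aside and added back afterwards, so that the
  -- correction to it is bounded by the other coefficients alone.
  obtain ⟨r, ξ, η, h1, h2, h3⟩ := exists_decomposition (n := n) hn hm ht d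
    (fun u => if u = e then 0 else c u)
  have hle : ∀ C : ℝ, 0 ≤ C → (∀ u, nweight n u = d → u ≠ e → ‖c u‖ ≤ C) →
      ∀ u, nweight n u = d → ‖(fun u => if u = e then 0 else c u) u‖ ≤ C := by
    intro C hC hc u hu
    dsimp only
    split_ifs with h
    · simpa using hC
    · exact hc u hu h
  refine ⟨r + c e, ξ, η, fun h => absurd h hd, ?_, ?_, ?_⟩
  · intro v hv
    have := h2 v hv
    by_cases hve : v = e
    · rw [if_pos hve] at this ⊢
      rw [if_pos hve] at this
      rw [hve] at this ⊢
      linear_combination this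
    · rw [if_neg hve] at this ⊢
      rw [if_neg hve] at this
      exact this
  · intro C hC hc
    obtain ⟨b1, b2, b3⟩ := h3 C hC (hle C hC fun u hu _ => hc u hu)
    refine ⟨(IsUltrametricDist.norm_add_le_max _ _).trans (max_le b1 (hc e ?_)), b2, b3⟩
    rw [he, nweight_epsExp]; omega
  · intro _ C hC hc
    rw [add_sub_cancel_right]
    exact (h3 C hC (hle C hC hc)).1

end Graded

/-! ### Reduction to the basis -/

section Reduction

variable {K : Type*} [NormedField K] [IsUltrametricDist K] {p n : ℕ} {g τ : K} {σ : K ≃+* K}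

/-- The exponents of the lattice in which the images of the basis under `α₁` are reduced: the
slope is `p` up to weight `2 n`, and smaller from there on. -/
def latticeExp (p n : ℕ) (d : ℤ) : ℤ := (p - 1) * d + min d (2 * n)

theorem latticeExp_add_one_le (hp : 2 < p) {d d' : ℤ} (h : d < d') :
    latticeExp p n d + 1 ≤ latticeExp p n d' := by
  have hp' : (2 : ℤ) ≤ p - 1 := by omega
  have h1 : min d (2 * (n : ℤ)) ≤ min d' (2 * n) := by omega
  have h2 : ((p : ℤ) - 1) * (d + 1) ≤ (p - 1) * d' := by
    apply mul_le_mul_of_nonneg_left (by omega) (by omega)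
  unfold latticeExp
  linarith

theorem latticeExp_mono (hp : 2 < p) {d d' : ℤ} (h : d ≤ d') :
    latticeExp p n d ≤ latticeExp p n d' := by
  rcases h.lt_or_eq with h | rfl
  · have := latticeExp_add_one_le (n := n) hp h; omega
  · exact le_rfl

/-- The derivative parts x∂/∂x and y∂/∂y do not raise the weight. This gain over a step of n makes
them errors even after ξ and η have been divided by g ^ n; it needs p - 1 ≥ 2. -/
theorem latticeExp_add_le (hp : 2 < p) (hn : 0 < n) (d : ℤ) :
    latticeExp p n d + n + 1 ≤ latticeExp p n (d + n) := by
  have hp' : (2 : ℤ) ≤ p - 1 := by omega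
  have h1 : min d (2 * (n : ℤ)) ≤ min (d + n) (2 * n) := by omega
  have h2 : 2 * (n : ℤ) ≤ (p - 1) * n := mul_le_mul_of_nonneg_right hp' (by omega)
  have h3 : (1 : ℤ) ≤ n := by omega
  unfold latticeExp
  rw [mul_add]
  linarith

/-- This is the reason for the flattened slope. With slope p in all weights the terms i ≥ 1 of the
operators would land exactly in the lattice without the extra factor g; lowering the slope by one
above weight 2n gains it, since n p ^ i - n ≥ n + 1. -/
theorem latticeExp_add_le_of_high (hp : 2 < p) (hn : 0 < n) {i : ℕ} (hi : 1 ≤ i) {d d' : ℤ}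
    (hd' : (n : ℤ) ≤ d') (h : d ≤ d' + n * p ^ i - n) :
    latticeExp p n d + 1 ≤ n * p ^ (i + 1) - n * p + latticeExp p n d' := by
  refine (add_le_add_left (latticeExp_mono hp h) 1).trans ?_
  have hp3 : (3 : ℤ) ≤ p := by exact_mod_cast hp
  have hpi : (p : ℤ) ≤ p ^ i := le_self_pow₀ (by omega) (by omega)
  have hn' : (1 : ℤ) ≤ n := by exact_mod_cast hn
  have hQ : (n : ℤ) + 1 ≤ n * p ^ i - n := by nlinarith
  have h1 : min (d' + n * p ^ i - n) (2 * (n : ℤ)) ≤ 2 * n := min_le_right _ _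
  have h2 : (n : ℤ) ≤ min d' (2 * n) := by omega
  unfold latticeExp
  have h3 : (n : ℤ) * p ^ (i + 1) = p * (n * p ^ i) := by rw [pow_succ]; ring
  rw [h3]
  generalize (n : ℤ) * p ^ i = Q at *
  linarith

theorem latticeExp_add_sub_nonneg (hp : 2 < p) (hn : 0 < n) {d : ℤ} (hd : 0 ≤ d) :
    2 * d ≤ latticeExp p n (d + n) - n := by
  have := latticeExp_add_le hp hn d
  have h1 : 0 ≤ min d (2 * (n : ℤ)) := by omega
  have h2 : 2 * d ≤ (p - 1) * d := mul_le_mul_of_nonneg_right (by omega) hd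
  unfold latticeExp at *
  linarith

theorem latticeExp_of_le {d : ℤ} (hd : d ≤ 2 * n) : latticeExp p n d = p * d := by
  rw [latticeExp, min_eq_left hd]; ring

theorem latticeExp_le (d : ℤ) : latticeExp p n d ≤ p * d := by
  have : min d (2 * (n : ℤ)) ≤ d := min_le_left _ _
  unfold latticeExp; linarith

variable [CompleteSpace K]

namespace FrobeniusData

/-- The leading terms of `D_x` and `D_y`, with a bound for the remaining ones. -/
theorem ordGE_dworkOp_sub (S : FrobeniusData p n g τ σ) (ℓ : ℤ × ℤ → ℤ) {m : K} (hm : ‖m‖ ≤ 1)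
    (V : ℤ × ℤ) {c : ℤ × ℤ → K} (hc : ∀ u, ‖c u‖ ≤ 1) (u : ℤ × ℤ) {k : ℤ}
    (hV : ∀ i : ℕ, 1 ≤ i →
      OrdGE g k (kappa p n g i * c (u.1 - V.1 * p ^ i, u.2 - V.2 * p ^ i)))
    (hZ : ∀ i : ℕ, 1 ≤ i →
      OrdGE g k (kappa p n g i * c (u.1 - (-1) * p ^ i, u.2 - (-1) * p ^ i))) :
    OrdGE g k (dworkOp p n g τ σ ℓ m V c u - ((ℓ u : K) * c u +
      g ^ (n : ℤ) * (m * c (u - V) - τ * c (u - (-1, -1))))) := by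
  have hr := S.gen_pos.le
  have hsum : Summable fun i : ℕ => kappa p n g i *
      (m * c (u.1 - V.1 * p ^ i, u.2 - V.2 * p ^ i) -
        σ^[i] τ * c (u.1 - (-1) * p ^ i, u.2 - (-1) * p ^ i)) := by
    refine summable_mul_of_norm_le_pow hr S.gen_lt S.norm_kappa_le fun i => ?_
    refine (norm_sub_le_max_norm _ _).trans (max_le ?_ ?_)
    · rw [norm_mul]; exact mul_le_one₀ hm (norm_nonneg _) (hc _)
    · rw [norm_mul, S.norm_sigma_iterate, one_mul]; exact hc _
  have hu : ∀ W : ℤ × ℤ, (u.1 - W.1 * (p : ℤ) ^ 0, u.2 - W.2 * (p : ℤ) ^ 0) = u - W := fun W => by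
    ext <;> simp
  have key : dworkOp p n g τ σ ℓ m V c u - ((ℓ u : K) * c u +
      g ^ (n : ℤ) * (m * c (u - V) - τ * c (u - (-1, -1))))
      = ∑' i : ℕ, kappa p n g (i + 1) *
      (m * c (u.1 - V.1 * p ^ (i + 1), u.2 - V.2 * p ^ (i + 1)) -
        σ^[i + 1] τ * c (u.1 - (-1) * p ^ (i + 1), u.2 - (-1) * p ^ (i + 1))) := by
    rw [dworkOp, hsum.tsum_eq_zero_add, hu V, hu (-1, -1), kappa_zero]
    simp only [Function.iterate_zero, id_eq]
    ring
  rw [key]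
  refine OrdGE.tsum fun i => ?_
  have h1 := (hV (i + 1) (by omega)).unit_mul hm
  have h2 := (hZ (i + 1) (by omega)).unit_mul (S.norm_sigma_iterate (i + 1)).le
  convert h1.sub h2 using 1
  ring

-- The decompositions are chosen separately in each weight d, but multiplication into weight d only
-- reads its argument in weight d - n. The separate choices therefore glue to one series.
omit [IsUltrametricDist K] [CompleteSpace K] in
theorem starOp_glue (V : ℤ × ℤ) (ξ : ℕ → ℤ × ℤ → K) (v : ℤ × ℤ) :
    starOp n V (ξ (nweight n v).toNat) v
      = starOp n V (fun w => ξ (nweight n w + n).toNat w) v := by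
  simp only [starOp]
  split_ifs with h
  · rw [h]
  · rfl

omit [IsUltrametricDist K] [CompleteSpace K] in
/-- In the lattice, multiplication by a monomial is multiplication in the graded ring up to
a multiple of `g`. -/
theorem ordGE_sub_starOp (S : FrobeniusData p n g τ σ) {F : ℤ × ℤ → K}
    (hF : ∀ v, OrdGE g (latticeExp p n (nweight n v + n)) (F v)) (V v : ℤ × ℤ)
    (hV : nweight n v ≤ nweight n (v - V) + n) :
    OrdGE g (latticeExp p n (nweight n v) + 1) (F (v - V) - starOp n V F v) := by
  rw [starOp]
  split_ifs with h
  · rw [sub_self]; exact OrdGE.zero _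
  · rw [sub_zero]
    exact (hF _).mono S.gen_pos S.gen_lt
      (latticeExp_add_one_le S.two_lt (lt_of_le_of_ne hV (Ne.symm h)))

omit [IsUltrametricDist K] [CompleteSpace K] in
theorem nweight_le_sub_ray (v : ℤ × ℤ) :
    nweight n v ≤ nweight n (v - ((n : ℤ), 0)) + n ∧ nweight n v ≤ nweight n (v - (0, 1)) + n ∧
      nweight n v ≤ nweight n (v - (-1, -1)) + n := by
  refine ⟨?_, ?_, ?_⟩
  · have := nweight_le_sub_X (n := n) v (k := 1) (by norm_num)
    simp only [mul_one] at this
    exact this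
  · have := nweight_le_sub_Y (n := n) v (k := 1) (by norm_num)
    simp only [mul_one] at this
    exact this
  · have := nweight_le_sub_Z (n := n) v (k := 1) (by norm_num)
    simp only [mul_one] at this
    exact this

omit [CompleteSpace K] in
theorem ordGE_high_lattice (S : FrobeniusData p n g τ σ) {ξ : ℤ × ℤ → K}
    (hξ : ∀ v, OrdGE g (latticeExp p n (nweight n v + n) - n) (ξ v)) {i : ℕ} (hi : 1 ≤ i)
    {v w : ℤ × ℤ} (h : nweight n v ≤ nweight n w + n * p ^ i) :
    OrdGE g (latticeExp p n (nweight n v) + 1) (kappa p n g i * ξ w) := by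
  refine ((S.ordGE_kappa i).mul S.gen_pos (hξ w)).mono S.gen_pos S.gen_lt ?_
  have h0 := nweight_nonneg (n := n) w
  have := latticeExp_add_le_of_high (d := nweight n v) (d' := nweight n w + n) S.two_lt S.n_pos hi
    (by omega) (by omega)
  linarith

omit [IsUltrametricDist K] [CompleteSpace K] in
theorem norm_le_one_of_lattice (S : FrobeniusData p n g τ σ) {ξ : ℤ × ℤ → K}
    (hξ : ∀ v, OrdGE g (latticeExp p n (nweight n v + n) - n) (ξ v)) (v : ℤ × ℤ) : ‖ξ v‖ ≤ 1 := by
  rw [← ordGE_zero_iff (g := g)]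
  refine (hξ v).mono S.gen_pos S.gen_lt ?_
  have h0 := nweight_nonneg (n := n) v
  have := latticeExp_add_sub_nonneg S.two_lt S.n_pos h0
  omega

omit [IsUltrametricDist K] [CompleteSpace K] in
theorem sum_single_eps (r : ℕ → K) (hr : ∀ d, 2 * n < d → r d = 0) (v : ℤ × ℤ) :
    (∑ j ∈ Finset.range (2 * n + 1), (Pi.single (epsExp n j) (r j) : ℤ × ℤ → K)) v
      = if v = epsExp n (nweight n v).toNat then r (nweight n v).toNat else 0 := by
  rw [Finset.sum_apply]
  simp only [Pi.single_apply]
  split_ifs with h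
  · by_cases hd : (nweight n v).toNat ∈ Finset.range (2 * n + 1)
    · rw [Finset.sum_eq_single_of_mem _ hd, if_pos h]
      intro j _ hj
      rw [if_neg]
      intro h'
      apply hj
      apply epsExp_injective (n := n)
      rw [← h, ← h']
    · rw [Finset.mem_range, not_lt] at hd
      rw [hr _ (by omega)]
      refine Finset.sum_eq_zero fun j hj => ?_
      rw [if_neg]
      intro h'
      rw [Finset.mem_range] at hj
      rw [h', nweight_epsExp] at hd
      omega
  · refine Finset.sum_eq_zero fun j _ => ?_
    rw [if_neg]
    intro h'
    apply h
    have : nweight n v = j := by rw [h', nweight_epsExp]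
    rw [this, Int.toNat_natCast]; exact h'

/-- One step of the reduction to the basis. -/
theorem exists_reduction_step (S : FrobeniusData p n g τ σ) {c : ℤ × ℤ → K}
    (hc : ∀ u, OrdGE g (latticeExp p n (nweight n u)) (c u)) :
    ∃ (r : ℕ → K) (ξ η c' : ℤ × ℤ → K),
      (∀ d : ℕ, OrdGE g (latticeExp p n d) (r d)) ∧
      (∀ v, OrdGE g (latticeExp p n (nweight n v + n) - n) (ξ v)) ∧
      (∀ v, OrdGE g (latticeExp p n (nweight n v + n) - n) (η v)) ∧
      (∀ u, OrdGE g (latticeExp p n (nweight n u)) (c' u)) ∧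
      (c = ∑ j ∈ Finset.range (2 * n + 1), Pi.single (epsExp n j) (r j) +
        dworkOp p n g τ σ Prod.fst n ((n : ℤ), 0) ξ + dworkOp p n g τ σ Prod.snd 1 (0, 1) η +
        g • c') ∧
      ∀ j : ℕ, j ≤ 2 * n →
        (∀ u, nweight n u = j → u ≠ epsExp n j → OrdGE g (latticeExp p n j + 1) (c u)) →
        OrdGE g (latticeExp p n j + 1) (r j - c (epsExp n j)) := by
  have hg0 := S.gen_ne
  have hdec := fun d : ℕ => exists_decomposition' (n := n) S.n_pos S.norm_n S.norm_tau
    (Int.natCast_nonneg d) c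
  simp only [Int.toNat_natCast] at hdec
  choose r ξ η h1 h2 h3 h4 using hdec
  have hb : ∀ d : ℕ, OrdGE g (latticeExp p n d) (r d) ∧
      (∀ v, OrdGE g (latticeExp p n d) (ξ d v)) ∧ ∀ v, OrdGE g (latticeExp p n d) (η d v) :=
    fun d => h3 d _ (by positivity) fun u hu => by rw [← hu]; exact hc u
  have hw : ∀ v, ((nweight n v + n).toNat : ℤ) = nweight n v + n := fun v => by
    have := nweight_nonneg (n := n) v; omega
  have hw' : ∀ v, ((nweight n v).toNat : ℤ) = nweight n v := fun v => by
    have := nweight_nonneg (n := n) v; omega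
  set F : ℤ × ℤ → K := fun v => ξ (nweight n v + n).toNat v with hF
  set G : ℤ × ℤ → K := fun v => η (nweight n v + n).toNat v with hG
  have hFb : ∀ v, OrdGE g (latticeExp p n (nweight n v + n)) (F v) := fun v => by
    have := (hb (nweight n v + n).toNat).2.1 v
    rwa [hw] at this
  have hGb : ∀ v, OrdGE g (latticeExp p n (nweight n v + n)) (G v) := fun v => by
    have := (hb (nweight n v + n).toNat).2.2 v
    rwa [hw] at this
  -- The leading forms occur in the operators with the factor γ = g ^ n, which is divided out here.
  set Ξ : ℤ × ℤ → K := fun v => F v * g ^ (-(n : ℤ)) with hΞ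
  set H : ℤ × ℤ → K := fun v => G v * g ^ (-(n : ℤ)) with hH
  have hΞb : ∀ v, OrdGE g (latticeExp p n (nweight n v + n) - n) (Ξ v) := fun v => by
    have := (hFb v).mul_zpow S.gen_pos (-(n : ℤ))
    rwa [← sub_eq_add_neg] at this
  have hHb : ∀ v, OrdGE g (latticeExp p n (nweight n v + n) - n) (H v) := fun v => by
    have := (hGb v).mul_zpow S.gen_pos (-(n : ℤ))
    rwa [← sub_eq_add_neg] at this
  have hgn : ∀ x : K, g ^ (n : ℤ) * (x * g ^ (-(n : ℤ))) = x := fun x => by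
    rw [mul_left_comm, ← zpow_add₀ hg0]; simp
  have hrz : ∀ d, 2 * n < d → r d = 0 := fun d hd => h1 d (by exact_mod_cast hd)
  -- There are three kinds of error, each with an extra factor g: the terms i ≥ 1, the products of
  -- monomials without a common cone, and the derivative parts.
  have herr : ∀ v, OrdGE g (latticeExp p n (nweight n v) + 1)
      (c v - ((∑ j ∈ Finset.range (2 * n + 1), (Pi.single (epsExp n j) (r j) : ℤ × ℤ → K)) v +
        dworkOp p n g τ σ Prod.fst n ((n : ℤ), 0) Ξ v +
        dworkOp p n g τ σ Prod.snd 1 (0, 1) H v)) := by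
    intro v
    have e1 := h2 (nweight n v).toNat v (hw' v).symm
    rw [gradedOp, starOp_glue _ ξ, starOp_glue _ ξ, starOp_glue _ η, starOp_glue _ η,
      ← sum_single_eps r hrz v] at e1
    have hpos : ∀ i : ℕ, (0 : ℤ) ≤ (p : ℤ) ^ i := fun i => by positivity
    have hX := S.ordGE_dworkOp_sub Prod.fst S.norm_n.le ((n : ℤ), 0) (S.norm_le_one_of_lattice hΞb)
      v (fun i hi => S.ordGE_high_lattice hΞb hi (nweight_le_sub_X v (hpos i)))
      (fun i hi => S.ordGE_high_lattice hΞb hi (nweight_le_sub_Z v (hpos i)))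
    have hY := S.ordGE_dworkOp_sub Prod.snd (m := 1) (by simp) (0, 1)
      (S.norm_le_one_of_lattice hHb)
      v (fun i hi => S.ordGE_high_lattice hHb hi (nweight_le_sub_Y v (hpos i)))
      (fun i hi => S.ordGE_high_lattice hHb hi (nweight_le_sub_Z v (hpos i)))
    obtain ⟨wX, wY, wZ⟩ := nweight_le_sub_ray (n := n) v
    have s1 := (S.ordGE_sub_starOp hFb _ v wX).unit_mul S.norm_n.le
    have s2 := (S.ordGE_sub_starOp hFb _ v wZ).unit_mul S.norm_tau.le
    have s3 := S.ordGE_sub_starOp hGb _ v wY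
    have s4 := (S.ordGE_sub_starOp hGb _ v wZ).unit_mul S.norm_tau.le
    have hle := latticeExp_add_le S.two_lt S.n_pos (nweight n v)
    have l1 := ((hΞb v).mono S.gen_pos S.gen_lt
      (l := latticeExp p n (nweight n v) + 1) (by linarith)).unit_mul (norm_intCast_le_one' v.1)
    have l2 := ((hHb v).mono S.gen_pos S.gen_lt
      (l := latticeExp p n (nweight n v) + 1) (by linarith)).unit_mul (norm_intCast_le_one' v.2)
    have total := ((((hX.add hY).add (s1.sub s2)).add (s3.sub s4)).add (l1.add l2)).neg
    convert total using 1
    have g1 := hgn (F (v - ((n : ℤ), 0)))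
    have g2 := hgn (F (v - (-1, -1)))
    have g3 := hgn (G (v - (0, 1)))
    have g4 := hgn (G (v - (-1, -1)))
    simp only [hΞ, hH] at *
    linear_combination e1 - (n : K) * g1 + τ * g2 - g3 + τ * g4
  refine ⟨r, Ξ, H, fun v => g ^ (-1 : ℤ) * (c v -
      ((∑ j ∈ Finset.range (2 * n + 1), (Pi.single (epsExp n j) (r j) : ℤ × ℤ → K)) v +
        dworkOp p n g τ σ Prod.fst n ((n : ℤ), 0) Ξ v +
        dworkOp p n g τ σ Prod.snd 1 (0, 1) H v)), fun d => (hb d).1, hΞb, hHb, ?_, ?_, ?_⟩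
  · intro u
    have := (herr u).zpow_mul S.gen_pos (-1)
    rwa [neg_add_cancel_comm_assoc] at this
  · funext v
    simp only [Pi.add_apply, Pi.smul_apply, smul_eq_mul, zpow_neg_one]
    rw [mul_inv_cancel_left₀ hg0]
    ring
  · intro j hj h
    exact h4 j (by exact_mod_cast hj) _ (by positivity) h

omit [CompleteSpace K] in
theorem ordGE_geomSum (S : FrobeniusData p n g τ σ) {x : ℕ → K} {k : ℤ}
    (hx : ∀ i, OrdGE g k (x i)) (a : ℕ) : OrdGE g k (∑' i, g ^ i * x (a + i)) := by
  refine OrdGE.tsum fun i => (hx _).unit_mul ?_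
  rw [norm_pow]
  exact pow_le_one₀ S.gen_pos.le S.gen_lt.le

omit [IsUltrametricDist K] in
theorem geomSum_eq (S : FrobeniusData p n g τ σ) {x : ℕ → K} (hx : ∀ i, ‖x i‖ ≤ 1) (a : ℕ) :
    ∑' i, g ^ i * x (a + i) = x a + g * ∑' i, g ^ i * x (a + 1 + i) := by
  have hs : Summable fun i => g ^ i * x (a + i) :=
    summable_mul_of_norm_le_pow S.gen_pos.le S.gen_lt (fun i => by rw [norm_pow]) fun i => hx _
  rw [hs.tsum_eq_zero_add, ← tsum_mul_left]
  simp only [pow_zero, one_mul, add_zero]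
  congr 1
  refine tsum_congr fun i => ?_
  rw [pow_succ', mul_assoc, add_assoc a 1 i, add_comm 1 i]

/-- Every element of the lattice is a combination of the basis in the cohomology, and its
coefficients are known modulo `g`. -/
theorem exists_reduction (S : FrobeniusData p n g τ σ) {c : ℤ × ℤ → K}
    (hc : ∀ u, OrdGE g (latticeExp p n (nweight n u)) (c u)) :
    ∃ (r : ℕ → K) (ξ η : ℤ × ℤ → K),
      (∀ d : ℕ, OrdGE g (latticeExp p n d) (r d)) ∧
      (∀ v, OrdGE g (latticeExp p n (nweight n v + n) - n) (ξ v)) ∧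
      (∀ v, OrdGE g (latticeExp p n (nweight n v + n) - n) (η v)) ∧
      (c = ∑ j ∈ Finset.range (2 * n + 1), Pi.single (epsExp n j) (r j) +
        dworkOp p n g τ σ Prod.fst n ((n : ℤ), 0) ξ + dworkOp p n g τ σ Prod.snd 1 (0, 1) η) ∧
      ∀ j : ℕ, j ≤ 2 * n →
        (∀ u, nweight n u = j → u ≠ epsExp n j → OrdGE g (latticeExp p n j + 1) (c u)) →
        OrdGE g (latticeExp p n j + 1) (r j - c (epsExp n j)) := by
  let L := {c : ℤ × ℤ → K // ∀ u, OrdGE g (latticeExp p n (nweight n u)) (c u)}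
  have hstep := fun c : L => S.exists_reduction_step c.2
  choose r ξ η c' hr hξ hη hc' hdec hlead using hstep
  -- `cs k` is the remainder after k reduction steps. The sums below carry a starting index a so
  -- that the remaining defect can be followed from one step to the next.
  let cs : ℕ → L := fun k => Nat.rec (motive := fun _ => L) ⟨c, hc⟩ (fun _ d => ⟨c' d, hc' d⟩) k
  have hexp : ∀ d : ℕ, 0 ≤ latticeExp p n d := fun d => by
    have := latticeExp_mono (n := n) S.two_lt (show (0 : ℤ) ≤ d by positivity)
    have h0 : latticeExp p n 0 = 0 := by simp [latticeExp]
    omega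
  have hr1 : ∀ (d : L) j, ‖r d j‖ ≤ 1 := fun d j => by
    rw [← ordGE_zero_iff (g := g)]
    exact (hr d j).mono S.gen_pos S.gen_lt (hexp j)
  have hξ1 := fun d => S.norm_le_one_of_lattice (hξ d)
  have hη1 := fun d => S.norm_le_one_of_lattice (hη d)
  let R : ℕ → ℕ → K := fun a j => ∑' i, g ^ i * r (cs (a + i)) j
  let X : ℕ → ℤ × ℤ → K := fun a v => ∑' i, g ^ i * ξ (cs (a + i)) v
  let Y : ℕ → ℤ × ℤ → K := fun a v => ∑' i, g ^ i * η (cs (a + i)) v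
  have hR : ∀ a (j : ℕ), OrdGE g (latticeExp p n j) (R a j) := fun a j =>
    S.ordGE_geomSum (x := fun i => r (cs i) j) (fun i => hr _ j) a
  have hX : ∀ a v, OrdGE g (latticeExp p n (nweight n v + n) - n) (X a v) := fun a v =>
    S.ordGE_geomSum (x := fun i => ξ (cs i) v) (fun i => hξ _ v) a
  have hY : ∀ a v, OrdGE g (latticeExp p n (nweight n v + n) - n) (Y a v) := fun a v =>
    S.ordGE_geomSum (x := fun i => η (cs i) v) (fun i => hη _ v) a
  have hRs : ∀ a j, R a j = r (cs a) j + g * R (a + 1) j := fun a j =>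
    S.geomSum_eq (x := fun i => r (cs i) j) (fun i => hr1 _ j) a
  have hXs : ∀ a, X a = ξ (cs a) + g • X (a + 1) := fun a => funext fun v =>
    S.geomSum_eq (x := fun i => ξ (cs i) v) (fun i => hξ1 _ v) a
  have hYs : ∀ a, Y a = η (cs a) + g • Y (a + 1) := fun a => funext fun v =>
    S.geomSum_eq (x := fun i => η (cs i) v) (fun i => hη1 _ v) a
  have hX1 := fun a => S.norm_le_one_of_lattice (hX a)
  have hY1 := fun a => S.norm_le_one_of_lattice (hY a)
  have hgle : ∀ {f : ℤ × ℤ → K}, (∀ v, ‖f v‖ ≤ 1) → ∀ v, ‖(g • f) v‖ ≤ 1 := fun hf v => by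
    rw [Pi.smul_apply, smul_eq_mul, norm_mul]
    exact mul_le_one₀ S.gen_lt.le (norm_nonneg _) (hf v)
  let E : ℕ → ℤ × ℤ → K := fun a => (cs a).1 -
    (∑ j ∈ Finset.range (2 * n + 1), Pi.single (epsExp n j) (R a j) +
      dworkOp p n g τ σ Prod.fst n ((n : ℤ), 0) (X a) +
      dworkOp p n g τ σ Prod.snd 1 (0, 1) (Y a))
  -- The defect loses a factor g at each stage and stays bounded, so the initial defect is divisible
  -- by every power of g.
  have hEs : ∀ a, E a = g • E (a + 1) := by
    intro a
    have e1 : dworkOp p n g τ σ Prod.fst n ((n : ℤ), 0) (X a)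
        = dworkOp p n g τ σ Prod.fst n ((n : ℤ), 0) (ξ (cs a))
          + g • dworkOp p n g τ σ Prod.fst n ((n : ℤ), 0) (X (a + 1)) := by
      rw [hXs a, S.dworkOp_add _ _ _ (hξ1 _) (hgle (hX1 (a + 1))), dworkOp_smul]
    have e2 : dworkOp p n g τ σ Prod.snd 1 (0, 1) (Y a)
        = dworkOp p n g τ σ Prod.snd 1 (0, 1) (η (cs a))
          + g • dworkOp p n g τ σ Prod.snd 1 (0, 1) (Y (a + 1)) := by
      rw [hYs a, S.dworkOp_add _ _ _ (hη1 _) (hgle (hY1 (a + 1))), dworkOp_smul]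
    have e3 : (∑ j ∈ Finset.range (2 * n + 1), (Pi.single (epsExp n j) (R a j) : ℤ × ℤ → K))
        = ∑ j ∈ Finset.range (2 * n + 1), Pi.single (epsExp n j) (r (cs a) j)
          + g • ∑ j ∈ Finset.range (2 * n + 1), Pi.single (epsExp n j) (R (a + 1) j) := by
      rw [Finset.smul_sum, ← Finset.sum_add_distrib]
      refine Finset.sum_congr rfl fun j _ => ?_
      rw [hRs a j, Pi.single_add, ← smul_eq_mul, Pi.single_smul]
    have e4 := hdec (cs a)
    have e5 : (cs (a + 1)).1 = c' (cs a) := rfl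
    simp only [E]
    rw [e1, e2, e3, e5]
    nth_rw 1 [e4]
    simp only [smul_sub, smul_add]
    abel
  have hDle : ∀ (ℓ : ℤ × ℤ → ℤ) {m : K} (V : ℤ × ℤ) {f : ℤ × ℤ → K}, ‖m‖ ≤ 1 →
      (∀ v, ‖f v‖ ≤ 1) → ∀ v, ‖dworkOp p n g τ σ ℓ m V f v‖ ≤ 1 := by
    intro ℓ m V f hm hf v
    refine (IsUltrametricDist.norm_add_le_max _ _).trans (max_le ?_ ?_)
    · rw [norm_mul]; exact mul_le_one₀ (norm_intCast_le_one' _) (norm_nonneg _) (hf v)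
    · refine IsUltrametricDist.norm_tsum_le_of_forall_le_of_nonneg zero_le_one fun i => ?_
      rw [norm_mul]
      refine mul_le_one₀ ((S.norm_kappa_le i).trans (pow_le_one₀ S.gen_pos.le S.gen_lt.le))
        (norm_nonneg _) ((norm_sub_le_max_norm _ _).trans (max_le ?_ ?_))
      · rw [norm_mul]; exact mul_le_one₀ hm (norm_nonneg _) (hf _)
      · rw [norm_mul, S.norm_sigma_iterate, one_mul]; exact hf _
  have hE1 : ∀ a v, ‖E a v‖ ≤ 1 := by
    intro a v
    have b1 : ‖(cs a).1 v‖ ≤ 1 := by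
      rw [← ordGE_zero_iff (g := g)]
      refine ((cs a).2 v).mono S.gen_pos S.gen_lt ?_
      have := hexp (nweight n v).toNat
      rwa [Int.toNat_of_nonneg (nweight_nonneg v)] at this
    have b2 : ‖(∑ j ∈ Finset.range (2 * n + 1),
        (Pi.single (epsExp n j) (R a j) : ℤ × ℤ → K)) v‖ ≤ 1 := by
      rw [Finset.sum_apply]
      refine IsUltrametricDist.norm_sum_le_of_forall_le_of_nonneg zero_le_one fun j _ => ?_
      rw [Pi.single_apply]
      split_ifs
      · rw [← ordGE_zero_iff (g := g)]
        exact (hR a j).mono S.gen_pos S.gen_lt (hexp j)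
      · simp
    refine (norm_sub_le_max_norm _ _).trans (max_le b1 ?_)
    refine (IsUltrametricDist.norm_add_le_max _ _).trans (max_le ?_ (hDle _ _ (by simp) (hY1 a) v))
    exact (IsUltrametricDist.norm_add_le_max _ _).trans
      (max_le b2 (hDle _ _ S.norm_n.le (hX1 a) v))
  have hE0 : ∀ a, E 0 = g ^ a • E a := by
    intro a
    induction a with
    | zero => simp
    | succ a ih => rw [ih, hEs a, smul_smul, pow_succ]
  have hEz : E 0 = 0 := by
    funext v
    have hle : ∀ a : ℕ, ‖E 0 v‖ ≤ ‖g‖ ^ a := fun a => by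
      rw [hE0 a, Pi.smul_apply, smul_eq_mul, norm_mul, norm_pow]
      exact mul_le_of_le_one_right (by positivity) (hE1 a v)
    have hlim := tendsto_pow_atTop_nhds_zero_of_lt_one S.gen_pos.le S.gen_lt
    have : ‖E 0 v‖ ≤ 0 := ge_of_tendsto' hlim hle
    simpa using this
  refine ⟨R 0, X 0, Y 0, hR 0, hX 0, hY 0, ?_, ?_⟩
  · exact sub_eq_zero.mp hEz
  · intro j hj h
    have h1 := hlead ⟨c, hc⟩ j hj h
    have h2 : OrdGE g (latticeExp p n j + 1) (g * R 1 j) := by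
      have := (hR 1 j).zpow_mul S.gen_pos 1
      rwa [zpow_one, add_comm] at this
    have h3 : R 0 j - c (epsExp n j) = (r ⟨c, hc⟩ j - c (epsExp n j)) + g * R 1 j := by
      have e0 : cs 0 = ⟨c, hc⟩ := rfl
      rw [hRs 0 j, e0]; ring
    rw [h3]
    exact h1.add h2

end FrobeniusData

end Reduction

/-! ### Exactness of the Koszul complex of the leading forms -/

section Koszul

variable {R : Type*} [CommRing R] {n : ℕ}

theorem starOp_X (hn : 0 < n) (a : ℤ × ℤ → R) (x y : ℤ) :
    starOp n ((n : ℤ), 0) a (x, y) = if n ≤ x ∨ y ≤ x - n then a (x - n, y) else 0 := by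
  have h := nweight_add_X hn (x - n) y
  rw [sub_add_cancel, sub_nonneg] at h
  rw [starOp, Prod.mk_sub_mk, sub_zero]
  exact if_congr (eq_comm.trans h) rfl rfl

theorem starOp_Y (a : ℤ × ℤ → R) (x y : ℤ) :
    starOp n (0, 1) a (x, y) = if 1 ≤ y ∨ x ≤ y - 1 then a (x, y - 1) else 0 := by
  have h := nweight_add_Y (n := n) x (y - 1)
  rw [sub_add_cancel, sub_nonneg] at h
  rw [starOp, Prod.mk_sub_mk, sub_zero]
  exact if_congr (eq_comm.trans h) rfl rfl

theorem starOp_Z (a : ℤ × ℤ → R) (x y : ℤ) :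
    starOp n (-1, -1) a (x, y) = if x ≤ -1 ∨ y ≤ -1 then a (x + 1, y + 1) else 0 := by
  have h := nweight_add_Z (n := n) (x + 1) (y + 1)
  rw [add_neg_cancel_right, add_neg_cancel_right] at h
  rw [starOp, Prod.mk_sub_mk, sub_neg_eq_add, sub_neg_eq_add]
  refine if_congr (eq_comm.trans h) rfl rfl |>.trans (if_congr ?_ rfl rfl)
  omega

/-- The relations between the coefficients of a pair in the kernel of the leading form. -/
structure IsSyzygy (n : ℕ) (m t : R) (a b : ℤ × ℤ → R) : Prop where
  first : ∀ x y : ℤ, 0 ≤ x → 0 ≤ y → m * a (x, y + 1) + b (x + n, y) = 0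
  first_b : ∀ x y : ℤ, 0 ≤ x → x < n → 0 ≤ y → b (x, y) = 0
  first_a : ∀ x : ℤ, 0 ≤ x → a (x, 0) = 0
  right : ∀ x y : ℤ, y ≤ 0 → y + n ≤ x → m * a (x - 1 - n, y - 1) = t * (a (x, y) + b (x, y))
  right_small : ∀ x y : ℤ, y ≤ 0 → y ≤ x → x < y + n → a (x, y) + b (x, y) = 0
  left : ∀ x y : ℤ, x ≤ 0 → x < y → b (x - 1, y - 2) = t * (a (x, y) + b (x, y))

/-- The exempted positions are the ε_i of weight at least n. The relations missing there follow from
the remaining ones, which is the graded form of the independence of the ε_i. -/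
theorem isSyzygy_of_gradedOp (hn : 0 < n) {m t m' t' : R} (hm : m * m' = 1) (ht : t * t' = 1)
    {a b : ℤ × ℤ → R}
    (h : ∀ x y : ℤ, ¬ (x = n ∧ y = 0) → ¬ (1 ≤ x ∧ x ≤ n ∧ y = 1) →
      gradedOp n m t a b (x, y) = 0) : IsSyzygy n m t a b := by
  have hn' : (1 : ℤ) ≤ n := by exact_mod_cast hn
  simp only [gradedOp, starOp_X hn, starOp_Y, starOp_Z] at h
  have hfst : ∀ x y : ℤ, 0 ≤ x → 0 ≤ y → ¬ (x = 0 ∧ y = 0) → m * a (x, y + 1) + b (x + n, y) = 0 := by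
    intro x y hx hy hxy
    have := h (x + n) (y + 1) (by omega) (by omega)
    rw [if_pos (by omega), if_pos (by omega), if_neg (by omega), if_neg (by omega)] at this
    simpa using this
  have hfb : ∀ x y : ℤ, 0 ≤ x → x < n → 0 ≤ y → (y = 0 → x = 0) → b (x, y) = 0 := by
    intro x y hx hx' hy hxy
    have := h x (y + 1) (by omega) (by omega)
    rw [if_neg (by omega), if_pos (by omega), if_neg (by omega), if_neg (by omega)] at this
    simpa using this
  have hfa : ∀ x : ℤ, 0 < x → a (x, 0) = 0 := by
    intro x hx
    have := h (x + n) 0 (by omega) (by omega)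
    rw [if_pos (by omega), if_neg (by omega), if_neg (by omega), if_neg (by omega)] at this
    have h2 : m * a (x, 0) = 0 := by simpa using this
    linear_combination m' * h2 - a (x, 0) * hm
  have hr : ∀ x y : ℤ, y ≤ 0 → y + n ≤ x →
      m * a (x - 1 - n, y - 1) = t * (a (x, y) + b (x, y)) := by
    intro x y hy hxy
    have := h (x - 1) (y - 1) (by omega) (by omega)
    rw [if_pos (by omega), if_neg (by omega), if_pos (by omega), if_pos (by omega)] at this
    simp only [sub_add_cancel] at this
    linear_combination this
  have hrs : ∀ x y : ℤ, y ≤ 0 → y ≤ x → x < y + n → a (x, y) + b (x, y) = 0 := by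
    intro x y hy hxy hxy'
    have := h (x - 1) (y - 1) (by omega) (by omega)
    rw [if_neg (by omega), if_neg (by omega), if_pos (by omega), if_pos (by omega)] at this
    simp only [sub_add_cancel] at this
    linear_combination -t' * this - (a (x, y) + b (x, y)) * ht
  have hl : ∀ x y : ℤ, x ≤ 0 → x < y → b (x - 1, y - 2) = t * (a (x, y) + b (x, y)) := by
    intro x y hx hxy
    have := h (x - 1) (y - 1) (by omega) (by omega)
    rw [if_neg (by omega), if_pos (by omega), if_pos (by omega), if_pos (by omega)] at this
    simp only [sub_add_cancel] at this
    rw [show y - 1 - 1 = y - 2 by ring] at this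
    linear_combination this
  -- The case x = 0 would come from the exempted position (n, 0); it is recovered through b(0, 0) =
  -- 0 and the relation on the lower side.
  have hfa' : ∀ x : ℤ, 0 ≤ x → a (x, 0) = 0 := by
    intro x hx
    rcases hx.lt_or_eq with hx | rfl
    · exact hfa x hx
    · have h1 := hrs 0 0 le_rfl le_rfl (by omega)
      rw [hfb 0 0 le_rfl (by omega) le_rfl (fun _ => rfl), add_zero] at h1
      exact h1
  have hfb' : ∀ x y : ℤ, 0 ≤ x → x < n → 0 ≤ y → b (x, y) = 0 := by
    intro x y hx hx' hy
    by_cases hy0 : y = 0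
    · subst hy0
      have h1 := hrs x 0 le_rfl hx (by omega)
      rwa [hfa' x hx, zero_add] at h1
    · exact hfb x y hx hx' hy (fun h => absurd h hy0)
  refine ⟨fun x y hx hy => ?_, hfb', hfa', hr, hrs, hl⟩
  by_cases hxy : x = 0 ∧ y = 0
  · obtain ⟨rfl, rfl⟩ := hxy
    have h1 := hr n 0 le_rfl (by omega)
    have h2 := hl 0 1 le_rfl (by omega)
    have h3 := hrs (-1) (-1) (by omega) le_rfl (by omega)
    rw [hfa' n (by omega), show (n : ℤ) - 1 - n = -1 by ring] at h1
    rw [hfb' 0 1 le_rfl (by omega) (by omega)] at h2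
    norm_num at h1 h2 ⊢
    linear_combination t' * (m * h3 - h1 - m * h2) - (m * a (0, 1) + b (n, 0)) * ht
  · exact hfst x y hx hy hxy

/-- A potential for a syzygy. -/
def syzygyPotential (t' : R) (a b : ℤ × ℤ → R) (u : ℤ × ℤ) : R :=
  if u.2 ≤ 0 ∧ u.2 ≤ u.1 then -t' * a (u.1 - 1, u.2 - 1)
  else if 0 ≤ u.1 ∧ 0 < u.2 then a (u.1, u.2 + 1) else t' * b (u.1 - 1, u.2 - 1)

/-- Wanted is c with a = (Y - tZ)c and b = -(mX - tZ)c. Inside a cone the opposite ray acts as 0, so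
one of the equations reads off c directly: a = -tZc below, a = Yc in the first cone, b = tZc on the
left. The syzygy relations give the other equation and agreement along the walls. -/
theorem IsSyzygy.eq_potential (hn : 0 < n) {m t m' t' : R} (hm : m * m' = 1) (ht : t * t' = 1)
    {a b : ℤ × ℤ → R} (H : IsSyzygy n m t a b) (v : ℤ × ℤ) :
    a v = starOp n (0, 1) (syzygyPotential t' a b) v
        - t * starOp n (-1, -1) (syzygyPotential t' a b) v ∧
      b v = -(m * starOp n ((n : ℤ), 0) (syzygyPotential t' a b) v
        - t * starOp n (-1, -1) (syzygyPotential t' a b) v) := by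
  obtain ⟨x, y⟩ := v
  have hn' : (1 : ℤ) ≤ n := by exact_mod_cast hn
  simp only [starOp_X hn, starOp_Y, starOp_Z]
  by_cases h1 : y ≤ -1 ∧ y ≤ x
  · rw [if_neg (by omega : ¬ (1 ≤ y ∨ x ≤ y - 1)), if_pos (by omega : x ≤ -1 ∨ y ≤ -1)]
    have e1 : t * syzygyPotential t' a b (x + 1, y + 1) = - a (x, y) := by
      rw [syzygyPotential, if_pos (by simp only; omega)]
      simp only [add_sub_cancel_right]
      linear_combination -a (x, y) * ht
    refine ⟨by linear_combination e1, ?_⟩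
    by_cases h2 : y + n ≤ x
    · rw [if_pos (by omega), syzygyPotential, if_pos (by simp only; omega)]
      have := H.right x y (by omega) (by omega)
      simp only
      rw [show x - n - 1 = x - 1 - n by ring]
      linear_combination -t' * this - e1 - (a (x, y) + b (x, y)) * ht
    · rw [if_neg (by omega)]
      have := H.right_small x y (by omega) (by omega) (by omega)
      linear_combination this - e1
  by_cases h2 : x ≤ -1
  · rw [if_neg (by omega : ¬ (n ≤ x ∨ y ≤ x - n)), if_pos (by omega : 1 ≤ y ∨ x ≤ y - 1),
      if_pos (by omega : x ≤ -1 ∨ y ≤ -1)]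
    have e1 : t * syzygyPotential t' a b (x + 1, y + 1) = b (x, y) := by
      rw [syzygyPotential, if_neg (by simp only; omega)]
      by_cases h3 : 0 ≤ x + 1 ∧ 0 < y + 1
      · obtain rfl : x = -1 := by omega
        rw [if_pos (by simpa using h3)]
        have h4 := H.left 0 (y + 2) le_rfl (by omega)
        rw [H.first_b 0 (y + 2) le_rfl (by omega) (by omega)] at h4
        simp only [add_sub_cancel_right, zero_sub, add_zero] at h4
        rw [h4]
        norm_num [add_assoc]
      · rw [if_neg (by simpa using h3)]
        simp only [add_sub_cancel_right]
        linear_combination b (x, y) * ht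
    have e2 : syzygyPotential t' a b (x, y - 1) = t' * b (x - 1, y - 2) := by
      rw [syzygyPotential]
      by_cases h3 : y - 1 ≤ 0 ∧ y - 1 ≤ x
      · rw [if_pos (by simpa using h3)]
        have h4 := H.right_small (x - 1) (y - 2) (by omega) (by omega) (by omega)
        simp only
        rw [show y - 1 - 1 = y - 2 by ring]
        linear_combination -t' * h4
      · rw [if_neg (by simpa using h3), if_neg (by simp only; omega)]
        simp only
        rw [show y - 1 - 1 = y - 2 by ring]
    have h5 := H.left x y (by omega) (by omega)
    refine ⟨?_, by linear_combination -e1⟩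
    rw [e2]
    linear_combination e1 - t' * h5 - (a (x, y) + b (x, y)) * ht
  rw [if_neg (by omega : ¬ (x ≤ -1 ∨ y ≤ -1))]
  -- Agreement across the horizontal axis of the two formulas for the potential.
  have key : ∀ z : ℤ, 0 ≤ z → -t' * a (z - 1, -1) = a (z, 1) := by
    intro z hz
    have h3 := H.right (z + n) 0 le_rfl (by omega)
    rw [H.first_a _ (by omega)] at h3
    have h4 := H.first z 0 hz le_rfl
    rw [show z + n - 1 - n = z - 1 by ring] at h3
    norm_num at h3 h4
    linear_combination -t' * m' * h3 - t' * m' * t * h4 + (t' * a (z - 1, -1) + t * t' * a (z, 1)) * hm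
      + a (z, 1) * ht
  constructor
  · by_cases h3 : 1 ≤ y
    · rw [if_pos (by omega), syzygyPotential]
      by_cases h4 : y = 1
      · subst h4
        rw [if_pos (by simp only; omega)]
        have := key x (by omega)
        norm_num at this ⊢
        exact this.symm
      · rw [if_neg (by simp only; omega), if_pos (by simp only; omega)]
        simp
    · obtain rfl : y = 0 := by omega
      rw [if_neg (by omega), H.first_a x (by omega)]
      ring
  · by_cases h3 : n ≤ x
    · rw [if_pos (by omega), syzygyPotential]
      have h4 := H.first (x - n) y (by omega) (by omega)
      rw [sub_add_cancel] at h4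
      by_cases h5 : y = 0
      · subst h5
        rw [if_pos (by simp only; omega)]
        have := key (x - n) (by omega)
        simp only [zero_sub, zero_add] at this h4 ⊢
        rw [this]
        linear_combination h4
      · rw [if_neg (by simp only; omega), if_pos (by simp only; omega)]
        simp only
        linear_combination h4
    · rw [if_neg (by omega), H.first_b x y (by omega) (by omega) (by omega)]
      ring

end Koszul

/-! ### Reduction modulo `g` -/

section Residue

variable {K : Type*} [NormedField K] [IsUltrametricDist K]

/-- The ring of elements of norm at most one. -/
def unitBall (K : Type*) [NormedField K] [IsUltrametricDist K] : Subring K where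
  carrier := {x | ‖x‖ ≤ 1}
  one_mem' := by simp
  zero_mem' := by simp
  mul_mem' := fun {x y} hx hy => by
    simp only [Set.mem_ofPred_eq, norm_mul] at *
    exact mul_le_one₀ hx (norm_nonneg _) hy
  add_mem' := fun {x y} hx hy => (IsUltrametricDist.norm_add_le_max x y).trans (max_le hx hy)
  neg_mem' := fun {x} hx => by simpa using hx

/-- The ideal of the multiples of `g`. -/
def multiplesIdeal (g : K) : Ideal (unitBall K) where
  carrier := {x | ‖(x : K)‖ ≤ ‖g‖}
  zero_mem' := by simp
  add_mem' := fun {x y} hx hy => (IsUltrametricDist.norm_add_le_max _ _).trans (max_le hx hy)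
  smul_mem' := fun c x hx => by
    simp only [Set.mem_ofPred_eq, smul_eq_mul, Subring.coe_mul, norm_mul] at *
    exact (mul_le_of_le_one_left (norm_nonneg _) c.2).trans hx

open Classical in
/-- Reduction modulo `g` of the elements of norm at most one. -/
def residue (g x : K) : unitBall K ⧸ multiplesIdeal g :=
  if h : ‖x‖ ≤ 1 then Ideal.Quotient.mk _ ⟨x, h⟩ else 0

variable {g : K}

theorem residue_of_le {x : K} (h : ‖x‖ ≤ 1) :
    residue g x = Ideal.Quotient.mk _ (⟨x, h⟩ : unitBall K) := dif_pos h

theorem residue_add {x y : K} (hx : ‖x‖ ≤ 1) (hy : ‖y‖ ≤ 1) :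
    residue g (x + y) = residue g x + residue g y := by
  rw [residue_of_le hx, residue_of_le hy, ← map_add,
    residue_of_le ((IsUltrametricDist.norm_add_le_max x y).trans (max_le hx hy))]
  rfl

theorem residue_sub {x y : K} (hx : ‖x‖ ≤ 1) (hy : ‖y‖ ≤ 1) :
    residue g (x - y) = residue g x - residue g y := by
  rw [residue_of_le hx, residue_of_le hy, ← map_sub,
    residue_of_le ((norm_sub_le_max_norm x y).trans (max_le hx hy))]
  rfl

theorem residue_mul {x y : K} (hx : ‖x‖ ≤ 1) (hy : ‖y‖ ≤ 1) :
    residue g (x * y) = residue g x * residue g y := by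
  have h : ‖x * y‖ ≤ 1 := by rw [norm_mul]; exact mul_le_one₀ hx (norm_nonneg _) hy
  rw [residue_of_le hx, residue_of_le hy, ← map_mul, residue_of_le h]
  rfl

theorem residue_one : residue g 1 = 1 := by
  rw [residue_of_le (by simp)]
  exact map_one _

theorem residue_eq_zero_iff {x : K} (hx : ‖x‖ ≤ 1) : residue g x = 0 ↔ ‖x‖ ≤ ‖g‖ := by
  rw [residue_of_le hx, Ideal.Quotient.eq_zero_iff_mem]
  rfl

theorem residue_eq_zero (hg : ‖g‖ ≤ 1) {x : K} (hx : ‖x‖ ≤ ‖g‖) : residue g x = 0 :=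
  (residue_eq_zero_iff (hx.trans hg)).mpr hx

theorem exists_residue_eq (y : unitBall K ⧸ multiplesIdeal g) : ∃ x : K, ‖x‖ ≤ 1 ∧ residue g x = y := by
  obtain ⟨x, rfl⟩ := Ideal.Quotient.mk_surjective y
  exact ⟨x, x.2, residue_of_le x.2⟩

theorem residue_mul_inv {x : K} (hx : ‖x‖ = 1) : residue g x * residue g x⁻¹ = 1 := by
  have hx0 : x ≠ 0 := norm_pos_iff.mp (by rw [hx]; exact one_pos)
  rw [← residue_mul hx.le (by rw [norm_inv, hx, inv_one]), mul_inv_cancel₀ hx0, residue_one]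

/-- The leading coefficients of a series. -/
def leadCoeff (n : ℕ) (g : K) (c : ℤ × ℤ → K) (u : ℤ × ℤ) : unitBall K ⧸ multiplesIdeal g :=
  residue g (c u * g ^ (-nweight n u))

/-- The elements of `C₀`, in terms of the norms of the coefficients. -/
structure IsC0 (n : ℕ) (g : K) (c : ℤ × ℤ → K) : Prop where
  ordGE : ∀ u, OrdGE g (nweight n u) (c u)
  decay : ∀ k : ℕ, ∃ N : ℤ, ∀ u, N ≤ nweight n u → OrdGE g (nweight n u + k) (c u)

variable {p n : ℕ} {τ : K} {σ : K ≃+* K}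

omit [IsUltrametricDist K] in
theorem norm_mul_zpow_le_iff (hg : 0 < ‖g‖) {x : K} {w k : ℤ} :
    ‖x * g ^ (-w)‖ ≤ ‖g‖ ^ k ↔ OrdGE g (w + k) x := by
  rw [OrdGE, norm_mul, norm_zpow, zpow_neg, ← div_eq_mul_inv, div_le_iff₀ (by positivity),
    add_comm, zpow_add₀ hg.ne']

omit [IsUltrametricDist K] in
theorem norm_mul_zpow_le_one (hg : 0 < ‖g‖) {x : K} {w : ℤ} (h : OrdGE g w x) :
    ‖x * g ^ (-w)‖ ≤ 1 := by
  have := (norm_mul_zpow_le_iff hg (x := x) (w := w) (k := 0)).mpr (by rwa [add_zero])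
  rwa [zpow_zero] at this

theorem residue_mul_zpow_eq_zero_iff (hg : 0 < ‖g‖) {x : K} {w : ℤ}
    (h : OrdGE g w x) : residue g (x * g ^ (-w)) = 0 ↔ OrdGE g (w + 1) x := by
  rw [residue_eq_zero_iff (norm_mul_zpow_le_one hg h), ← norm_mul_zpow_le_iff hg, zpow_one]

theorem IsC0.sub {c d : ℤ × ℤ → K} (hc : IsC0 n g c)
    (hd : IsC0 n g d) : IsC0 n g (c - d) := by
  refine ⟨fun u => (hc.ordGE u).sub (hd.ordGE u), fun k => ?_⟩
  obtain ⟨N, hN⟩ := hc.decay k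
  obtain ⟨N', hN'⟩ := hd.decay k
  exact ⟨max N N', fun u hu => (hN u ((le_max_left _ _).trans hu)).sub
    (hN' u ((le_max_right _ _).trans hu))⟩

theorem IsC0.add {c d : ℤ × ℤ → K} (hc : IsC0 n g c)
    (hd : IsC0 n g d) : IsC0 n g (c + d) := by
  refine ⟨fun u => (hc.ordGE u).add (hd.ordGE u), fun k => ?_⟩
  obtain ⟨N, hN⟩ := hc.decay k
  obtain ⟨N', hN'⟩ := hd.decay k
  exact ⟨max N N', fun u hu => (hN u ((le_max_left _ _).trans hu)).add
    (hN' u ((le_max_right _ _).trans hu))⟩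

theorem IsC0.smul_inv {c : ℤ × ℤ → K} (hg : 0 < ‖g‖) (hc : IsC0 n g c)
    (h : leadCoeff n g c = 0) : IsC0 n g (g⁻¹ • c) := by
  have key : ∀ {k : ℤ} {x : K}, OrdGE g (k + 1) x → OrdGE g k (g⁻¹ * x) := fun {k x} hx => by
    have := hx.zpow_mul hg (-1)
    rwa [zpow_neg_one, add_comm k, neg_add_cancel_left] at this
  refine ⟨fun u => key ((residue_mul_zpow_eq_zero_iff hg (hc.ordGE u)).mp (congrFun h u)),
    fun k => ?_⟩
  obtain ⟨N, hN⟩ := hc.decay (k + 1)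
  refine ⟨N, fun u hu => key ?_⟩
  have := hN u hu
  push_cast at this
  rwa [← add_assoc] at this

omit [IsUltrametricDist K] in
theorem IsC0.norm_le_one {c : ℤ × ℤ → K} (hg1 : ‖g‖ < 1) (hg : 0 < ‖g‖) (hc : IsC0 n g c)
    (u : ℤ × ℤ) : ‖c u‖ ≤ 1 :=
  ordGE_zero_iff.mp ((hc.ordGE u).mono hg hg1 (nweight_nonneg u))

theorem leadCoeff_sub {c d : ℤ × ℤ → K} (hg : 0 < ‖g‖) (hc : IsC0 n g c) (hd : IsC0 n g d)
    (u : ℤ × ℤ) : leadCoeff n g (c - d) u = leadCoeff n g c u - leadCoeff n g d u := by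
  rw [leadCoeff, Pi.sub_apply, sub_mul, residue_sub (norm_mul_zpow_le_one hg (hc.ordGE u))
    (norm_mul_zpow_le_one hg (hd.ordGE u))]
  rfl

theorem leadCoeff_add {c d : ℤ × ℤ → K} (hg : 0 < ‖g‖) (hc : IsC0 n g c) (hd : IsC0 n g d)
    (u : ℤ × ℤ) : leadCoeff n g (c + d) u = leadCoeff n g c u + leadCoeff n g d u := by
  rw [leadCoeff, Pi.add_apply, add_mul, residue_add (norm_mul_zpow_le_one hg (hc.ordGE u))
    (norm_mul_zpow_le_one hg (hd.ordGE u))]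
  rfl

/-- If the weight rises by less than n, the factor g ^ n leaves a positive power of g unused and the
product vanishes in the residue ring, exactly as in the graded ring. -/
theorem leadCoeff_shift (hg : 0 < ‖g‖) (hg1 : ‖g‖ < 1) {c : ℤ × ℤ → K} (hc : IsC0 n g c)
    {V u : ℤ × ℤ} (hV : nweight n u ≤ nweight n (u - V) + n) :
    residue g (g ^ (n : ℤ) * c (u - V) * g ^ (-nweight n u)) = starOp n V (leadCoeff n g c) u := by
  have hg0 : g ≠ 0 := norm_pos_iff.mp hg
  have h1 := (hc.ordGE (u - V)).zpow_mul hg n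
  rw [starOp]
  split_ifs with h
  · rw [leadCoeff, ← h]
    congr 1
    rw [neg_add, zpow_add₀ hg0]
    have : g ^ (n : ℤ) * g ^ (-(n : ℤ)) = 1 := by rw [← zpow_add₀ hg0]; simp
    linear_combination c (u - V) * g ^ (-nweight n (u - V)) * this
  · exact (residue_mul_zpow_eq_zero_iff hg (h1.mono hg hg1 (by linarith))).mpr
      (h1.mono hg hg1 (by omega))

variable [CompleteSpace K]

/-- The monomial `V` has weight at most `n`. -/
def IsRay (n : ℕ) (V : ℤ × ℤ) : Prop :=
  ∀ (u : ℤ × ℤ) (k : ℤ), 0 ≤ k → nweight n u ≤ nweight n (u.1 - V.1 * k, u.2 - V.2 * k) + n * k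

theorem isRay_X : IsRay n ((n : ℤ), 0) := fun u _ hk => nweight_le_sub_X u hk

theorem isRay_Y : IsRay n (0, 1) := fun u _ hk => nweight_le_sub_Y u hk

theorem isRay_Z : IsRay n (-1, -1) := fun u _ hk => nweight_le_sub_Z u hk

theorem IsRay.le_sub {V : ℤ × ℤ} (h : IsRay n V) (u : ℤ × ℤ) :
    nweight n u ≤ nweight n (u - V) + n := by
  have := h u 1 zero_le_one
  simp only [mul_one] at this
  exact this

namespace FrobeniusData

omit [CompleteSpace K] in
theorem ordGE_kappa_shift (S : FrobeniusData p n g τ σ) {c : ℤ × ℤ → K}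
    (hc : ∀ u, OrdGE g (nweight n u) (c u)) {V : ℤ × ℤ} (hV : IsRay n V) (u : ℤ × ℤ) (i : ℕ) :
    OrdGE g (nweight n u + i)
      (kappa p n g i * c (u.1 - V.1 * p ^ i, u.2 - V.2 * p ^ i)) := by
  have h := hV u (p ^ i) (by positivity)
  exact ((S.ordGE_kappa_self i).mul S.gen_pos (hc _)).mono S.gen_pos S.gen_lt (by linarith)

theorem leadCoeff_dworkOp (S : FrobeniusData p n g τ σ) (ℓ : ℤ × ℤ → ℤ) {m : K} (hm : ‖m‖ ≤ 1)
    {V : ℤ × ℤ} (hV : IsRay n V) {c : ℤ × ℤ → K} (hc : IsC0 n g c) (u : ℤ × ℤ) :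
    OrdGE g (nweight n u) (dworkOp p n g τ σ ℓ m V c u) ∧
    leadCoeff n g (dworkOp p n g τ σ ℓ m V c) u
      = residue g (ℓ u : K) * leadCoeff n g c u
        + (residue g m * starOp n V (leadCoeff n g c) u
        - residue g τ * starOp n (-1, -1) (leadCoeff n g c) u) := by
  have hg := S.gen_pos
  have hZ : IsRay n (-1, -1) := isRay_Z
  have hmain := S.ordGE_dworkOp_sub ℓ hm V (c := c) (hc.norm_le_one S.gen_lt hg) u
    (k := nweight n u + 1)
    (fun i hi => (S.ordGE_kappa_shift hc.ordGE hV u i).mono hg S.gen_lt (by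
      have : (1 : ℤ) ≤ i := by exact_mod_cast hi
      linarith))
    (fun i hi => (S.ordGE_kappa_shift hc.ordGE hZ u i).mono hg S.gen_lt (by
      have : (1 : ℤ) ≤ i := by exact_mod_cast hi
      linarith))
  set D := dworkOp p n g τ σ ℓ m V c u with hD
  set w := nweight n u with hw
  have t1 : OrdGE g w (c u) := hc.ordGE u
  have t2 : OrdGE g w (g ^ (n : ℤ) * c (u - V)) :=
    ((hc.ordGE _).zpow_mul hg n).mono hg S.gen_lt (by have := hV.le_sub u; linarith)
  have t3 : OrdGE g w (g ^ (n : ℤ) * c (u - (-1, -1))) :=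
    ((hc.ordGE _).zpow_mul hg n).mono hg S.gen_lt (by have := hZ.le_sub u; linarith)
  set L := (ℓ u : K) * c u + g ^ (n : ℤ) * (m * c (u - V) - τ * c (u - (-1, -1))) with hL
  have eL : L = (ℓ u : K) * c u +
      (m * (g ^ (n : ℤ) * c (u - V)) - τ * (g ^ (n : ℤ) * c (u - (-1, -1)))) := by rw [hL]; ring
  have s1 : OrdGE g w L := by
    rw [eL]
    exact (t1.unit_mul (norm_intCast_le_one' _)).add
      ((t2.unit_mul hm).sub (t3.unit_mul S.norm_tau.le))
  have s2 : OrdGE g w D := by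
    have := (hmain.mono hg S.gen_lt (show w ≤ w + 1 by linarith)).add s1
    rwa [sub_add_cancel] at this
  refine ⟨s2, ?_⟩
  have e1 : leadCoeff n g (dworkOp p n g τ σ ℓ m V c) u = residue g (L * g ^ (-w)) := by
    rw [leadCoeff, ← sub_eq_zero, ← residue_sub (norm_mul_zpow_le_one hg s2)
      (norm_mul_zpow_le_one hg s1), ← sub_mul]
    exact (residue_mul_zpow_eq_zero_iff hg
      (hmain.mono hg S.gen_lt (show w ≤ w + 1 by linarith))).mpr hmain
  have r1 := norm_mul_zpow_le_one hg t1
  have r2 := norm_mul_zpow_le_one hg t2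
  have r3 := norm_mul_zpow_le_one hg t3
  have unit : ∀ {x y : K}, ‖x‖ ≤ 1 → ‖y‖ ≤ 1 → ‖x * y‖ ≤ 1 := fun hx hy => by
    rw [norm_mul]; exact mul_le_one₀ hx (norm_nonneg _) hy
  have hτ := S.norm_tau.le
  rw [e1, show L * g ^ (-w) = (ℓ u : K) * (c u * g ^ (-w)) +
      (m * (g ^ (n : ℤ) * c (u - V) * g ^ (-w)) - τ * (g ^ (n : ℤ) * c (u - (-1, -1)) * g ^ (-w)))
      by rw [eL]; ring,
    residue_add (unit (norm_intCast_le_one' _) r1)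
      ((norm_sub_le_max_norm _ _).trans (max_le (unit hm r2) (unit hτ r3))),
    residue_sub (unit hm r2) (unit hτ r3), residue_mul (norm_intCast_le_one' _) r1,
    residue_mul hm r2, residue_mul hτ r3, leadCoeff_shift hg S.gen_lt hc (hV.le_sub u),
    leadCoeff_shift hg S.gen_lt hc (hZ.le_sub u)]
  rfl

theorem isC0_dworkOp (S : FrobeniusData p n g τ σ) (ℓ : ℤ × ℤ → ℤ) {m : K} (hm : ‖m‖ ≤ 1)
    {V : ℤ × ℤ} (hV : IsRay n V) {c : ℤ × ℤ → K} (hc : IsC0 n g c) :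
    IsC0 n g (dworkOp p n g τ σ ℓ m V c) := by
  have hg := S.gen_pos
  have hp1 : (1 : ℤ) ≤ p := by exact_mod_cast S.prime.one_le
  refine ⟨fun u => (S.leadCoeff_dworkOp ℓ hm hV hc u).1, fun k => ?_⟩
  obtain ⟨N, hN⟩ := hc.decay k
  -- For i ≥ k the coefficient κ_i alone supplies the factor g ^ k. For i ≤ k the shift changes the
  -- weight by at most n p ^ k, so the decay of c still applies.
  refine ⟨N + n * p ^ k, fun u hu => ?_⟩
  have hnk : (0 : ℤ) ≤ n * p ^ k := by positivity
  have key : ∀ W : ℤ × ℤ, IsRay n W → ∀ i : ℕ, OrdGE g (nweight n u + k)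
      (kappa p n g i * c (u.1 - W.1 * p ^ i, u.2 - W.2 * p ^ i)) := by
    intro W hW i
    have h1 := hW u (p ^ i) (by positivity)
    rcases le_total k i with hki | hki
    · refine (S.ordGE_kappa_shift hc.ordGE hW u i).mono hg S.gen_lt ?_
      have : (k : ℤ) ≤ i := by exact_mod_cast hki
      linarith
    · have h2 : (n : ℤ) * p ^ i ≤ n * p ^ k :=
        mul_le_mul_of_nonneg_left (pow_le_pow_right₀ hp1 hki) (by positivity)
      have h3 := hN (u.1 - W.1 * p ^ i, u.2 - W.2 * p ^ i) (by linarith)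
      refine ((S.ordGE_kappa_self i).mul hg h3).mono hg S.gen_lt ?_
      have : (0 : ℤ) ≤ i := by positivity
      linarith
  rw [dworkOp]
  refine ((hN u (by linarith)).unit_mul (norm_intCast_le_one' _)).add (OrdGE.tsum fun i => ?_)
  rw [mul_sub, mul_left_comm, mul_left_comm _ (σ^[i] τ)]
  exact ((key V hV i).unit_mul hm).sub ((key _ isRay_Z i).unit_mul (S.norm_sigma_iterate i).le)

omit [IsUltrametricDist K] [CompleteSpace K] in
theorem starOp_truncate {R : Type*} [Zero R] (V : ℤ × ℤ) (a : ℤ × ℤ → R) (d : ℤ) (v : ℤ × ℤ) :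
    starOp n V (fun u => if nweight n u = d then a u else 0) v
      = if nweight n v = d + n then starOp n V a v else 0 := by
  simp only [starOp]
  split_ifs <;> first | rfl | (exfalso; omega)

/-- Descent on a strict bound M for the weights of the leading coefficients. The top part is a
syzygy, hence a Koszul boundary; subtracting a lift of that boundary does not change the image,
because D_x and D_y commute. -/
theorem exists_leadCoeff_eq_zero (S : FrobeniusData p n g τ σ) {e : ℤ × ℤ → K}
    (he : ∀ u, (∀ j ≤ 2 * n, u ≠ epsExp n j) → e u = 0) (M : ℕ) :
    ∀ ξ η : ℤ × ℤ → K, IsC0 n g ξ → IsC0 n g η →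
    (∀ u, (M : ℤ) ≤ nweight n u → leadCoeff n g ξ u = 0 ∧ leadCoeff n g η u = 0) →
    e = dworkOp p n g τ σ Prod.fst n ((n : ℤ), 0) ξ + dworkOp p n g τ σ Prod.snd 1 (0, 1) η →
    ∃ ξ' η' : ℤ × ℤ → K, IsC0 n g ξ' ∧ IsC0 n g η' ∧ leadCoeff n g ξ' = 0 ∧
      leadCoeff n g η' = 0 ∧
      e = dworkOp p n g τ σ Prod.fst n ((n : ℤ), 0) ξ' + dworkOp p n g τ σ Prod.snd 1 (0, 1) η' := by
  have hg := S.gen_pos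
  have hg1 := S.gen_lt
  have hn := S.n_pos
  have hmn := S.norm_n.le
  have hm1 : ‖(1 : K)‖ ≤ 1 := by simp
  induction M with
  | zero =>
    intro ξ η hξ hη h0 heq
    exact ⟨ξ, η, hξ, hη, funext fun u => (h0 u (by simpa using nweight_nonneg u)).1,
      funext fun u => (h0 u (by simpa using nweight_nonneg u)).2, heq⟩
  | succ M ih =>
    intro ξ η hξ hη h0 heq
    set mb := residue g (n : K) with hmb
    set t := residue g τ with ht
    have hmm : mb * residue g (n : K)⁻¹ = 1 := residue_mul_inv S.norm_n
    have htt : t * residue g τ⁻¹ = 1 := residue_mul_inv S.norm_tau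
    set a : ℤ × ℤ → _ := fun u => if nweight n u = M then leadCoeff n g ξ u else 0 with ha
    set b : ℤ × ℤ → _ := fun u => if nweight n u = M then leadCoeff n g η u else 0 with hb
    have hsyz : IsSyzygy n mb t a b := by
      refine isSyzygy_of_gradedOp hn hmm htt fun x y h1 h2 => ?_
      rw [gradedOp, ha, hb, starOp_truncate, starOp_truncate, starOp_truncate, starOp_truncate]
      by_cases hw : nweight n (x, y) = M + n
      · simp only [if_pos hw]
        have hz : e (x, y) = 0 := by
          refine he _ fun j _ hj => ?_
          have hwj : (j : ℤ) = M + n := by rw [← hw, hj, nweight_epsExp]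
          rw [epsExp] at hj
          split_ifs at hj with hjn
          · rw [Prod.mk.injEq] at hj
            omega
          · rw [Prod.mk.injEq] at hj
            omega
        have hlead : leadCoeff n g e (x, y) = 0 := by
          rw [leadCoeff, hz, zero_mul]; exact residue_eq_zero hg1.le (by simp)
        -- In weight M + n the derivative parts see only leading coefficients above the top weight,
        -- which vanish, so the leading forms alone remain.
        have h0' := h0 (x, y) (by rw [hw]; push_cast; omega)
        rw [heq, leadCoeff_add hg (S.isC0_dworkOp _ hmn isRay_X hξ)
          (S.isC0_dworkOp _ hm1 isRay_Y hη), (S.leadCoeff_dworkOp _ hmn isRay_X hξ _).2,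
          (S.leadCoeff_dworkOp _ hm1 isRay_Y hη _).2, h0'.1, h0'.2, residue_one] at hlead
        linear_combination hlead
      · simp only [if_neg hw]; ring
    set ζ' : ℤ × ℤ → _ := syzygyPotential (residue g τ⁻¹) a b with hζ'
    choose lift hlift1 hlift2 using exists_residue_eq (K := K) (g := g)
    -- The lift is confined to weight M - n, so the derivative parts of its images stay in that
    -- weight and only the leading forms reach weight M.
    set ζ : ℤ × ℤ → K := fun u =>
      if nweight n u = (M : ℤ) - n then lift (ζ' u) * g ^ nweight n u else 0 with hζ
    have hζC : IsC0 n g ζ := by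
      refine ⟨fun u => ?_, fun k => ⟨M, fun u hu => ?_⟩⟩
      · simp only [hζ]
        split_ifs
        · exact (ordGE_zpow _).unit_mul (hlift1 _)
        · exact OrdGE.zero _
      · simp only [hζ]
        rw [if_neg (by omega)]
        exact OrdGE.zero _
    have hζl : leadCoeff n g ζ = fun u => if nweight n u = (M : ℤ) - n then ζ' u else 0 := by
      funext u
      simp only [hζ, leadCoeff]
      split_ifs
      · rw [mul_assoc, ← zpow_add₀ S.gen_ne, add_neg_cancel, zpow_zero, mul_one, hlift2]
      · rw [zero_mul]; exact residue_eq_zero hg1.le (by simp)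
    have hDyζ := S.isC0_dworkOp Prod.snd hm1 isRay_Y hζC
    have hDxζ := S.isC0_dworkOp Prod.fst hmn isRay_X hζC
    refine ih (ξ - dworkOp p n g τ σ Prod.snd 1 (0, 1) ζ)
      (η + dworkOp p n g τ σ Prod.fst n ((n : ℤ), 0) ζ) (hξ.sub hDyζ)
      (hη.add hDxζ) (fun u hu => ?_) ?_
    · have hpot := hsyz.eq_potential hn hmm htt u
      have hne : nweight n u ≠ (M : ℤ) - n := by omega
      rw [leadCoeff_sub hg hξ hDyζ, leadCoeff_add hg hη hDxζ,
        (S.leadCoeff_dworkOp _ hm1 isRay_Y hζC _).2, (S.leadCoeff_dworkOp _ hmn isRay_X hζC _).2,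
        hζl]
      simp only [starOp_truncate, if_neg hne, sub_add_cancel, residue_one]
      by_cases hM : nweight n u = M
      · simp only [if_pos hM, ← hmb, ← ht]
        simp only [ha, hb, if_pos hM] at hpot
        constructor
        · linear_combination hpot.1
        · linear_combination hpot.2
      · simp only [if_neg hM]
        have := h0 u (by push_cast; omega)
        rw [this.1, this.2]
        constructor <;> ring
    · rw [S.dworkOp_sub _ _ _ (hξ.norm_le_one hg1 hg) (hDyζ.norm_le_one hg1 hg),
        S.dworkOp_add _ _ _ (hη.norm_le_one hg1 hg) (hDxζ.norm_le_one hg1 hg),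
        S.dworkOp_comm (hζC.norm_le_one hg1 hg), heq]
      abel

/-- The classes of the `ε_i` are linearly independent. -/
theorem eq_zero_of_boundary (S : FrobeniusData p n g τ σ) {e ξ η : ℤ × ℤ → K}
    (he : ∀ u, (∀ j ≤ 2 * n, u ≠ epsExp n j) → e u = 0) (hξ : IsC0 n g ξ) (hη : IsC0 n g η)
    (heq : e = dworkOp p n g τ σ Prod.fst n ((n : ℤ), 0) ξ
      + dworkOp p n g τ σ Prod.snd 1 (0, 1) η) : e = 0 := by
  have hg := S.gen_pos
  have hg1 := S.gen_lt
  have hm1 : ‖(1 : K)‖ ≤ 1 := by simp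
  -- Once the leading coefficients of ξ and η vanish, the whole relation can be divided by g. Hence
  -- e is divisible by all powers of g.
  have main : ∀ (k : ℕ) (e ξ η : ℤ × ℤ → K), (∀ u, (∀ j ≤ 2 * n, u ≠ epsExp n j) → e u = 0) →
      IsC0 n g ξ → IsC0 n g η → e = dworkOp p n g τ σ Prod.fst n ((n : ℤ), 0) ξ
      + dworkOp p n g τ σ Prod.snd 1 (0, 1) η → ∀ u, OrdGE g k (e u) := by
    intro k
    induction k with
    | zero =>
      intro e ξ η _ hξ hη heq u
      have h1 := (S.isC0_dworkOp Prod.fst S.norm_n.le isRay_X hξ).norm_le_one hg1 hg u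
      have h2 := (S.isC0_dworkOp Prod.snd hm1 isRay_Y hη).norm_le_one hg1 hg u
      rw [heq]
      exact ordGE_zero_iff.mpr ((IsUltrametricDist.norm_add_le_max _ _).trans (max_le h1 h2))
    | succ k ih =>
      intro e ξ η he hξ hη heq u
      obtain ⟨N, hN⟩ := hξ.decay 1
      obtain ⟨N', hN'⟩ := hη.decay 1
      obtain ⟨ξ', η', hξ', hη', h1, h2, heq'⟩ := S.exists_leadCoeff_eq_zero he (max N N').toNat ξ η
        hξ hη (fun u hu => by
          have hu' : max N N' ≤ nweight n u := (Int.self_le_toNat _).trans hu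
          exact ⟨(residue_mul_zpow_eq_zero_iff hg (hξ.ordGE u)).mpr
              (hN u ((le_max_left _ _).trans hu')),
            (residue_mul_zpow_eq_zero_iff hg (hη.ordGE u)).mpr
              (hN' u ((le_max_right _ _).trans hu'))⟩) heq
      have := ih (g⁻¹ • e) (g⁻¹ • ξ') (g⁻¹ • η')
        (fun u hu => by rw [Pi.smul_apply, he u hu, smul_zero]) (hξ'.smul_inv hg h1)
        (hη'.smul_inv hg h2) (by rw [dworkOp_smul, dworkOp_smul, ← smul_add, ← heq']) u
      have h3 := this.zpow_mul hg 1
      rw [Pi.smul_apply, smul_eq_mul, zpow_one, mul_inv_cancel_left₀ S.gen_ne] at h3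
      push_cast
      rwa [add_comm]
  funext u
  have hle : ∀ k : ℕ, ‖e u‖ ≤ ‖g‖ ^ k := fun k => by
    have := main k e ξ η he hξ hη heq u
    rwa [OrdGE, zpow_natCast] at this
  have : ‖e u‖ ≤ 0 := ge_of_tendsto' (tendsto_pow_atTop_nhds_zero_of_lt_one hg.le hg1) hle
  simpa using this

end FrobeniusData

-- Only finitely many exponents lie below a given weight, so convergence along the cofinite filter
-- is the same as decay with the weight.
omit [IsUltrametricDist K] [CompleteSpace K] in
theorem mem_C0_iff (hn : 0 < n) (hg : 0 < ‖g‖) (hg1 : ‖g‖ < 1) (c : ℤ × ℤ → K) :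
    c ∈ C0 n {z : K | ‖z‖ ≤ 1} g ↔ IsC0 n g c := by
  have hg0 : g ≠ 0 := norm_pos_iff.mp hg
  have hfin : ∀ N : ℤ, {u : ℤ × ℤ | nweight n u < N}.Finite := fun N => by
    refine ((Finset.Icc (0 : ℤ) N).finite_toSet.biUnion
      (fun d _ => finite_nweight_eq hn d)).subset fun u hu => ?_
    simp only [Set.mem_iUnion]
    exact ⟨nweight n u, by simpa using ⟨nweight_nonneg u, (Set.mem_ofPred.mp hu).le⟩, rfl⟩
  constructor
  · rintro ⟨ξ, h1, h2, h3⟩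
    refine ⟨fun u => ?_, fun k => ?_⟩
    · rw [h3]; exact (ordGE_zpow _).unit_mul (h1 u)
    · have hk : 0 < ‖g‖ ^ k := by positivity
      have h4 := (Metric.tendsto_nhds.mp h2) _ hk
      rw [Filter.eventually_cofinite] at h4
      obtain ⟨N, hN⟩ := (h4.image (nweight n)).bddAbove
      refine ⟨N + 1, fun u hu => ?_⟩
      have h5 : ‖ξ u‖ < ‖g‖ ^ k := by
        by_contra hcon
        have : nweight n u ≤ N := hN ⟨u, by simpa using hcon, rfl⟩
        linarith
      rw [h3, add_comm]
      refine OrdGE.mul hg (k := k) ?_ (ordGE_zpow _)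
      rw [OrdGE, zpow_natCast]; exact h5.le
  · intro hc
    refine ⟨fun u => c u * g ^ (-nweight n u), fun u => norm_mul_zpow_le_one hg (hc.ordGE u), ?_,
      fun u => ?_⟩
    · rw [Metric.tendsto_nhds]
      intro ε hε
      obtain ⟨k, hk⟩ := exists_pow_lt_of_lt_one hε hg1
      obtain ⟨N, hN⟩ := hc.decay k
      rw [Filter.eventually_cofinite]
      refine (hfin N).subset fun u hu => ?_
      by_contra hcon
      have h4 := hN u (not_lt.mp hcon)
      rw [← norm_mul_zpow_le_iff hg, zpow_natCast] at h4
      apply hu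
      rw [dist_zero_right]
      exact h4.trans_lt hk
    · rw [mul_assoc, ← zpow_add₀ hg0, neg_add_cancel, zpow_zero, mul_one]

end Residue

/-! ### The coefficients of `F_t` and of the images of the basis -/

section Entries

variable {K : Type*} [NormedField K] {p n : ℕ} {g τ : K} {σ : K ≃+* K}

namespace FrobeniusData

theorem ordGE_thetaCoeff (S : FrobeniusData p n g τ σ) (k : ℕ) :
    OrdGE g (n * k) (thetaCoeff p (g ^ n) k) := by
  rw [thetaCoeff, ← pow_mul]
  refine OrdGE.unit_mul (S.norm_coeff_le k) ?_
  have := ordGE_zpow (g := g) ((n * k : ℕ) : ℤ)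
  rw [zpow_natCast] at this
  exact_mod_cast this

theorem norm_thetaCoeff (S : FrobeniusData p n g τ σ) {k : ℕ} (hk : k < p) :
    ‖thetaCoeff p (g ^ n) k‖ = ‖g‖ ^ (n * k : ℤ) := by
  rw [thetaCoeff, norm_mul, S.norm_coeff_eq k hk, one_mul, ← pow_mul, norm_pow, ← zpow_natCast]
  push_cast
  rfl

/-- For given v, the total degree satisfies n(k + l + m) = v₁ + n v₂ + (2n+1)k, so the order is
governed by k alone. -/
theorem ordGE_Ft_term (S : FrobeniusData p n g τ σ) {v : ℤ × ℤ} {k l m : ℕ}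
    (h1 : (n : ℤ) * l - k = v.1) (h2 : (m : ℤ) - k = v.2) :
    OrdGE g (v.1 + n * v.2 + (2 * n + 1) * k)
      (τ ^ k * (thetaCoeff p (g ^ n) k * thetaCoeff p (g ^ n) l * thetaCoeff p (g ^ n) m)) := by
  refine OrdGE.unit_mul (by rw [norm_pow, S.norm_tau, one_pow]) ?_
  have := ((S.ordGE_thetaCoeff k).mul S.gen_pos (S.ordGE_thetaCoeff l)).mul S.gen_pos
    (S.ordGE_thetaCoeff m)
  convert this using 1
  rw [← h1, ← h2]; ring

theorem nweight_le_Ft_exponent {v : ℤ × ℤ} {k l m : ℕ}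
    (h1 : (n : ℤ) * l - k = v.1) (h2 : (m : ℤ) - k = v.2) :
    nweight n v ≤ v.1 + n * v.2 + (2 * n + 1) * k := by
  have h3 : (0 : ℤ) ≤ n * l := by positivity
  have : max 0 (max (-v.1) (-v.2)) ≤ (k : ℤ) := by omega
  have := mul_le_mul_of_nonneg_left this (by positivity : (0 : ℤ) ≤ 2 * n + 1)
  unfold nweight
  linarith

variable [IsUltrametricDist K]

theorem ordGE_FtCoeff (S : FrobeniusData p n g τ σ) (v : ℤ × ℤ) :
    OrdGE g (nweight n v) (FtCoeff p n (g ^ n) τ v) :=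
  OrdGE.tsum fun ⟨⟨_, _, _⟩, h1, h2⟩ =>
    (S.ordGE_Ft_term h1 h2).mono S.gen_pos S.gen_lt (nweight_le_Ft_exponent h1 h2)

/-- A term with k = 0 would make n divide v₁; every k ≥ 1 costs at least a further 2n + 1. -/
theorem ordGE_FtCoeff_of_not_dvd (S : FrobeniusData p n g τ σ) {v : ℤ × ℤ} (h1 : 0 ≤ v.1)
    (h2 : 0 ≤ v.2) (h : ¬ (n : ℤ) ∣ v.1) :
    OrdGE g (nweight n v + 1) (FtCoeff p n (g ^ n) τ v) := by
  refine OrdGE.tsum fun ⟨⟨k, l, m⟩, e1, e2⟩ => ?_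
  refine (S.ordGE_Ft_term e1 e2).mono S.gen_pos S.gen_lt ?_
  have hk : k ≠ 0 := by
    rintro rfl
    exact h ⟨l, by simpa using e1.symm⟩
  have hk1 : (1 : ℤ) ≤ k := by exact_mod_cast Nat.one_le_iff_ne_zero.mpr hk
  have hM : max 0 (max (-v.1) (-v.2)) = 0 := by omega
  have : (0 : ℤ) ≤ n * k := by positivity
  unfold nweight
  rw [hM]
  linarith

variable [CompleteSpace K]

/-- The single term with k = 0 dominates, and its Artin-Hasse coefficients are units because l and m
are below p. -/
theorem norm_FtCoeff (S : FrobeniusData p n g τ σ) {l m : ℕ} (hl : l < p) (hm : m < p) :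
    ‖FtCoeff p n (g ^ n) τ ((n : ℤ) * l, (m : ℤ))‖ = ‖g‖ ^ nweight n ((n : ℤ) * l, (m : ℤ)) := by
  set v : ℤ × ℤ := ((n : ℤ) * l, (m : ℤ)) with hv
  have hg := S.gen_pos
  have hn : (n : ℤ) ≠ 0 := by exact_mod_cast S.n_pos.ne'
  have hwv : nweight n v = v.1 + n * v.2 := by
    have h1 : (0 : ℤ) ≤ n * l := by positivity
    have hM : max 0 (max (-v.1) (-v.2)) = 0 := by simp only [hv]; omega
    rw [nweight, hM]; ring
  have hsum : Summable fun w : {w : ℕ × ℕ × ℕ //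
      (n : ℤ) * w.2.1 - w.1 = v.1 ∧ (w.2.2 : ℤ) - w.1 = v.2} =>
      τ ^ w.1.1 * (thetaCoeff p (g ^ n) w.1.1 * thetaCoeff p (g ^ n) w.1.2.1
        * thetaCoeff p (g ^ n) w.1.2.2) := by
    have hinj : Function.Injective (fun w : {w : ℕ × ℕ × ℕ //
        (n : ℤ) * w.2.1 - w.1 = v.1 ∧ (w.2.2 : ℤ) - w.1 = v.2} => w.1.1) := by
      rintro ⟨⟨k, l, m⟩, e1, e2⟩ ⟨⟨k', l', m'⟩, e1', e2'⟩ h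
      simp only at h e1 e2 e1' e2'
      subst h
      have hl : (n : ℤ) * l = n * l' := by linarith
      have hl' : l = l' := by exact_mod_cast mul_left_cancel₀ hn hl
      have hm' : m = m' := by omega
      subst hl' hm'
      rfl
    refine Summable.of_norm_bounded
      ((summable_geometric_of_lt_one hg.le S.gen_lt).comp_injective hinj) ?_
    rintro ⟨⟨k, l, m⟩, e1, e2⟩
    have := (S.ordGE_Ft_term e1 e2).mono hg S.gen_lt (l := (k : ℤ)) (by
      have h1 := nweight_nonneg (n := n) v
      have h2 : (0 : ℤ) ≤ n * k := by positivity
      have h3 : (0 : ℤ) ≤ k := by positivity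
      rw [hwv] at h1
      linarith)
    rw [OrdGE, zpow_natCast] at this
    exact this
  have hrest : OrdGE g (nweight n v + 1) (∑' w : {w : ℕ × ℕ × ℕ //
      (n : ℤ) * w.2.1 - w.1 = v.1 ∧ (w.2.2 : ℤ) - w.1 = v.2},
      if w = ⟨(0, l, m), by simp [hv]⟩ then 0 else
      τ ^ w.1.1 * (thetaCoeff p (g ^ n) w.1.1 * thetaCoeff p (g ^ n) w.1.2.1
        * thetaCoeff p (g ^ n) w.1.2.2)) := by
    refine OrdGE.tsum fun ⟨⟨k, l', m'⟩, e1, e2⟩ => ?_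
    split_ifs with h
    · exact OrdGE.zero _
    · refine (S.ordGE_Ft_term e1 e2).mono hg S.gen_lt ?_
      have hk : k ≠ 0 := by
        rintro rfl
        apply h
        simp only [hv, Nat.cast_zero, sub_zero] at e1 e2
        have hl' : l' = l := by exact_mod_cast mul_left_cancel₀ hn e1
        have hm' : m' = m := by omega
        simp [hl', hm']
      have hk1 : (1 : ℤ) ≤ k := by exact_mod_cast Nat.one_le_iff_ne_zero.mpr hk
      have : (0 : ℤ) ≤ n * k := by positivity
      rw [hwv]
      linarith
  have hmain : ‖τ ^ 0 * (thetaCoeff p (g ^ n) 0 * thetaCoeff p (g ^ n) l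
      * thetaCoeff p (g ^ n) m)‖ = ‖g‖ ^ nweight n v := by
    rw [pow_zero, one_mul, norm_mul, norm_mul, S.norm_thetaCoeff S.prime.pos, S.norm_thetaCoeff hl,
      S.norm_thetaCoeff hm, ← zpow_add₀ hg.ne', ← zpow_add₀ hg.ne', hwv]
    congr 1
    simp only [hv]
    push_cast
    ring
  rw [FtCoeff, hsum.tsum_eq_add_tsum_ite ⟨(0, l, m), by simp [hv]⟩,
    IsUltrametricDist.norm_add_eq_max_of_norm_ne_norm, hmain]
  · refine max_eq_left (hrest.trans ?_)
    exact zpow_le_zpow_right_of_le_one₀ hg S.gen_lt.le (by omega)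
  · rw [hmain]
    refine ne_of_gt (lt_of_le_of_lt hrest ?_)
    exact zpow_lt_zpow_right_of_lt_one₀ hg S.gen_lt (by omega)

end FrobeniusData

theorem alpha1_epsTilde (i : ℕ) (u : ℤ × ℤ) :
    alpha1 p n (g ^ n) τ σ (epsTilde n g i) u
      = σ.symm (FtCoeff p n (g ^ n) τ ((p * u.1, p * u.2) - epsExp n i) * g ^ (i : ℤ)) := by
  rw [alpha1, psi, mulFt, tsum_eq_single (epsExp n i)]
  · rw [epsTilde, Pi.single_eq_same, nweight_epsExp]
  · intro v hv
    rw [epsTilde, Pi.single_eq_of_ne hv, mul_zero]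

theorem FrobeniusData.norm_alpha1 (S : FrobeniusData p n g τ σ) (i : ℕ) (u : ℤ × ℤ) :
    ‖alpha1 p n (g ^ n) τ σ (epsTilde n g i) u‖
      = ‖FtCoeff p n (g ^ n) τ ((p * u.1, p * u.2) - epsExp n i) * g ^ (i : ℤ)‖ := by
  rw [alpha1_epsTilde, ← S.norm_sigma, RingEquiv.apply_symm_apply]

theorem epsExp_of_le {i : ℕ} (h : i ≤ n) : epsExp n i = ((i : ℤ), 0) := if_pos h

theorem epsExp_of_lt {i : ℕ} (h : n < i) : epsExp n i = ((i : ℤ) - n, 1) := if_neg (by omega)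

theorem epsExp_nonneg (i : ℕ) : 0 ≤ (epsExp n i).1 ∧ 0 ≤ (epsExp n i).2 ∧
    (epsExp n i).1 + n * (epsExp n i).2 = i := by
  rcases le_or_gt i n with h | h
  · rw [epsExp_of_le h]; simp
  · rw [epsExp_of_lt h]; simp only; omega

/-- The excess of the weight of `p u - ε_i` over the one given by the lower bound. -/
def excess (p n i : ℕ) (u : ℤ × ℤ) : ℤ :=
  max 0 (max ((epsExp n i).1 - p * u.1) ((epsExp n i).2 - p * u.2))
    - max 0 (max (-(p * u.1)) (-(p * u.2)))

theorem excess_nonneg (i : ℕ) (u : ℤ × ℤ) : 0 ≤ excess p n i u := by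
  have := epsExp_nonneg (n := n) i
  unfold excess
  omega

/-- The linear parts of the weights match exactly, so only the difference of the two maxima
survives, with its factor 2n + 1. -/
theorem nweight_sub_epsExp (i : ℕ) (u : ℤ × ℤ) :
    nweight n ((p * u.1, p * u.2) - epsExp n i) + i
      = p * nweight n u + (2 * n + 1) * excess p n i u := by
  obtain ⟨-, -, h⟩ := epsExp_nonneg (n := n) i
  have hp : (0 : ℤ) ≤ p := by positivity
  have e1 : max 0 (max (-(p * u.1)) (-(p * u.2))) = (p : ℤ) * max 0 (max (-u.1) (-u.2)) := by
    rw [mul_max_of_nonneg _ _ hp, mul_max_of_nonneg _ _ hp, mul_zero, mul_neg, mul_neg]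
  simp only [nweight, excess, e1, Prod.fst_sub, Prod.snd_sub, neg_sub]
  linear_combination -h

/-- The block of the index `i`: the Frobenius matrix is block triangular modulo `g`. -/
def block (n i : ℕ) : ℕ :=
  if i = 0 then 0 else if i < n then 1 else if i = n then 2 else if i < 2 * n then 3 else 4

/-- Suppose the excess is 0. If i > n, then u has both coordinates positive, and weight at most 2n
forces height 1. If 1 ≤ i ≤ n, then u is in the first cone off the vertical axis, or strictly inside
the lower cone, where the weight exceeds n ≥ j. If i = 0, then j = 0 and only the origin has weight
0. -/
theorem one_le_excess (hp : 0 < p) (hn : 0 < n) {i j : ℕ} (hj : j ≤ 2 * n)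
    (hij : block n j ≤ block n i) {u : ℤ × ℤ} (hu : nweight n u = j) (hne : u ≠ epsExp n j) :
    1 ≤ excess p n i u := by
  by_contra hcon
  obtain ⟨a, b⟩ := u
  have hp' : (0 : ℤ) < p := by exact_mod_cast hp
  have hn' : (1 : ℤ) ≤ n := by exact_mod_cast hn
  have ha : (p : ℤ) * a ≤ 0 ↔ a ≤ 0 := by
    constructor
    · intro h; by_contra h'; have := mul_pos hp' (not_le.mp h'); linarith
    · intro h; exact mul_nonpos_of_nonneg_of_nonpos hp'.le h
  have hb : (p : ℤ) * b ≤ 0 ↔ b ≤ 0 := by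
    constructor
    · intro h; by_contra h'; have := mul_pos hp' (not_le.mp h'); linarith
    · intro h; exact mul_nonpos_of_nonneg_of_nonpos hp'.le h
  have hb' : 0 ≤ (p : ℤ) * b ↔ 0 ≤ b := mul_nonneg_iff_of_pos_left hp'
  have hab : (p : ℤ) * a ≤ p * b ↔ a ≤ b := mul_le_mul_iff_right₀ hp'
  simp only [excess] at hcon
  generalize (p : ℤ) * a = P at *
  generalize (p : ℤ) * b = Q at *
  have hjn : i ≤ n → j ≤ n := by
    intro hi
    simp only [block] at hij
    split_ifs at hij <;> omega
  have hj0 : i = 0 → j = 0 := by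
    intro hi
    simp only [block] at hij
    split_ifs at hij <;> omega
  rcases Nat.eq_zero_or_pos i with hi0 | hi0
  · have hj0 := hj0 hi0
    subst hj0
    obtain ⟨h1, h2, h3, h4⟩ := bounds_of_nweight hn hu
    apply hne
    rw [epsExp_of_le (Nat.zero_le _), Prod.mk.injEq]
    simp only [Nat.cast_zero] at *
    omega
  rw [nweight_def] at hu
  rcases le_or_gt i n with hin | hin
  · have hjn := hjn hin
    rw [epsExp_of_le hin] at hcon
    simp only at hcon
    have hcase : (1 ≤ a ∧ 0 ≤ b) ∨ (b < 0 ∧ b < a) := by omega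
    rcases hcase with ⟨h1, h2⟩ | ⟨h1, h2⟩
    · have hM : max 0 (max (-a) (-b)) = 0 := by omega
      rw [hM] at hu
      have hb0 : b = 0 := by
        by_contra hb0
        have : (n : ℤ) * 1 ≤ n * b := mul_le_mul_of_nonneg_left (by omega) (by omega)
        omega
      subst hb0
      apply hne
      rw [epsExp_of_le hjn, Prod.mk.injEq]
      simp only [mul_zero, add_zero] at hu
      exact ⟨hu, rfl⟩
    · have hM : max 0 (max (-a) (-b)) = -b := by omega
      rw [hM] at hu
      have : (n : ℤ) * 1 ≤ n * (-b) := mul_le_mul_of_nonneg_left (by omega) (by omega)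
      have : (j : ℤ) ≤ n := by exact_mod_cast hjn
      linarith
  · rw [epsExp_of_lt hin] at hcon
    simp only at hcon
    have h1 : 1 ≤ a ∧ 1 ≤ b := by omega
    have hM : max 0 (max (-a) (-b)) = 0 := by omega
    rw [hM] at hu
    have hb1 : b = 1 := by
      by_contra hb1
      have : (n : ℤ) * 2 ≤ n * b := mul_le_mul_of_nonneg_left (by omega) (by omega)
      omega
    subst hb1
    apply hne
    rw [epsExp_of_lt (by omega), Prod.mk.injEq]
    exact ⟨by omega, rfl⟩

/-- Divisibility by `n` of the first exponent depends only on the indices. -/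
theorem dvd_exponent_iff (i j : ℕ) :
    (n : ℤ) ∣ p * (epsExp n j).1 - (epsExp n i).1 ↔ (n : ℤ) ∣ p * j - i := by
  obtain ⟨-, -, h1⟩ := epsExp_nonneg (n := n) i
  obtain ⟨-, -, h2⟩ := epsExp_nonneg (n := n) j
  rw [← h1, ← h2]
  have : (p : ℤ) * ((epsExp n j).1 + n * (epsExp n j).2) - ((epsExp n i).1 + n * (epsExp n i).2)
      = (p * (epsExp n j).1 - (epsExp n i).1)
        + n * (p * (epsExp n j).2 - (epsExp n i).2) := by ring
  rw [this]
  exact (dvd_add_left (dvd_mul_right _ _)).symm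

theorem not_dvd_of_block (hp : p.Prime) (hnp : n < p) {j c : ℕ} (hj : j % n ≠ 0) (hc : n ∣ c) :
    ¬ (n : ℤ) ∣ p * j - c := by
  intro h
  have h1 : (n : ℤ) ∣ p * j := by
    have := dvd_add h (Int.natCast_dvd_natCast.mpr hc)
    rwa [sub_add_cancel] at this
  have h2 : n ∣ p * j := by exact_mod_cast h1
  have hn0 : n ≠ 0 := by
    rintro rfl
    rw [zero_dvd_iff, mul_eq_zero] at h2
    rcases h2 with h | h
    · exact hp.ne_zero h
    · exact hj (by rw [h, Nat.zero_mod])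
  exact hj (Nat.mod_eq_zero_of_dvd
    ((Nat.coprime_of_lt_prime hn0 hnp hp).symm.dvd_of_dvd_mul_left h2))

end Entries

/-! ### The Frobenius matrix -/

section FrobeniusMatrix

variable {K : Type*} [NormedField K] [IsUltrametricDist K] {p n : ℕ} {g τ : K} {σ : K ≃+* K}

namespace FrobeniusData

theorem ordGE_alpha1_excess (S : FrobeniusData p n g τ σ) (i : ℕ) (u : ℤ × ℤ) :
    OrdGE g (p * nweight n u + (2 * n + 1) * excess p n i u)
      (alpha1 p n (g ^ n) τ σ (epsTilde n g i) u) := by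
  rw [OrdGE, S.norm_alpha1, ← nweight_sub_epsExp]
  exact (S.ordGE_FtCoeff _).mul_zpow S.gen_pos i

theorem ordGE_alpha1 (S : FrobeniusData p n g τ σ) (i : ℕ) (u : ℤ × ℤ) :
    OrdGE g (p * nweight n u) (alpha1 p n (g ^ n) τ σ (epsTilde n g i) u) := by
  refine (S.ordGE_alpha1_excess i u).mono S.gen_pos S.gen_lt ?_
  have := excess_nonneg (p := p) (n := n) i u
  have : (0 : ℤ) ≤ (2 * n + 1) * excess p n i u := by positivity
  linarith

theorem ordGE_alpha1_of_excess (S : FrobeniusData p n g τ σ) (i : ℕ) (u : ℤ × ℤ)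
    (h : 1 ≤ excess p n i u) :
    OrdGE g (p * nweight n u + 1) (alpha1 p n (g ^ n) τ σ (epsTilde n g i) u) := by
  refine (S.ordGE_alpha1_excess i u).mono S.gen_pos S.gen_lt ?_
  have : (2 * (n : ℤ) + 1) * 1 ≤ (2 * n + 1) * excess p n i u :=
    mul_le_mul_of_nonneg_left h (by positivity)
  linarith

theorem ordGE_alpha1_eps (S : FrobeniusData p n g τ σ) {i j : ℕ} (hi : i ≤ 2 * n)
    (hj : j ≤ 2 * n) (hij : block n j ≤ block n i)
    (h : ¬ (block n j = block n i ∧ (n : ℤ) ∣ p * j - i)) :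
    OrdGE g (p * j + 1) (alpha1 p n (g ^ n) τ σ (epsTilde n g i) (epsExp n j)) := by
  have hn := S.n_pos
  by_cases hex : 1 ≤ excess p n i (epsExp n j)
  · have := S.ordGE_alpha1_of_excess i _ hex
    rwa [nweight_epsExp] at this
  obtain ⟨hj1, hj2, -⟩ := epsExp_nonneg (n := n) j
  have hx1 : 0 ≤ (p : ℤ) * (epsExp n j).1 := by positivity
  have hx2 : 0 ≤ (p : ℤ) * (epsExp n j).2 := by positivity
  have hex0 : (epsExp n i).1 ≤ p * (epsExp n j).1 ∧ (epsExp n i).2 ≤ p * (epsExp n j).2 := by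
    unfold excess at hex
    omega
  -- Between different blocks with zero excess, either the inequalities on the exponents already
  -- fail, or exactly one of the indices i, j is a multiple of n.
  have hdvd : ¬ (n : ℤ) ∣ p * j - i := by
    intro hd
    have hlt : block n j < block n i := lt_of_le_of_ne hij fun he => h ⟨he, hd⟩
    have hcases : (j = 0 ∧ 1 ≤ i ∧ i ≤ n) ∨ (i = n ∧ 1 ≤ j ∧ j < n) ∨ (j ≤ n ∧ n < i) ∨
        (i = 2 * n ∧ n < j ∧ j < 2 * n) := by
      simp only [block] at hlt
      split_ifs at hlt <;> omega
    rcases hcases with ⟨rfl, h1, h2⟩ | ⟨rfl, h1, h2⟩ | ⟨h1, h2⟩ | ⟨rfl, h1, h2⟩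
    · rw [epsExp_of_le (Nat.zero_le _), epsExp_of_le h2] at hex0
      simp only [Nat.cast_zero, mul_zero] at hex0
      omega
    · exact not_dvd_of_block S.prime S.n_lt (by rw [Nat.mod_eq_of_lt h2]; omega) dvd_rfl hd
    · rw [epsExp_of_le h1, epsExp_of_lt h2] at hex0
      simp only [mul_zero] at hex0
      omega
    · refine not_dvd_of_block S.prime S.n_lt ?_ (dvd_mul_left n 2) hd
      rw [show j = (j - n) + n by omega, Nat.add_mod_right, Nat.mod_eq_of_lt (by omega)]
      omega
  have hw := nweight_sub_epsExp (p := p) (n := n) i (epsExp n j)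
  rw [nweight_epsExp] at hw
  have he := excess_nonneg (p := p) (n := n) i (epsExp n j)
  have := (S.ordGE_FtCoeff_of_not_dvd
    (v := ((p : ℤ) * (epsExp n j).1, (p : ℤ) * (epsExp n j).2) - epsExp n i)
    (by simp only [Prod.fst_sub]; omega) (by simp only [Prod.snd_sub]; omega)
    (by simp only [Prod.fst_sub]; rwa [dvd_exponent_iff])).mul_zpow S.gen_pos i
  rw [OrdGE, S.norm_alpha1]
  refine this.trans (zpow_le_zpow_right_of_le_one₀ S.gen_pos S.gen_lt.le ?_)
  have : (0 : ℤ) ≤ (2 * n + 1) * excess p n i (epsExp n j) := by positivity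
  linarith

variable [CompleteSpace K]

theorem norm_alpha1_eps (S : FrobeniusData p n g τ σ) {i j : ℕ} (hi : i ≤ 2 * n)
    (hj : j ≤ 2 * n) (hij : block n j = block n i) (hd : (n : ℤ) ∣ p * j - i) :
    ‖alpha1 p n (g ^ n) τ σ (epsTilde n g i) (epsExp n j)‖ = ‖g‖ ^ ((p : ℤ) * j) := by
  have hn := S.n_pos
  have hp := S.prime.pos
  have hnp : (n : ℤ) < p := by exact_mod_cast S.n_lt
  obtain ⟨x, y, e, hx, hy, he, hxy⟩ : ∃ x y e : ℤ, epsExp n j = (x, e) ∧ epsExp n i = (y, e) ∧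
      (e = 0 ∨ e = 1) ∧ ((x = 0 ∧ y = 0) ∨ (1 ≤ x ∧ x ≤ n ∧ 1 ≤ y ∧ y ≤ n)) := by
    have hcases : (i = 0 ∧ j = 0) ∨ (1 ≤ i ∧ i ≤ n ∧ 1 ≤ j ∧ j ≤ n) ∨ (n < i ∧ n < j) := by
      simp only [block] at hij
      split_ifs at hij <;> omega
    rcases hcases with ⟨rfl, rfl⟩ | ⟨h1, h2, h3, h4⟩ | ⟨h1, h2⟩
    · exact ⟨0, 0, 0, epsExp_of_le (Nat.zero_le _), epsExp_of_le (Nat.zero_le _), by simp⟩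
    · exact ⟨j, i, 0, epsExp_of_le h4, epsExp_of_le h2, by omega, by omega⟩
    · exact ⟨j - n, i - n, 1, epsExp_of_lt h2, epsExp_of_lt h1, by omega, by omega⟩
  -- The upper bound gives l = (p x - y) / n < p, so the Artin-Hasse coefficient of index l is a
  -- unit.
  have h0 : 0 ≤ p * x - y ∧ p * x - y < n * p := by
    rcases hxy with ⟨rfl, rfl⟩ | ⟨h1, h2, h3, h4⟩
    · have : (0 : ℤ) < n * p := by positivity
      constructor <;> simp [this]
    · have h5 : (p : ℤ) * 1 ≤ p * x := mul_le_mul_of_nonneg_left h1 (by omega)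
      have h6 : (p : ℤ) * x ≤ p * n := mul_le_mul_of_nonneg_left h2 (by omega)
      constructor <;> linarith
  rw [← dvd_exponent_iff, hx, hy] at hd
  obtain ⟨l, hl⟩ := hd
  simp only at hl
  have hl0 : 0 ≤ l := by
    by_contra hcon
    have : (n : ℤ) * l < 0 := mul_neg_of_pos_of_neg (by exact_mod_cast hn) (by omega)
    omega
  have hlp : l < p := by
    by_contra hcon
    have : (n : ℤ) * p ≤ n * l := mul_le_mul_of_nonneg_left (by omega) (by omega)
    omega
  lift l to ℕ using hl0
  obtain ⟨m, hm, hm'⟩ : ∃ m : ℕ, m < p ∧ (p : ℤ) * e - e = m := by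
    rcases he with rfl | rfl
    · exact ⟨0, hp, by simp⟩
    · exact ⟨p - 1, by omega, by push_cast [Nat.cast_sub hp]; ring⟩
  have hv : ((p : ℤ) * (epsExp n j).1, (p : ℤ) * (epsExp n j).2) - epsExp n i
      = ((n : ℤ) * l, (m : ℤ)) := by
    rw [hx, hy, Prod.mk_sub_mk, hl, hm']
  have hex : excess p n i (epsExp n j) = 0 := by
    have hx1 : 0 ≤ (p : ℤ) * x := by rcases hxy with ⟨rfl, rfl⟩ | ⟨h1, _⟩ <;> positivity
    have hx2 : 0 ≤ (p : ℤ) * e := by rcases he with rfl | rfl <;> simp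
    unfold excess
    rw [hx, hy]
    simp only
    omega
  have hw := nweight_sub_epsExp (p := p) (n := n) i (epsExp n j)
  rw [nweight_epsExp, hex, mul_zero, add_zero] at hw
  rw [S.norm_alpha1, norm_mul, norm_zpow, hv, S.norm_FtCoeff (by exact_mod_cast hlp) hm, ← hv,
    ← zpow_add₀ S.gen_pos.ne', hw]

omit [IsUltrametricDist K] [CompleteSpace K] in
theorem isC0_of_lattice (S : FrobeniusData p n g τ σ) {ξ : ℤ × ℤ → K}
    (h : ∀ v, OrdGE g (latticeExp p n (nweight n v + n) - n) (ξ v)) : IsC0 n g ξ := by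
  have h2 : ∀ v, OrdGE g (2 * nweight n v) (ξ v) := fun v =>
    (h v).mono S.gen_pos S.gen_lt
      (latticeExp_add_sub_nonneg S.two_lt S.n_pos (nweight_nonneg v))
  refine ⟨fun u => (h2 u).mono S.gen_pos S.gen_lt ?_, fun k => ⟨k, fun u hu =>
    (h2 u).mono S.gen_pos S.gen_lt (by linarith)⟩⟩
  have := nweight_nonneg (n := n) u
  linarith

/-- The matrix of `α₁` exists, it is divisible by the expected powers of `g` and it is block
triangular with monomial blocks up to higher order terms. -/
theorem exists_matrix (S : FrobeniusData p n g τ σ) :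
    ∃ A : Matrix (Fin (2 * n + 1)) (Fin (2 * n + 1)) K,
      (∀ i : Fin (2 * n + 1), ∃ ξ η, IsC0 n g ξ ∧ IsC0 n g η ∧
        alpha1 p n (g ^ n) τ σ (epsTilde n g i) - ∑ j, A i j • epsTilde n g j
          = dworkOp p n g τ σ Prod.fst n ((n : ℤ), 0) ξ
            + dworkOp p n g τ σ Prod.snd 1 (0, 1) η) ∧
      (∀ i j : Fin (2 * n + 1), OrdGE g ((p - 1) * (j : ℕ)) (A i j)) ∧
      (∀ i j : Fin (2 * n + 1), block n j ≤ block n i → ¬ (block n j = block n i ∧ (n : ℤ) ∣ p * (j : ℕ) - (i : ℕ)) →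
        OrdGE g ((p - 1) * (j : ℕ) + 1) (A i j)) ∧
      (∀ i j : Fin (2 * n + 1), block n j = block n i → (n : ℤ) ∣ p * (j : ℕ) - (i : ℕ) →
        ‖A i j‖ = ‖g‖ ^ (((p : ℤ) - 1) * (j : ℕ))) := by
  have hg := S.gen_pos
  have hn := S.n_pos
  have h := fun i : ℕ => S.exists_reduction
    (c := alpha1 p n (g ^ n) τ σ (epsTilde n g i))
    (fun u => (S.ordGE_alpha1 i u).mono hg S.gen_lt (latticeExp_le _))
  choose r ξ η hr hξ hη heq hlead using h
  have hr' : ∀ i j : ℕ, j ≤ 2 * n → OrdGE g (p * j) (r i j) := fun i j hj => by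
    have := hr i j
    rwa [latticeExp_of_le (by exact_mod_cast hj)] at this
  have hlead' : ∀ i j : ℕ, j ≤ 2 * n → block n j ≤ block n i →
      OrdGE g (p * j + 1) (r i j - alpha1 p n (g ^ n) τ σ (epsTilde n g i) (epsExp n j)) := by
    intro i j hj hij
    have := hlead i j hj fun u hu hne => by
      have := S.ordGE_alpha1_of_excess i u (one_le_excess S.prime.pos hn hj hij hu hne)
      rw [hu] at this
      rwa [latticeExp_of_le (by exact_mod_cast hj)]
    rwa [latticeExp_of_le (by exact_mod_cast hj)] at this
  have hdiv : ∀ {k : ℤ} {j : ℕ} {x : K}, OrdGE g (p * j + k) x →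
      OrdGE g ((p - 1) * j + k) (x * g ^ (-(j : ℤ))) := fun {k j x} hx => by
    have := hx.mul_zpow hg (-(j : ℤ))
    rwa [show (p : ℤ) * j + k + -(j : ℤ) = (p - 1) * j + k by ring] at this
  -- Since ε̃_j = g ^ j ε_j, passing to its coefficient removes g ^ j and the slope p becomes p - 1.
  refine ⟨fun i j => r i j * g ^ (-((j : ℕ) : ℤ)), fun i => ⟨ξ i, η i, S.isC0_of_lattice (hξ i),
    S.isC0_of_lattice (hη i), ?_⟩, fun i j => ?_, fun i j hij hd => ?_, fun i j hij hd => ?_⟩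
  · have hs : ∑ j : Fin (2 * n + 1), (r i j * g ^ (-((j : ℕ) : ℤ))) • epsTilde n g j
        = ∑ j ∈ Finset.range (2 * n + 1), Pi.single (epsExp n j) (r i j) := by
      rw [Finset.sum_range]
      refine Finset.sum_congr rfl fun j _ => ?_
      rw [epsTilde, ← Pi.single_smul, smul_eq_mul, nweight_epsExp, mul_assoc,
        ← zpow_add₀ S.gen_ne, neg_add_cancel, zpow_zero, mul_one]
    rw [hs, sub_eq_iff_eq_add, heq i]
    abel_nf
  · have := hdiv (k := 0) (j := j) (x := r i j) (by rw [add_zero]; exact hr' i j (by omega))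
    rwa [add_zero] at this
  · have h1 := hlead' i j (by omega) hij
    have h2 := S.ordGE_alpha1_eps (by omega) (by omega) hij hd
    have := h1.add h2
    rw [sub_add_cancel] at this
    exact hdiv this
  · have h1 := hlead' i j (by omega) hij.le
    have h2 := S.norm_alpha1_eps (by omega) (by omega) hij hd
    have h3 : ‖r i j‖ = ‖g‖ ^ ((p : ℤ) * (j : ℕ)) := by
      rw [← h2, ← norm_neg (alpha1 _ _ _ _ _ _ _)]
      refine IsUltrametricDist.norm_eq_of_add_norm_lt_max ?_
      rw [← sub_eq_add_neg, norm_neg, h2]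
      refine lt_of_le_of_lt h1 (lt_max_of_lt_right ?_)
      exact zpow_lt_zpow_right_of_lt_one₀ hg S.gen_lt (by omega)
    rw [norm_mul, norm_zpow, h3, ← zpow_add₀ hg.ne']
    congr 1
    ring

end FrobeniusData

end FrobeniusMatrix

/-! ### The coefficients of the reversed characteristic polynomial -/

section Charpoly

open Polynomial

/-- The matrix with the columns of `B` at the indices in `S`, and of the identity elsewhere. -/
def mixedMatrix {R ι : Type*} [Zero R] [One R] [DecidableEq ι] (B : Matrix ι ι R) (S : Finset ι) :
    Matrix ι ι R :=
  Matrix.of fun i j => if j ∈ S then B i j else (1 : Matrix ι ι R) i j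

/-- Each column of 1 - T·B·diag(s) is a column of the identity minus T s_j times a column of B. The
formula is the multilinear expansion of the determinant over the choices of columns. -/
theorem coeff_charpolyRev_mul_diagonal {R ι : Type*} [CommRing R] [Fintype ι] [DecidableEq ι]
    (B : Matrix ι ι R) (s : ι → R) (m : ℕ) :
    (B * Matrix.diagonal s).charpolyRev.coeff m = ∑ S : Finset ι,
      if S.card = m then (-1) ^ m * (∏ j ∈ S, s j) * (mixedMatrix B S).det else 0 := by
  have h1 : (B * Matrix.diagonal s).charpolyRev = ∑ S : Finset ι,
      (∏ j ∈ S, (-X * C (s j))) * C (mixedMatrix B S).det := by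
    rw [Matrix.charpolyRev, ← Matrix.det_transpose]
    let r : ι → ι → R[X] := fun j i => -X * C (s j) * C (B i j)
    let e : ι → ι → R[X] := fun j i => if j = i then 1 else 0
    have h2 : (1 - (X : R[X]) • (B * Matrix.diagonal s).map C).transpose = Matrix.of (r + e) := by
      ext j i : 2
      have : (r + e) j i = -X * C (s j) * C (B i j) + if j = i then 1 else 0 := rfl
      rw [Matrix.of_apply, this]
      simp only [Matrix.transpose_apply, Matrix.sub_apply, Matrix.smul_apply, Matrix.map_apply,
        Matrix.mul_diagonal, smul_eq_mul, map_mul, Matrix.one_apply, eq_comm (a := i)]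
      split_ifs <;> ring_nf
    have hadd := (Matrix.detRowAlternating (R := R[X]) (n := ι)).toMultilinearMap.map_add_univ r e
    rw [h2]
    refine Eq.trans hadd (Finset.sum_congr rfl fun S _ => ?_)
    have h3 : S.piecewise r e = fun j => (if j ∈ S then -X * C (s j) else 1) •
        (fun i => C (mixedMatrix B S i j)) := by
      funext j i
      by_cases hj : j ∈ S
      · rw [Finset.piecewise_eq_of_mem _ _ _ hj, if_pos hj]
        simp [mixedMatrix, hj, r]
      · rw [Finset.piecewise_eq_of_notMem _ _ _ hj, if_neg hj, one_smul]
        simp only [mixedMatrix, Matrix.of_apply, if_neg hj, Matrix.one_apply, e, eq_comm (a := i)]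
        split_ifs <;> simp
    rw [h3, MultilinearMap.map_smul_univ, Finset.prod_ite_mem, Finset.univ_inter, smul_eq_mul]
    congr 1
    change Matrix.det ((mixedMatrix B S).map (C : R →+* R[X])).transpose = _
    rw [Matrix.det_transpose, RingHom.map_det]
    rfl
  rw [h1, finsetSum_coeff]
  refine Finset.sum_congr rfl fun S _ => ?_
  have h4 : (∏ j ∈ S, (-X * C (s j))) * C (mixedMatrix B S).det
      = C ((-1) ^ S.card * (∏ j ∈ S, s j) * (mixedMatrix B S).det) * X ^ S.card := by
    rw [Finset.prod_mul_distrib, Finset.prod_const, ← map_prod, neg_pow, C_mul, C_mul, C_pow, C_neg,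
      C_1]
    ring
  rw [h4, coeff_C_mul_X_pow]
  by_cases h : S.card = m
  · rw [if_pos h, if_pos h.symm, h]
  · rw [if_neg h, if_neg (fun h' => h h'.symm)]

/-- Among the sets of `m` indices the set of the first `m` ones has the least sum. -/
theorem sum_lt_sum_of_card {N m : ℕ} (hm : m ≤ N) {S : Finset (Fin N)} (hS : S.card = m)
    (hne : S ≠ ({j : Fin N | (j : ℕ) < m} : Finset (Fin N))) :
    ∑ j ∈ ({j : Fin N | (j : ℕ) < m} : Finset (Fin N)), (j : ℕ) < ∑ j ∈ S, (j : ℕ) := by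
  set S₀ : Finset (Fin N) := {j : Fin N | (j : ℕ) < m} with hS₀
  have hcard : S₀.card = m := by
    rw [hS₀, Fin.card_filter_val_lt, min_eq_right hm]
  have hc : (S₀ \ S).card = (S \ S₀).card := by
    have h1 := Finset.card_sdiff_add_card_inter S₀ S
    have h2 := Finset.card_sdiff_add_card_inter S S₀
    rw [Finset.inter_comm] at h2
    omega
  have hpos : 0 < (S \ S₀).card := by
    rw [Finset.card_pos, Finset.sdiff_nonempty]
    exact fun hsub => hne (Finset.eq_of_subset_of_card_le hsub (by omega))
  have h1 := Finset.sum_inter_add_sum_sdiff S₀ S (fun j => (j : ℕ))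
  have h2 := Finset.sum_inter_add_sum_sdiff S S₀ (fun j => (j : ℕ))
  rw [Finset.inter_comm] at h2
  have h3 : (S \ S₀).card • m ≤ ∑ j ∈ S \ S₀, (j : ℕ) := by
    refine Finset.card_nsmul_le_sum _ _ _ fun j hj => ?_
    have := (Finset.mem_sdiff.mp hj).2
    rw [hS₀, Finset.mem_filter] at this
    by_contra hcon
    exact this ⟨Finset.mem_univ _, by omega⟩
  have h4 : ∑ j ∈ S₀ \ S, ((j : ℕ) + 1) ≤ (S₀ \ S).card • m := by
    refine Finset.sum_le_card_nsmul _ _ _ fun j hj => ?_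
    have := (Finset.mem_sdiff.mp hj).1
    rw [hS₀, Finset.mem_filter] at this
    exact this.2
  rw [Finset.sum_add_distrib, Finset.sum_const, smul_eq_mul, mul_one, hc] at h4
  omega

variable {K : Type*} [NormedField K] [IsUltrametricDist K]

theorem norm_sum_lt {ι : Type*} {s : Finset ι} {f : ι → K} {r : ℝ} (hr : 0 < r)
    (h : ∀ i ∈ s, ‖f i‖ < r) : ‖∑ i ∈ s, f i‖ < r :=
  Finset.sum_induction f (fun x => ‖x‖ < r)
    (fun x y hx hy => (IsUltrametricDist.norm_add_le_max x y).trans_lt (max_lt hx hy))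
    (by simpa using hr) h

/-- The ideal of the elements of norm less than one. -/
def openBallIdeal (K : Type*) [NormedField K] [IsUltrametricDist K] : Ideal (unitBall K) where
  carrier := {x | ‖(x : K)‖ < 1}
  zero_mem' := by simp
  add_mem' := fun {x y} hx hy =>
    (IsUltrametricDist.norm_add_le_max _ _).trans_lt (max_lt hx hy)
  smul_mem' := fun c x hx => by
    simp only [Set.mem_ofPred_eq, smul_eq_mul, Subring.coe_mul, norm_mul] at *
    exact (mul_le_of_le_one_left (norm_nonneg _) c.2).trans_lt hx

theorem mem_openBallIdeal {x : unitBall K} : x ∈ openBallIdeal K ↔ ‖(x : K)‖ < 1 := Iff.rfl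

instance : (openBallIdeal K).IsPrime where
  ne_top' := by
    rw [Ideal.ne_top_iff_one, mem_openBallIdeal]
    simp
  mem_or_mem' := fun {x y} h => by
    simp only [mem_openBallIdeal, Subring.coe_mul, norm_mul] at *
    by_contra! hcon
    have := one_le_mul_of_one_le_of_one_le hcon.1 hcon.2
    linarith

/-- A matrix is invertible over the ring of integers if it is injective modulo the maximal
ideal. -/
theorem norm_det_eq_one {ι : Type*} [Fintype ι] [DecidableEq ι] {M : Matrix ι ι K}
    (hM : ∀ i j, ‖M i j‖ ≤ 1)
    (h : ∀ v : ι → K, (∀ i, ‖v i‖ ≤ 1) → (∀ i, ‖∑ j, M i j * v j‖ < 1) → ∀ i, ‖v i‖ < 1) :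
    ‖M.det‖ = 1 := by
  set M' : Matrix ι ι (unitBall K) := Matrix.of fun i j => ⟨M i j, hM i j⟩ with hM'
  have hdet : M.det = (M'.det : K) := by
    have := RingHom.map_det (unitBall K).subtype M'
    rw [Subring.subtype_apply] at this
    rw [this]
    rfl
  rw [hdet]
  refine le_antisymm M'.det.2 (not_lt.mp fun hlt => ?_)
  have h0 : (M'.map (Ideal.Quotient.mk (openBallIdeal K))).det = 0 := by
    have := RingHom.map_det (Ideal.Quotient.mk (openBallIdeal K)) M'
    rw [Ideal.Quotient.eq_zero_iff_mem.mpr (mem_openBallIdeal.mpr hlt)] at this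
    exact this.symm
  obtain ⟨w, hw0, hw⟩ := Matrix.exists_mulVec_eq_zero_iff.mpr h0
  choose v hv using fun i => Ideal.Quotient.mk_surjective (w i)
  apply hw0
  funext i
  rw [← hv i, Pi.zero_apply, Ideal.Quotient.eq_zero_iff_mem, mem_openBallIdeal]
  refine h (fun i => (v i : K)) (fun i => (v i).2) (fun i => ?_) i
  have h1 := congrFun hw i
  simp only [Matrix.mulVec, dotProduct, Matrix.map_apply, ← hv, ← map_mul, ← map_sum,
    Pi.zero_apply] at h1
  rw [Ideal.Quotient.eq_zero_iff_mem, mem_openBallIdeal] at h1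
  simpa [hM'] using h1

/-- The pivot step of triangular elimination modulo the maximal ideal. -/
theorem norm_lt_one_of_row {ι : Type*} [Fintype ι] [DecidableEq ι] {a v : ι → K} {j₀ : ι}
    (h : ‖∑ j, a j * v j‖ < 1) (ha : ‖a j₀‖ = 1) (h' : ∀ j ≠ j₀, ‖a j * v j‖ < 1) :
    ‖v j₀‖ < 1 := by
  have h1 : a j₀ * v j₀ = ∑ j, a j * v j - ∑ j ∈ Finset.univ.erase j₀, a j * v j := by
    rw [← Finset.add_sum_erase _ _ (Finset.mem_univ j₀)]; ring
  have h2 : ‖a j₀ * v j₀‖ < 1 := by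
    rw [h1]
    exact (norm_sub_le_max_norm _ _).trans_lt
      (max_lt h (norm_sum_lt one_pos fun j hj => h' j (Finset.ne_of_mem_erase hj)))
  rwa [norm_mul, ha, one_mul] at h2

end Charpoly

/-! ### The blocks -/

section Block

variable {p n : ℕ}

/-- As p is prime to n, multiplication by p preserves nonzero residues modulo n, so the row
congruent to p j can be found in the block of j. -/
theorem exists_row (hp : p.Prime) (hn : 0 < n) (hnp : n < p) {j : ℕ} (hj : j ≤ 2 * n) :
    ∃ i ≤ 2 * n, block n j = block n i ∧ (n : ℤ) ∣ p * j - i := by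
  have hmod : (n : ℤ) ∣ p * j - (p * j % n : ℕ) := by
    refine ⟨(p * j / n : ℕ), ?_⟩
    have h : ((p * j % n + n * (p * j / n) : ℕ) : ℤ) = (p * j : ℕ) := by rw [Nat.mod_add_div]
    push_cast at h ⊢
    linarith
  have hlt := Nat.mod_lt (p * j) hn
  have hpos : j % n ≠ 0 → p * j % n ≠ 0 := fun h h0 =>
    not_dvd_of_block hp hnp h (dvd_zero n) (by rwa [h0] at hmod)
  by_cases h0 : j % n = 0
  · refine ⟨j, hj, rfl, ?_⟩
    have h1 : (n : ℤ) ∣ j := Int.natCast_dvd_natCast.mpr (Nat.dvd_of_mod_eq_zero h0)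
    exact dvd_sub (h1.mul_left _) h1
  have hj0 : j ≠ 0 := by rintro rfl; exact h0 (Nat.zero_mod _)
  have hjn : j ≠ n := by rintro rfl; exact h0 (Nat.mod_self _)
  have hj2n : j ≠ 2 * n := by rintro rfl; exact h0 (Nat.mul_mod_left _ _)
  have hpos := hpos h0
  by_cases hjlt : j < n
  · refine ⟨p * j % n, by omega, ?_, hmod⟩
    simp only [block]
    rw [if_neg hj0, if_pos hjlt, if_neg hpos, if_pos hlt]
  · refine ⟨n + p * j % n, by omega, ?_, ?_⟩
    · simp only [block]
      split_ifs <;> omega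
    · have := dvd_sub hmod (dvd_refl (n : ℤ))
      rw [sub_sub] at this
      rwa [Nat.cast_add, add_comm]

/-- Two indices of one block differ by less than n, and p is invertible modulo n. -/
theorem eq_of_block (hp : p.Prime) (hn : 0 < n) (hnp : n < p) {i j j' : ℕ} (hj : j ≤ 2 * n)
    (hj' : j' ≤ 2 * n) (hb : block n j = block n j') (h : (n : ℤ) ∣ p * j - i)
    (h' : (n : ℤ) ∣ p * j' - i) : j = j' := by
  have h1 : (n : ℤ) ∣ p * (j - j') := by
    have := dvd_sub h h'
    rwa [sub_sub_sub_cancel_right, ← mul_sub] at this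
  have hco : IsCoprime (n : ℤ) p :=
    Nat.isCoprime_iff_coprime.mpr (Nat.coprime_of_lt_prime hn.ne' hnp hp).symm
  have h2 : (n : ℤ) ∣ j - j' := hco.dvd_of_dvd_mul_left h1
  have h3 : |(j : ℤ) - j'| < n := by
    rw [abs_lt]
    simp only [block] at hb
    split_ifs at hb <;> omega
  have := Int.eq_zero_of_abs_lt_dvd h2 h3
  omega

/-- The listed values of m are the places where a block ends, so no block meets both {0, …, m-1} and
its complement. -/
theorem block_lt_block {m : ℕ} (hm : m ∈ ({1, n, n + 1, 2 * n, 2 * n + 1} : Finset ℕ)) (hn : 0 < n)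
    {i j : ℕ} (hi : i ≤ 2 * n) (hj : j < m) (hmi : m ≤ i) : block n j < block n i := by
  simp only [Finset.mem_insert, Finset.mem_singleton] at hm
  simp only [block]
  split_ifs <;> omega

end Block

/-! ### Minors at the block boundaries and the resulting Newton polygon -/

section CharpolyRev

variable {K : Type*} [NormedField K] [IsUltrametricDist K] {p n : ℕ}

/-- Modulo the maximal ideal the matrix has monomial diagonal blocks followed by an identity, and
vanishes below them. Back substitution from the last block shows that its kernel is zero. -/
theorem norm_det_mixedMatrix (hp : p.Prime) (hn : 0 < n) (hnp : n < p)
    {B : Matrix (Fin (2 * n + 1)) (Fin (2 * n + 1)) K} (hB : ∀ i j, ‖B i j‖ ≤ 1)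
    (hlt : ∀ i j : Fin (2 * n + 1), block n j ≤ block n i →
      ¬ (block n j = block n i ∧ (n : ℤ) ∣ p * (j : ℕ) - (i : ℕ)) → ‖B i j‖ < 1)
    (heq : ∀ i j : Fin (2 * n + 1), block n j = block n i →
      (n : ℤ) ∣ p * (j : ℕ) - (i : ℕ) → ‖B i j‖ = 1)
    {m : ℕ} (hm : m ∈ ({1, n, n + 1, 2 * n, 2 * n + 1} : Finset ℕ)) :
    ‖(mixedMatrix B ({j | (j : ℕ) < m} : Finset (Fin (2 * n + 1)))).det‖ = 1 := by
  set M := mixedMatrix B ({j | (j : ℕ) < m} : Finset (Fin (2 * n + 1))) with hM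
  have hM1 : ∀ i j : Fin (2 * n + 1), (j : ℕ) < m → M i j = B i j := fun i j hj => by
    simp [hM, mixedMatrix, hj]
  have hM2 : ∀ i j : Fin (2 * n + 1), m ≤ (j : ℕ) →
      M i j = (1 : Matrix (Fin (2 * n + 1)) (Fin (2 * n + 1)) K) i j := fun i j hj => by
    simp [hM, mixedMatrix, not_lt.mpr hj]
  have hle : ∀ i j, ‖M i j‖ ≤ 1 := fun i j => by
    rcases lt_or_ge (j : ℕ) m with hj | hj
    · rw [hM1 i j hj]; exact hB i j
    · rw [hM2 i j hj, Matrix.one_apply]; split_ifs <;> simp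
  refine norm_det_eq_one hle fun v hv hMv => ?_
  have mul_lt_left : ∀ {x y : K}, ‖x‖ < 1 → ‖y‖ ≤ 1 → ‖x * y‖ < 1 := fun hx hy => by
    rw [norm_mul]; exact mul_lt_one_of_nonneg_of_lt_one_left (norm_nonneg _) hx hy
  have mul_lt_right : ∀ {x y : K}, ‖x‖ ≤ 1 → ‖y‖ < 1 → ‖x * y‖ < 1 := fun hx hy => by
    rw [norm_mul]; exact mul_lt_one_of_nonneg_of_lt_one_right hx (norm_nonneg _) hy
  have hhigh : ∀ i : Fin (2 * n + 1), m ≤ (i : ℕ) → ‖v i‖ < 1 := fun i hi => by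
    refine norm_lt_one_of_row (hMv i) (by rw [hM2 i i hi]; simp) fun j hj => ?_
    rcases lt_or_ge (j : ℕ) m with hjm | hjm
    · have hb := block_lt_block hm hn (by omega) hjm hi
      rw [hM1 i j hjm]
      exact mul_lt_left (hlt i j hb.le fun h => hb.ne h.1) (hv j)
    · rw [hM2 i j hjm, Matrix.one_apply_ne hj.symm]; simp
  -- The induction runs through the blocks from the last to the first. For column j₀ the pivot row
  -- lies in the same block; later blocks have small coordinates already, and the other entries of
  -- the row are small.
  have hlow : ∀ (k : ℕ) (j₀ : Fin (2 * n + 1)), (j₀ : ℕ) < m → 4 - block n j₀ = k →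
      ‖v j₀‖ < 1 := by
    intro k
    induction k using Nat.strong_induction_on with
    | _ k ih =>
      intro j₀ hj₀ hk
      obtain ⟨i', hi', hb, hd⟩ := exists_row hp hn hnp (j := j₀) (by omega)
      obtain ⟨i, rfl⟩ : ∃ i : Fin (2 * n + 1), (i : ℕ) = i' := ⟨⟨i', by omega⟩, rfl⟩
      have him : (i : ℕ) < m := by
        by_contra hcon
        have := block_lt_block hm hn (i := i) (by omega) hj₀ (by omega)
        omega
      refine norm_lt_one_of_row (hMv i) (by rw [hM1 i j₀ hj₀]; exact heq i j₀ hb hd)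
        fun j hj => ?_
      rcases lt_or_ge (j : ℕ) m with hjm | hjm
      · rcases lt_or_ge (block n i) (block n j) with h | h
        · have h4 : ∀ i, block n i ≤ 4 := fun i => by
            simp only [block]; split_ifs <;> omega
          have := h4 j
          exact mul_lt_right (hle i j) (ih (4 - block n j) (by omega) j hjm rfl)
        · rw [hM1 i j hjm]
          refine mul_lt_left (hlt i j h fun h' => hj ?_) (hv j)
          exact Fin.ext (eq_of_block hp hn hnp (by omega) (by omega) (h'.1.trans hb.symm) h'.2 hd)
      · rw [hM2 i j hjm, Matrix.one_apply_ne (fun h => by subst h; omega)]; simp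
  intro i
  rcases lt_or_ge (i : ℕ) m with h | h
  · exact hlow _ i h rfl
  · exact hhigh i h

/-- The norms of the coefficients of `det (1 - T A)` at the vertices, where the minor formed by the
first rows and columns dominates. -/
theorem norm_coeff_charpolyRev {N m : ℕ} (hm : m ≤ N) {h : K} (hh : 0 < ‖h‖) (hh1 : ‖h‖ < 1)
    {B : Matrix (Fin N) (Fin N) K} (hB : ∀ i j, ‖B i j‖ ≤ 1)
    (hdet : ‖(mixedMatrix B ({j | (j : ℕ) < m} : Finset (Fin N))).det‖ = 1) :
    ‖(B * Matrix.diagonal fun j : Fin N => h ^ (j : ℕ)).charpolyRev.coeff m‖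
      = ‖h‖ ^ (m * (m - 1) / 2) := by
  set S₀ : Finset (Fin N) := {j | (j : ℕ) < m} with hS₀
  have hcard : S₀.card = m := by
    rw [hS₀, Fin.card_filter_val_lt, min_eq_right hm]
  have hsum : ∑ j ∈ S₀, (j : ℕ) = m * (m - 1) / 2 := by
    rw [← Finset.sum_range_id, ← Finset.sum_image (f := fun j : ℕ => j) (g := fun j : Fin N => (j : ℕ))
      (fun _ _ _ _ h => Fin.ext h)]
    congr 1
    ext j
    simp only [hS₀, Finset.mem_image, Finset.mem_filter, Finset.mem_univ, true_and, Finset.mem_range]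
    exact ⟨fun ⟨a, ha, h⟩ => h ▸ ha, fun h => ⟨⟨j, by omega⟩, h, rfl⟩⟩
  have hle : ∀ S, ‖(mixedMatrix B S).det‖ ≤ 1 := fun S => by
    rw [Matrix.det_apply]
    refine IsUltrametricDist.norm_sum_le_of_forall_le_of_nonneg zero_le_one fun π _ => ?_
    rw [Units.smul_def, zsmul_eq_mul, norm_mul, norm_prod]
    refine mul_le_one₀ (norm_intCast_le_one' _) (Finset.prod_nonneg fun _ _ => norm_nonneg _)
      (Finset.prod_le_one (fun _ _ => norm_nonneg _) fun i _ => ?_)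
    simp only [mixedMatrix, Matrix.of_apply]
    split_ifs
    · exact hB _ _
    · rw [Matrix.one_apply]; split_ifs <;> simp
  rw [coeff_charpolyRev_mul_diagonal, ← Finset.add_sum_erase _ _ (Finset.mem_univ S₀), if_pos hcard]
  have hmain : ‖(-1) ^ m * (∏ j ∈ S₀, h ^ (j : ℕ)) * (mixedMatrix B S₀).det‖
      = ‖h‖ ^ (m * (m - 1) / 2) := by
    rw [norm_mul, norm_mul, hdet, norm_pow, norm_neg, norm_one, one_pow, one_mul, mul_one,
      Finset.prod_pow_eq_pow_sum, norm_pow, hsum]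
  have hrest : ‖∑ S ∈ Finset.univ.erase S₀, if S.card = m then
      (-1) ^ m * (∏ j ∈ S, h ^ (j : ℕ)) * (mixedMatrix B S).det else 0‖
      < ‖h‖ ^ (m * (m - 1) / 2) := by
    refine norm_sum_lt (by positivity) fun S hS => ?_
    split_ifs with hSm
    · rw [norm_mul, norm_mul, norm_pow, norm_neg, norm_one, one_pow, one_mul,
        Finset.prod_pow_eq_pow_sum, norm_pow]
      refine lt_of_le_of_lt (mul_le_of_le_one_right (by positivity) (hle S)) ?_
      rw [← hsum]
      exact pow_lt_pow_right_of_lt_one₀ hh hh1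
        (sum_lt_sum_of_card hm hSm (Finset.ne_of_mem_erase hS))
    · rw [norm_zero]; positivity
  rw [IsUltrametricDist.norm_add_eq_max_of_norm_ne_norm (by rw [hmain]; exact hrest.ne'), hmain,
    max_eq_left hrest.le]

end CharpolyRev

/-! ### Existence, uniqueness and Newton polygon of the Frobenius matrix -/

section Main

variable {K : Type*} [NormedField K] [IsUltrametricDist K] {p n : ℕ} {g τ : K} {σ : K ≃+* K}

omit [IsUltrametricDist K] in
theorem sum_smul_epsTilde_apply {N : ℕ} (x : Fin N → K) (j : Fin N) :
    (∑ i, x i • epsTilde n g i) (epsExp n j) = x j * g ^ nweight n (epsExp n j) := by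
  rw [Finset.sum_apply, Finset.sum_eq_single j]
  · rw [Pi.smul_apply, epsTilde, Pi.single_eq_same, smul_eq_mul]
  · intro i _ hij
    have : epsExp n j ≠ epsExp n i := fun h => hij (Fin.ext (epsExp_injective h.symm))
    rw [Pi.smul_apply, epsTilde, Pi.single_eq_of_ne this, smul_zero]
  · exact fun h => absurd (Finset.mem_univ _) h

omit [IsUltrametricDist K] in
theorem sum_smul_epsTilde_apply_of_ne (x : Fin (2 * n + 1) → K) {u : ℤ × ℤ}
    (hu : ∀ j ≤ 2 * n, u ≠ epsExp n j) : (∑ i, x i • epsTilde n g i) u = 0 := by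
  rw [Finset.sum_apply]
  refine Finset.sum_eq_zero fun i _ => ?_
  rw [Pi.smul_apply, epsTilde, Pi.single_eq_of_ne (hu i (by omega)), smul_zero]

variable [CompleteSpace K]

namespace FrobeniusData

theorem isFrobeniusMatrix_unique (S : FrobeniusData p n g τ σ)
    {A A' : Matrix (Fin (2 * n + 1)) (Fin (2 * n + 1)) K}
    (hA : IsFrobeniusMatrix p n {z : K | ‖z‖ ≤ 1} g (g ^ n) τ σ A)
    (hA' : IsFrobeniusMatrix p n {z : K | ‖z‖ ≤ 1} g (g ^ n) τ σ A') : A' = A := by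
  have hg := S.gen_pos
  have hg1 := S.gen_lt
  ext i j
  obtain ⟨ξ, hξ, η, hη, h⟩ := hA.2 i
  obtain ⟨ξ', hξ', η', hη', h'⟩ := hA'.2 i
  rw [mem_C0_iff S.n_pos hg hg1] at hξ hη hξ' hη'
  rw [Dx_eq, Dy_eq] at h h'
  have key : ∑ j, (A' i j - A i j) • epsTilde n g j
      = dworkOp p n g τ σ Prod.fst n ((n : ℤ), 0) (ξ - ξ')
        + dworkOp p n g τ σ Prod.snd 1 (0, 1) (η - η') := by
    rw [S.dworkOp_sub _ _ _ (hξ.norm_le_one hg1 hg) (hξ'.norm_le_one hg1 hg),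
      S.dworkOp_sub _ _ _ (hη.norm_le_one hg1 hg) (hη'.norm_le_one hg1 hg),
      sub_add_sub_comm, ← h, ← h']
    simp only [sub_smul, Finset.sum_sub_distrib]
    abel
  have hz := S.eq_zero_of_boundary (e := ∑ j, (A' i j - A i j) • epsTilde n g j)
    (fun u hu => sum_smul_epsTilde_apply_of_ne _ hu)
    (hξ.sub hξ') (hη.sub hη') key
  have h1 := sum_smul_epsTilde_apply (g := g) (n := n) (fun j => A' i j - A i j) j
  rw [hz, Pi.zero_apply] at h1
  rcases mul_eq_zero.mp h1.symm with h2 | h2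
  · exact sub_eq_zero.mp h2
  · exact absurd h2 (zpow_ne_zero _ S.gen_ne)

theorem exists_isFrobeniusMatrix (S : FrobeniusData p n g τ σ) :
    ∃ A : Matrix (Fin (2 * n + 1)) (Fin (2 * n + 1)) K,
      IsFrobeniusMatrix p n {z : K | ‖z‖ ≤ 1} g (g ^ n) τ σ A ∧
      ∀ m ∈ ({1, n, n + 1, 2 * n, 2 * n + 1} : Finset ℕ),
        ‖A.charpolyRev.coeff m‖ = ‖g ^ (p - 1)‖ ^ (m * (m - 1) / 2) := by
  have hg := S.gen_pos
  have hg1 := S.gen_lt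
  have hp1 : 1 ≤ p := S.prime.one_le
  obtain ⟨A, h1, h2, h3, h4⟩ := S.exists_matrix
  have hpow : ∀ j : ℕ, ‖(g ^ (p - 1)) ^ j‖ = ‖g‖ ^ (((p : ℤ) - 1) * j) := fun j => by
    rw [← pow_mul, norm_pow, ← zpow_natCast]
    push_cast [Nat.cast_sub hp1]
    rfl
  have hpos : ∀ j : ℕ, 0 < ‖(g ^ (p - 1)) ^ j‖ := fun j => by
    rw [norm_pow, norm_pow]; positivity
  have hne : ∀ j : ℕ, (g ^ (p - 1)) ^ j ≠ 0 := fun j => norm_pos_iff.mp (hpos j)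
  refine ⟨A, ⟨fun i j => ?_, fun i => ?_⟩, fun m hm => ?_⟩
  · refine ordGE_zero_iff.mp ((h2 i j).mono hg hg1 ?_)
    have : (0 : ℤ) ≤ p - 1 := by omega
    positivity
  · obtain ⟨ξ, η, hξ, hη, h⟩ := h1 i
    refine ⟨ξ, (mem_C0_iff S.n_pos hg hg1 _).mpr hξ, η, (mem_C0_iff S.n_pos hg hg1 _).mpr hη, ?_⟩
    rw [Dx_eq, Dy_eq]
    exact h
  -- The powers of g expected in the columns are removed, which leaves an integral matrix whose
  -- boundary minors are units.
  · set B : Matrix (Fin (2 * n + 1)) (Fin (2 * n + 1)) K :=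
      Matrix.of fun i j => A i j / (g ^ (p - 1)) ^ (j : ℕ) with hB
    have hAB : A = B * Matrix.diagonal fun j : Fin (2 * n + 1) => (g ^ (p - 1)) ^ (j : ℕ) := by
      ext i j
      rw [Matrix.mul_diagonal, hB, Matrix.of_apply, div_mul_cancel₀ _ (hne j)]
    have hBn : ∀ i j, ‖B i j‖ = ‖A i j‖ / ‖g‖ ^ (((p : ℤ) - 1) * (j : ℕ)) := fun i j => by
      rw [hB, Matrix.of_apply, norm_div, hpow]
    have hB1 : ∀ i j, ‖B i j‖ ≤ 1 := fun i j => by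
      rw [hBn, div_le_one (by positivity)]
      exact h2 i j
    have hmN : m ≤ 2 * n + 1 := by
      have := S.n_pos
      simp only [Finset.mem_insert, Finset.mem_singleton] at hm
      omega
    conv_lhs => rw [hAB]
    refine norm_coeff_charpolyRev hmN (by rw [norm_pow]; positivity)
      (by rw [norm_pow]; exact pow_lt_one₀ hg.le hg1 (by have := S.two_lt; omega)) hB1 ?_
    refine norm_det_mixedMatrix S.prime S.n_pos S.n_lt hB1 (fun i j hij hd => ?_)
      (fun i j hij hd => ?_) hm
    · rw [hBn, div_lt_one (by positivity)]
      refine lt_of_le_of_lt (h3 i j hij hd) ?_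
      exact zpow_lt_zpow_right_of_lt_one₀ hg hg1 (by omega)
    · rw [hBn, h4 i j hij hd, div_self (by positivity)]

end FrobeniusData

end Main

/-! ### The field `Ω₀(γ̃)` -/

section Omega

variable {p : ℕ} [hp : Fact p.Prime] {a n : ℕ} {ζ γ g : ℂ_[p]}

theorem norm_ratCast_Omega (x : ℚ) : ‖(x : Omega p a ζ g)‖ = ‖(x : ℚ_[p])‖ := by
  rw [← map_ratCast (algebraMap ℚ_[p] (Omega p a ζ g)) x]
  exact norm_algebraMap' (Omega p a ζ g) (x : ℚ_[p])

theorem norm_eq_one_of_isTeichmuller (ha : 0 < a) {F : Type*} [Field F] {red : Zq p a →+* F}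
    {t : F} (ht : t ≠ 0) {τ : ℂ_[p]} (h : IsTeichmuller p a red t τ) : ‖τ‖ = 1 := by
  obtain ⟨z, hz, hzt, rfl⟩ := h
  have hz0 : (z : ℂ_[p]) ≠ 0 := by
    intro h0
    have : z = 0 := Subtype.ext h0
    rw [this, map_zero] at hzt
    exact ht hzt.symm
  have h1 : (z : ℂ_[p]) ^ p ^ a = z := congrArg Subtype.val hz
  refine norm_of_pow_eq_one (pow_sub_one_pos (p := p) ha) ?_
  apply mul_right_cancel₀ hz0
  rw [← pow_succ, Nat.sub_add_cancel (Nat.one_le_pow _ _ hp.out.pos), h1, one_mul]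

theorem frobeniusData_Omega (hp2 : 2 < p) (hn : 0 < n) (hnp : n < p) (ha : 0 < a)
    (hζ : IsPrimitiveRoot ζ p) (hγ : γ ∈ IntermediateField.adjoin ℚ_[p] {ζ})
    (hγ0 : HasSum (fun k : ℕ => γ ^ p ^ k / (p : ℂ_[p]) ^ k) 0)
    (hγn : ‖γ‖ ^ (p - 1) = ‖(p : ℚ_[p])‖) (hg : g ^ n = γ)
    (σ : Omega p a ζ g ≃ₐ[ℚ_[p]] Omega p a ζ g)
    {τ : Omega p a ζ g} (hτ : ‖(τ : ℂ_[p])‖ = 1) :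
    FrobeniusData p n (Omega.gen p a ζ g) τ σ.toRingEquiv := by
  have := finiteDimensional_Omega hn ha hζ hγ hg
  have hgn := gen_norm_pow hγn hg
  have hgen : ‖Omega.gen p a ζ g‖ = ‖g‖ := rfl
  have hnat : ∀ m : ℕ, ‖(m : Omega p a ζ g)‖ = ‖(m : ℚ_[p])‖ := fun m => by
    have := norm_ratCast_Omega (p := p) (a := a) (ζ := ζ) (g := g) m
    simpa using this
  have hgpos : 0 < ‖g‖ := by
    rw [norm_pos_iff]
    rintro rfl
    rw [norm_zero, zero_pow (Nat.mul_pos hn (by omega)).ne'] at hgn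
    exact (norm_prime_pos p).ne hgn
  refine ⟨hp.out, hp2, hn, hnp, hgpos, gen_norm_lt_one hγn hg, ?_, ?_, hτ,
    fun z => norm_algEquiv_apply σ z, ?_, fun k => ?_, fun k hk => ?_⟩
  · rw [hgen, hgn, hnat]
  · rw [hnat, Padic.norm_natCast_eq_one_iff]
    exact Nat.coprime_of_lt_prime hn.ne' hnp hp.out
  · have hind : Topology.IsInducing (Subtype.val : Omega p a ζ g → ℂ_[p]) := .subtypeVal
    refine (hind.hasSum_iff (g := (Omega p a ζ g).val) (L := .unconditional ℕ) _ _).mp ?_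
    rw [map_zero]
    convert hγ0 using 2 with k
    rw [← hg]
    simp [Omega.gen]
  · rw [norm_ratCast_Omega]; exact norm_coeff_artinHasse_le p k
  · rw [norm_ratCast_Omega]; exact norm_coeff_artinHasse_of_lt p hk

theorem ordp_of_norm_eq {K : Type*} [NormedField K] (hn : 0 < n) {h z : K}
    (hh : ‖h‖ ^ n = ‖(p : ℚ_[p])‖) (m : ℕ) (hz : ‖z‖ = ‖h‖ ^ (m * (m - 1) / 2)) :
    ordp p z = (((m : ℝ) * ((m : ℝ) - 1) / (2 * (n : ℝ)) : ℝ) : WithTop ℝ) := by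
  have hp1 : (1 : ℝ) < p := by exact_mod_cast hp.out.one_lt
  have hpos : 0 < ‖h‖ := by
    refine (norm_nonneg h).lt_of_ne fun h0 => ?_
    rw [← h0, zero_pow hn.ne'] at hh
    exact (norm_prime_pos p).ne hh
  have hz0 : z ≠ 0 := norm_pos_iff.mp (by rw [hz]; positivity)
  have hlog : (n : ℝ) * Real.logb p ‖h‖ = -1 := by
    rw [← Real.logb_pow, hh, Padic.norm_p, Real.logb_inv, Real.logb_self_eq_one hp1]
  have hm : ((m * (m - 1) / 2 : ℕ) : ℝ) = (m : ℝ) * ((m : ℝ) - 1) / 2 := by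
    rw [Nat.cast_div (Nat.even_mul_pred_self m).two_dvd (by norm_num)]
    cases m with
    | zero => simp
    | succ m => push_cast; simp
  rw [ordp, if_neg hz0, hz, Real.logb_pow, hm]
  congr 1
  have hn' : (n : ℝ) ≠ 0 := by exact_mod_cast hn.ne'
  have h1 : Real.logb p ‖h‖ = -1 / n := by
    rw [eq_div_iff hn', mul_comm]; exact hlog
  rw [h1]
  field_simp

end Omega

end DworkFamily

end

/-! ### The theorem for Ω₀(γ̃) -/

open DworkFamily in
theorem theorem3p1
    (p : ℕ) [Fact p.Prime] (hp2 : 2 < p)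
    (n : ℕ) (hn : 0 < n) (hnp : n < p)
    (a : ℕ) (ha : 0 < a)
    -- the finite field with `q = p ^ a` elements, as the residue field of `ℤ_q`
    {F : Type*} [Field F] [Fintype F] (hF : Fintype.card F = p ^ a)
    (red : Zq p a →+* F)
    -- the parameter `t` of the family
    (t : F) (ht : t ≠ 0)
    -- the choices of `ζ_p`, of `γ` and of `γ̃ = g`
    (ζ : ℂ_[p]) (hζ : IsPrimitiveRoot ζ p)
    (γ : ℂ_[p]) (hγ : γ ∈ IntermediateField.adjoin ℚ_[p] {ζ})
    (hγ_zero : HasSum (fun k : ℕ => γ ^ p ^ k / (p : ℂ_[p]) ^ k) 0)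
    (hγ_ord : ordp p γ = ((1 / ((p : ℝ) - 1) : ℝ) : WithTop ℝ))
    (g : ℂ_[p]) (hg : g ^ n = γ)
    -- the Frobenius automorphism and the Teichmüller representative of `t`
    (σ : Omega p a ζ g ≃ₐ[ℚ_[p]] Omega p a ζ g) (hσ : IsFrobenius p a ζ g σ)
    (τ : Omega p a ζ g) (hτ : IsTeichmuller p a red t (τ : ℂ_[p])) :
    ∃ A : Matrix (Fin (2 * n + 1)) (Fin (2 * n + 1)) (Omega p a ζ g),
      -- `A` is the matrix of `α₁` on `H²`; note `γ = γ̃ ^ n`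
      IsFrobeniusMatrix p n (Omega.integers p a ζ g)
        (Omega.gen p a ζ g) (Omega.gen p a ζ g ^ n) τ σ.toRingEquiv A ∧
      (∀ A' : Matrix (Fin (2 * n + 1)) (Fin (2 * n + 1)) (Omega p a ζ g),
        IsFrobeniusMatrix p n (Omega.integers p a ζ g)
          (Omega.gen p a ζ g) (Omega.gen p a ζ g ^ n) τ σ.toRingEquiv A' → A' = A) ∧
      -- `A.charpolyRev = det (1 - T A)`, and `b_m` is its coefficient of `T ^ m`
      ∀ m ∈ ({1, n, n + 1, 2 * n, 2 * n + 1} : Finset ℕ),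
        ordp p (A.charpolyRev.coeff m) =
          (((m : ℝ) * ((m : ℝ) - 1) / (2 * (n : ℝ)) : ℝ) : WithTop ℝ) := by
  have hγn := norm_pow_of_ordp hγ_ord
  have hfin := finiteDimensional_Omega hn ha hζ hγ hg
  have hcomplete : CompleteSpace (Omega p a ζ g) := FiniteDimensional.complete ℚ_[p] _
  have S := frobeniusData_Omega hp2 hn hnp ha hζ hγ hγ_zero hγn hg σ
    (norm_eq_one_of_isTeichmuller ha ht hτ)
  -- From here on membership in R is a bound on the norm.
  rw [integers_eq hn ha hp2 hζ hγ hγ_zero hγn hg]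
  obtain ⟨A, hA, hcoeff⟩ := S.exists_isFrobeniusMatrix
  refine ⟨A, hA, fun A' hA' => S.isFrobeniusMatrix_unique hA hA', fun m hm => ?_⟩
  -- The element γ̃ ^ (p-1) has order 1/n, since the n-th power of its norm is ‖γ‖ ^ (p-1) = ‖p‖.
  refine ordp_of_norm_eq (h := Omega.gen p a ζ g ^ (p - 1)) hn ?_ m (hcoeff m hm)
  rw [norm_pow, ← pow_mul, mul_comm]
  exact gen_norm_pow hγn hg
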